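/- **Setting.** Let $q\in\mathbb C\setminus\{0\}$, $m=N+1\ge 1$, and $$f(u,v)=\frac{qu-q^{-1}v}{u-v},\quad g(u,v)=\frac{q-q^{-1}}{u-v},\quad g^{(l)}(u,v)=u\,g(u,v),\quad g^{(r)}(u,v)=v\,g(u,v).$$ Let $R(u,v)=f(u,v)\sum_i E_{ii}\otimes E_{ii}+\sum_{i\neq j}E_{ii}\otimes E_{jj}+g(u,v)\sum_{i<j}(u\,E_{ij}\otimes E_{ji}+v\,E_{ji}\otimes E_{ij})$, $1\le i,j\le m$. A generalized $U_q(\widehat{\mathfrak{gl}}_m)$ based model is given by a monodromy matrix $T(u)=(T_{i,j}(u))_{i,j=1}^m$, $u\neq0$, with $R(u,v)(T(u)\otimes 1)(1\otimes T(v))=(1\otimes T(v))(T(u)\otimes 1)R(u,v)$ for $u\ne v$, a pseudovacuum $|0\rangle$ and a dual pseudovacuum $\langle 0|$ such that $T_{i,i}(u)|0\rangle=\lambda_i(u)|0\rangle$, $T_{i,j}(u)|0\rangle=0$ for $i>j$, $\langle0|T_{i,i}(u)=\lambda_i(u)\langle0|$, $\langle0|T_{i,j}(u)=0$ for $i<j$,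 $\langle0|0\rangle=1$, where the $\lambda_i(u)$ are free functional parameters (independent indeterminates, the operators being linear over the Laurent polynomials in them). Put $\alpha_i(u)=\lambda_i(u)/\lambda_{i+1}(u)$, $i=1,\dots,N$. A function of one or two finite collections of variables means the product of its values over all (pairs of) elements; empty products are $1$. For collections $\bar t=(\bar t^1,\dots,\bar t^N)$ the Bethe vector $\mathbb B(\bar t|T)$ is given by the nested algebraic Bethe ansatz: $\mathbb B(\emptyset|T)=|0\rangle$ for $m=1$, and, with $r=\#\bar t^1$ and $\bar t^{N+1}=\emptyset$, $$\mathbb B(\bar t|T)=\sum_{k_1,\dots,k_r=2}^m\frac{T_{1,k_1}(t^1_1)\cdots T_{1,k_r}(t^1_r)}{\lambda_2(\bar t^1)f(\bar t^2,\bar t^1)}\bigl[\mathbb B(\bar t^2,\dots,\bar t^{N}|\widetilde T)\bigr]_{k_1,\dots,k_r},\qquad \widetilde T(u)=D(u)\,\mathsf r_{0,r}(u,t^1_r)\cdots\mathsf r_{0,1}(u,t^1_1),$$ where $D=(T_{i,j})_{i,j=2}^m$, $\mathsf r$ is the analogous $R$-matrix on $\mathbb C^{m-1}\otimes\mathbb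 C^{m-1}$ (basis $e_2,\dots,e_m$), and $\widetilde T$ has the pseudovacuum $|0\rangle\otimes e_2^{\otimes r}$. The dual Bethe vector is $\mathbb C_q(\bar s)=\Psi(\mathbb B_{q^{-1}}(\bar s^{-1}))$ for the antimorphism $\Psi:T_{a,b}(u)\mapsto \widetilde T_{b,a}(u^{-1})$, $|0\rangle\mapsto\langle0|$, which exchanges $q$ and $q^{-1}$. For $\#\bar s^k=\#\bar t^k$ the highest coefficient $Z(\bar s|\bar t)\in\mathbb C$ is the coefficient of $\prod_{k=1}^N\alpha_k(\bar s^k)$ in the scalar product $\mathbb C(\bar s)\mathbb B(\bar t)$. The Bethe parameters are assumed generic: nonzero, pairwise distinct (within and between all the $\bar s^k$, $\bar t^k$), with no vanishing factor in $f(\bar s^{k+1},\bar s^k)$, $f(\bar t^{k+1},\bar t^k)$. **Proposition.** (a) *Let $N\ge1$ and let $\bar s^1_{I}$ be any fixed element of $\bar s^1$, $\bar s^1_{II}=\bar s^1\setminus\{\bar s^1_I\}$. Then, with $\bar s^{N+1}=\emptyset$,* $$\begin{aligned}Z(\bar s|\bar t)=\sum_{p=2}^{N+1}\ \sum_{\substack{\mathrm{part}(\bar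 s^2,\dots,\bar s^{p-1})\\ \mathrm{part}(\bar t^1,\dots,\bar t^{p-1})}} &\frac{g^{(l)}(\bar t^{1}_{I},\bar s^{1}_{I})\,f(\bar t^{1}_{I},\bar t^{1}_{II})\,f(\bar t^{1}_{II},\bar s^{1}_{I})}{f(\bar s^{p},\bar s^{p-1}_{I})}\\ &\times\prod_{\nu=2}^{p-1}\frac{g^{(r)}(\bar s^{\nu}_{I},\bar s^{\nu-1}_{I})\,g^{(l)}(\bar t^{\nu}_{I},\bar t^{\nu-1}_{I})\,f(\bar s^{\nu}_{II},\bar s^{\nu}_{I})\,f(\bar t^{\nu}_{I},\bar t^{\nu}_{II})}{f(\bar s^{\nu},\bar s^{\nu-1}_{I})\,f(\bar t^{\nu}_{I},\bar t^{\nu-1})}\\ &\times Z\bigl(\{\bar s^k_{II}\}_1^{p-1},\{\bar s^k\}_p^N\,\big|\,\{\bar t^k_{II}\}_1^{p-1},\{\bar t^k\}_p^N\bigr).\end{aligned}$$ *For each $p$ the sum is over all partitions $\bar t^k\Rightarrow\{\bar t^k_I,\bar t^k_{II}\}$ ($1\le k\le p-1$) and $\bar s^k\Rightarrow\{\bar s^k_I,\bar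 s^k_{II}\}$ ($2\le k\le p-1$) with $\#\bar t^k_I=\#\bar s^k_I=1$; there is no sum over partitions of $\bar s^1$.* This recursion reduces $Z$ inductively to the $U_q(\widehat{\mathfrak{gl}}_2)$ case, in the following sense. (b) *If the first collections are empty, $Z$ is the highest coefficient of rank one less:* $Z^{(m)}(\emptyset,\bar s^1,\dots,\bar s^{N-1}|\emptyset,\bar t^1,\dots,\bar t^{N-1})=Z^{(m-1)}(\bar s^1,\dots,\bar s^{N-1}|\bar t^1,\dots,\bar t^{N-1})$ *for $m=N+1\ge2$ and any generalized models of ranks $m$ and $m-1$.* (c) *For $m=2$, $\bar s=\{s_1,\dots,s_r\}$, $\bar t=\{t_1,\dots,t_r\}$ with all $qt_i\ne q^{-1}s_j$, $Z$ is the Izergin–Korepin determinant* $$Z(\bar s|\bar t)=\frac{\prod_i t_i\,\prod_{i,j}(qt_i-q^{-1}s_j)}{\prod_{i<j}(t_i-t_j)(s_j-s_i)}\ \det_{1\le i,j\le r}\left[\frac{q-q^{-1}}{(t_i-s_j)(qt_i-q^{-1}s_j)}\right].$$ -/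

import Mathlib

/-! ## The rational functions and the R-matrix -/

/-- `f(u,v) = (q u - q⁻¹ v) / (u - v)`. -/
noncomputable def fFun (q u v : ℂ) : ℂ := (q * u - q⁻¹ * v) / (u - v)

/-- `g(u,v) = (q - q⁻¹) / (u - v)`. -/
noncomputable def gFun (q u v : ℂ) : ℂ := (q - q⁻¹) / (u - v)

/-- `g⁽ˡ⁾(u,v) = u g(u,v)`. -/
noncomputable def gL (q u v : ℂ) : ℂ := u * gFun q u v

/-- `g⁽ʳ⁾(u,v) = v g(u,v)`. -/
noncomputable def gR (q u v : ℂ) : ℂ := v * gFun q u v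

/-- The double product `f(ū, v̄)` over two collections of variables. -/
noncomputable def fProd (q : ℂ) (us vs : List ℂ) : ℂ :=
  (us.map fun u => (vs.map fun v => fFun q u v).prod).prod

/-- The trigonometric R-matrix of the vector representation,
`R = f ∑ᵢ Eᵢᵢ⊗Eᵢᵢ + ∑_{i≠j} Eᵢᵢ⊗Eⱼⱼ + g ∑_{i<j} (u Eᵢⱼ⊗Eⱼᵢ + v Eⱼᵢ⊗Eᵢⱼ)`.
The entry at `((a, c), (b, d))` is the coefficient of `E_{ab} ⊗ E_{cd}`. -/
noncomputable def RMat (q : ℂ) (m : ℕ) (u v : ℂ) : Matrix (Fin m × Fin m) (Fin m × Fin m) ℂ :=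
  Matrix.of fun ac bd =>
    if ac = bd then (if ac.1 = ac.2 then fFun q u v else 1)
    else if ac.1 = bd.2 ∧ ac.2 = bd.1 then
      (if ac.1 < ac.2 then u * gFun q u v else v * gFun q u v)
    else 0

/-! ## The generalized model -/

/-- The ring of Laurent polynomials over `ℂ` in the free functional parameters `λᵢ(u)`,
`1 ≤ i ≤ m`, `u ∈ ℂ`. -/
abbrev LamRing (m : ℕ) : Type := AddMonoidAlgebra ℂ ((Fin m × ℂ) →₀ ℤ)

/-- The free functional parameter `λᵢ(u)`. -/
noncomputable def lam {m : ℕ} (i : Fin m) (u : ℂ) : LamRing m :=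
  AddMonoidAlgebra.single (Finsupp.single (i, u) 1) 1

/-- The inverse `λᵢ(u)⁻¹`. -/
noncomputable def lamInv {m : ℕ} (i : Fin m) (u : ℂ) : LamRing m :=
  AddMonoidAlgebra.single (Finsupp.single (i, u) (-1)) 1

/-- A generalized `U_q(ĝl_m)` based model: a monodromy matrix `T(u)` (`u ≠ 0`) acting in `H` and
satisfying the `RTT`-relation
`R(u,v) (T(u) ⊗ 1) (1 ⊗ T(v)) = (1 ⊗ T(v)) (T(u) ⊗ 1) R(u,v)`,
with a pseudovacuum vector `|0⟩` and a dual pseudovacuum vector `⟨0|` such that `⟨0|0⟩ = 1`, whose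
vacuum eigenvalues `λᵢ(u)` are free functional parameters. -/
structure GenModel (q : ℂ) (m : ℕ) (H : Type*) [AddCommGroup H] [Module (LamRing m) H] where
  T : Fin m → Fin m → ℂ → Module.End (LamRing m) H
  vac : H
  bra : Module.Dual (LamRing m) H
  rtt : ∀ u v : ℂ, u ≠ 0 → v ≠ 0 → u ≠ v → ∀ a c i j : Fin m,
    (∑ b, ∑ d, algebraMap ℂ (LamRing m) (RMat q m u v (a, c) (b, d)) • (T b i u * T d j v)) =
      ∑ b, ∑ d, algebraMap ℂ (LamRing m) (RMat q m u v (b, d) (i, j)) • (T c d v * T a b u)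
  diag_vac : ∀ u : ℂ, u ≠ 0 → ∀ i, T i i u vac = lam i u • vac
  lower_vac : ∀ u : ℂ, u ≠ 0 → ∀ i j, j < i → T i j u vac = 0
  bra_diag : ∀ u : ℂ, u ≠ 0 → ∀ i, bra ∘ₗ T i i u = lam i u • bra
  bra_upper : ∀ u : ℂ, u ≠ 0 → ∀ i j, i < j → bra ∘ₗ T i j u = 0
  bra_vac : bra vac = 1

/-! ## Bethe vectors -/

/-- The variables of the color with (zero-based) number `k`, and no variables at all if there is
no such color. -/
def colorOr {N : ℕ} (t : Fin N → List ℂ) (k : ℕ) : List ℂ :=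
  if h : k < N then t ⟨k, h⟩ else []

/-- The entries of the inhomogeneous monodromy matrix
`D(u) r_{0,r}(u, x_r) ⋯ r_{0,1}(u, x_1)` acting in `H ⊗ (ℂⁿ)^{⊗ r}`. A vector of this space is
given by its components, indexed by `κ : Fin r → Fin n`; here `κ j` belongs to the site that
carries the inhomogeneity `x j`. -/
noncomputable def chainMonodromy {K : Type*} [CommRing K] [Algebra ℂ K] (q : ℂ) (n : ℕ)
    {H : Type*} [AddCommGroup H] [Module K H] (D : Fin n → Fin n → ℂ → Module.End K H) :
    (r : ℕ) → (Fin r → ℂ) → Fin n → Fin n → ℂ → Module.End K ((Fin r → Fin n) → H)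
  | 0, _, i, j, u => LinearMap.pi fun κ => D i j u ∘ₗ LinearMap.proj κ
  | r + 1, x, i, j, u =>
      LinearMap.pi fun κ => ∑ k : Fin n, ∑ d : Fin n,
        algebraMap ℂ K (RMat q n u (x 0) (k, κ 0) (j, d)) •
          (LinearMap.proj (Fin.tail κ) ∘ₗ chainMonodromy q n D r (Fin.tail x) i k u ∘ₗ
            LinearMap.funLeft K H (fun κ' : Fin r → Fin n => (Fin.cons d κ' : Fin (r + 1) → Fin n)))

/-- The Bethe vector `𝔹(t̄¹, …, t̄ᴺ | T)` of a monodromy matrix `T` of size `N + 1` with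
pseudovacuum `vac`, by the nested algebraic Bethe ansatz:
`𝔹(t̄|T) = ∑_{k₁,…,k_r} T_{1,k₁}(t¹₁) ⋯ T_{1,k_r}(t¹_r) / (λ₂(t̄¹) f(t̄²,t̄¹)) ·
  [𝔹(t̄²,…,t̄ᴺ | T̃)]_{k₁,…,k_r}`,
where `T̃(u) = D(u) r_{0,r}(u,t¹_r) ⋯ r_{0,1}(u,t¹₁)`, `D` is the lower right `N × N` block of `T`,
and the pseudovacuum of `T̃` is `vac ⊗ e₂ ⊗ ⋯ ⊗ e₂`.
The argument `nu k u` is the inverse vacuum eigenvalue that normalizes the color `k`, namely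
`1 / λ_{k+1}(u)` for `k = 1, …, N`. Passing to `T̃` changes only the first of its vacuum
eigenvalues, `λ₂`, which does not enter the normalization of the colors `2, …, N`. -/
noncomputable def betheVec {K : Type*} [CommRing K] [Algebra ℂ K] (q : ℂ) :
    (N : ℕ) → {H : Type*} → [AddCommGroup H] → [Module K H] →
    (Fin (N + 1) → Fin (N + 1) → ℂ → Module.End K H) → (Fin N → ℂ → K) → H →
    (Fin N → List ℂ) → H
  | 0, _, _, _, _, _, vac, _ => vac
  | N + 1, _, _, _, T, nu, vac, t =>
      (((t 0).map (nu 0)).prod * algebraMap ℂ K (fProd q (colorOr t 1) (t 0))⁻¹) •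
        ∑ κ : Fin (t 0).length → Fin (N + 1),
          (List.ofFn fun j => T 0 (κ j).succ ((t 0).get j)).prod
            (betheVec q N
              (chainMonodromy q (N + 1) (fun i j u => T i.succ j.succ u) (t 0).length (t 0).get)
              (fun k => nu k.succ) (Pi.single (fun _ => 0) vac) (fun k => t k.succ) κ)

section

variable {q : ℂ} {N : ℕ} {H : Type*} [AddCommGroup H] [Module (LamRing (N + 1)) H]

/-- The Bethe vector `𝔹(t̄)` of a generalized model. -/
noncomputable def GenModel.B (M : GenModel q (N + 1) H) (t : Fin N → List ℂ) : H :=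
  betheVec q N M.T (fun k u => lamInv k.succ u) M.vac t

/-- The dual Bethe vector `ℂ(s̄)`. It is the image under the antimorphism
`Ψ : T_{a,b}(u) ↦ T̃_{b,a}(u⁻¹)`, `|0⟩ ↦ ⟨0|`, which exchanges `q` and `q⁻¹`: the Bethe vector for
`q⁻¹`, with parameters `s̄⁻¹`, of the monodromy matrix `T̃_{a,b}(u) = T_{b,a}(u⁻¹)ᵗ`, which acts in
the dual space and has the pseudovacuum `⟨0|` and the vacuum eigenvalues `λᵢ(u⁻¹)`. -/
noncomputable def GenModel.C (M : GenModel q (N + 1) H) (s : Fin N → List ℂ) :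
    Module.Dual (LamRing (N + 1)) H :=
  betheVec q⁻¹ N (fun a b u => (M.T b a u⁻¹).dualMap) (fun k u => lamInv k.succ u⁻¹) M.bra
    (fun k => (s k).map fun x => x⁻¹)

/-- The scalar product `S(s̄|t̄) = ℂ(s̄) 𝔹(t̄)`, a Laurent polynomial in the `λᵢ(u)`. -/
noncomputable def GenModel.S (M : GenModel q (N + 1) H) (s t : Fin N → List ℂ) : LamRing (N + 1) :=
  M.C s (M.B t)

/-- The exponent of the Laurent monomial `∏ₖ αₖ(s̄ᵏ)`, where `αₖ(u) = λₖ(u) / λₖ₊₁(u)`. -/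
noncomputable def alphaExp (s : Fin N → List ℂ) : (Fin (N + 1) × ℂ) →₀ ℤ :=
  ∑ k : Fin N, ((s k).map fun x =>
    Finsupp.single (k.castSucc, x) (1 : ℤ) - Finsupp.single (k.succ, x) (1 : ℤ)).sum

/-- The highest coefficient `Z(s̄|t̄)`: the coefficient of `∏ₖ αₖ(s̄ᵏ)` in `S(s̄|t̄)`. -/
noncomputable def GenModel.Z (M : GenModel q (N + 1) H) (s t : Fin N → List ℂ) : ℂ :=
  (M.S s t).coeff (alphaExp s)

end

/-- Generic Bethe parameters: they are nonzero and pairwise distinct, and the factors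
`f(s̄ᵏ⁺¹, s̄ᵏ)`, `f(t̄ᵏ⁺¹, t̄ᵏ)`, by which the (dual) Bethe vectors are divided, do not vanish. -/
structure IsGeneric (q : ℂ) {N : ℕ} (s t : Fin N → List ℂ) : Prop where
  ne_zero : ∀ k, (∀ x ∈ s k, x ≠ 0) ∧ (∀ x ∈ t k, x ≠ 0)
  nodup : ((List.ofFn s).flatten ++ (List.ofFn t).flatten).Nodup
  f_ne_zero : ∀ k l : Fin N, (l : ℕ) = k + 1 →
    (∀ x ∈ s l, ∀ y ∈ s k, fFun q x y ≠ 0) ∧ (∀ x ∈ t l, ∀ y ∈ t k, fFun q x y ≠ 0)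

/-! ## Partitions with one-element subsets

Colors are numbered from `0` here. For a color `p`, a function `I` on the colors encodes
one-element subsets of the collections of colors `0, …, p`: the chosen element of color `k ≤ p` is
the one at the position `I k`. For colors `k > p` nothing is chosen, and `I k = 0` by
convention. -/

/-- All choices of one element in each of the colors `0, …, p`. -/
def choices {N : ℕ} (t : Fin N → List ℂ) (p : Fin N) : Finset (Fin N → ℕ) :=
  Fintype.piFinset fun k => if k ≤ p then Finset.range (t k).length else {0}

/-- The chosen element `t^k_I`. -/
def chosen {N : ℕ} (t : Fin N → List ℂ) (I : Fin N → ℕ) (k : Fin N) : ℂ := (t k).getD (I k) 0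

/-- The collections that are left: the complements `t̄^k_II` for `k ≤ p`, and `t̄^k` for `k > p`. -/
def remaining {N : ℕ} (t : Fin N → List ℂ) (p : Fin N) (I : Fin N → ℕ) (k : Fin N) : List ℂ :=
  if k ≤ p then (t k).eraseIdx (I k) else t k

/-- The rational coefficient in the recursion for the highest coefficient, for chosen elements
`I` of `s̄` and `J` of `t̄` in the colors `0, …, p`. -/
noncomputable def recCoeff (q : ℂ) {n : ℕ} (s t : Fin (n + 1) → List ℂ) (p : Fin (n + 1))
    (I J : Fin (n + 1) → ℕ) : ℂ :=
  gL q (chosen t J 0) (chosen s I 0) * fProd q [chosen t J 0] (remaining t p J 0) *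
      fProd q (remaining t p J 0) [chosen s I 0] /
    fProd q (colorOr s ((p : ℕ) + 1)) [chosen s I p] *
  ∏ ν : Fin n with ν.castSucc < p,
    gR q (chosen s I ν.succ) (chosen s I ν.castSucc) *
      gL q (chosen t J ν.succ) (chosen t J ν.castSucc) *
      fProd q (remaining s p I ν.succ) [chosen s I ν.succ] *
      fProd q [chosen t J ν.succ] (remaining t p J ν.succ) /
    (fProd q (s ν.succ) [chosen s I ν.castSucc] * fProd q [chosen t J ν.succ] (t ν.castSucc))

/-- The Izergin–Korepin determinant. -/
noncomputable def izerginKorepin (q : ℂ) {r : ℕ} (s t : Fin r → ℂ) : ℂ :=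
  (∏ i, t i) * (∏ i, ∏ j, (q * t i - q⁻¹ * s j)) /
      (∏ i, ∏ j ∈ Finset.Ioi i, (t i - t j) * (s j - s i)) *
    (Matrix.of fun i j => (q - q⁻¹) / ((t i - s j) * (q * t i - q⁻¹ * s j))).det

/-! Rows and columns of `T` are numbered from 0. After removal of the normalization by the vacuum
eigenvalues, `Z` is the coefficient of the monomial `∏ λ_k(s^k) λ_{k+1}(t^k)` (`omegaExp`) in the
scalar product of `dualBv` and `bv` (see `GenModel.Z_eq_highCoeff`). The recursion compares two
expansions at this monomial.

On the dual side one variable `z = s^1_I` is split off. The transposed form of `bv_recursion` writes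
the dual Bethe vector as a combination of smaller dual Bethe vectors composed with first-column
entries `T_{p,0}(z)`, `p > 0` (`IsFreeModel.dualBv_recursion`). On the other side, `T_{p,0}(z)` must
act on the Bethe vector of `t`. Here one adds a site with inhomogeneity `z` to the quantum space and
contracts the components of the extended Bethe vector with row `p` of `T(z)` (the map `theta`). The
RTT relation evaluates this contraction in closed form (`theta_bv_color`). Its component 0 is the
original Bethe vector, which yields the wanted `T_{p,0}(z) B(t)`. Each other component carries a
factor `λ_0(t^1_I)` (`bv_site_color`) and cannot contribute: the scalar products are polynomials in
the `λ`, with nonnegative exponents only (`IsFreeModel.isNice_word`), and the target monomial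
contains no `λ_0` at a point of `t^1`.

Both formulas for one additional site rest on interpolation. With denominators cleared, the relevant
expression is a vector-valued polynomial of degree less than `#t^1` in the inhomogeneity. It is
evaluated at the points `a` of `t^1` for the components (`bv_site_succ`), and at the points `q²a`
for the contraction (`theta_bv_succ`). Bethe vectors are symmetric in the variables of each color
(`bv_perm`), so `a` may be moved to the first or to the last place, where a single term survives.
That term contains the Bethe vector of the next nesting level with one additional site at `a`, so
the formulas iterate over the colors and generate the partitions.

The symmetry argument divides by `f(a,b)` for all pairs of variables on the same side, while
genericity only excludes zeros between neighboring colors. The recursion is therefore proved first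
for `Nondeg` parameters and extended by perturbation. Continuity of the highest coefficient holds
because the reordering of operators uses only R-matrix entries and normalizing factors that stay
finite in the limit (`IsFreeModel.highCoeff_mem`).

For (b), an empty first color reduces `T` to its lower right block, and the recursion determines the
highest coefficient independently of the model (`IsFreeModel.highCoeff_unique`). For (c), the
determinant satisfies the same recursion (`izerginKorepin_succ`), by a column operation coming from
a partial fraction expansion. -/

set_option linter.unusedSectionVars false

/-! ## The R-matrix -/

section RMatrix

/-- The coefficient of `E_{ac} ⊗ E_{ca}`, `a ≠ c`, in the R-matrix. -/
noncomputable def gOff (q : ℂ) {n : ℕ} (u v : ℂ) (a c : Fin n) : ℂ :=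
  if a < c then u * gFun q u v else v * gFun q u v

variable {q : ℂ} {n : ℕ} {M : Type*} [AddCommGroup M] [Module ℂ M]

theorem RMat_apply (u v : ℂ) (a c b d : Fin n) :
    RMat q n u v (a, c) (b, d) =
      if a = b ∧ c = d then (if a = c then fFun q u v else 1)
      else if a = d ∧ c = b then gOff q u v a c else 0 := by
  simp only [RMat, Matrix.of_apply, Prod.mk.injEq, gOff]

/-- Ice rule: a row of the R-matrix has at most two nonzero entries. Every later use of the R-matrix
goes through such contracted sums. -/
theorem RMat_sum_row (u v : ℂ) (a c : Fin n) (X : Fin n → Fin n → M) :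
    ∑ b, ∑ d, RMat q n u v (a, c) (b, d) • X b d =
      if a = c then fFun q u v • X a a else X a c + gOff q u v a c • X c a := by
  by_cases h : a = c
  · subst h
    rw [Finset.sum_eq_single a, Finset.sum_eq_single a]
    · simp [RMat_apply]
    · intro d _ hd
      simp [RMat_apply, hd.symm]
    · simp
    · intro b _ hb
      exact Finset.sum_eq_zero fun d _ => by simp [RMat_apply, hb.symm]
    · simp
  · rw [if_neg h, ← Finset.add_sum_erase _ _ (Finset.mem_univ a)]
    congr 1
    · rw [Finset.sum_eq_single c]
      · simp [RMat_apply, h]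
      · intro d _ hd
        simp [RMat_apply, hd.symm, Ne.symm h]
      · simp
    · rw [Finset.sum_eq_single c, Finset.sum_eq_single a]
      · simp [RMat_apply, h]
      · intro d _ hd
        simp [RMat_apply, h, hd.symm]
      · simp
      · intro b hb hbc
        rw [Finset.mem_erase] at hb
        exact Finset.sum_eq_zero fun d _ => by simp [RMat_apply, hb.1.symm, Ne.symm hbc]
      · simp [Ne.symm h]

theorem RMat_sum_col (u v : ℂ) (i j : Fin n) (X : Fin n → Fin n → M) :
    ∑ b, ∑ d, RMat q n u v (b, d) (i, j) • X b d =
      if i = j then fFun q u v • X i i else X i j + gOff q u v j i • X j i := by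
  have h : ∀ b d, RMat q n u v (b, d) (i, j) =
      RMat q n u v (i, j) (b, d) + (if b = j ∧ d = i ∧ i ≠ j then
        gOff q u v j i - gOff q u v i j else 0) := by
    intro b d
    simp only [RMat_apply]
    by_cases h1 : b = i <;> by_cases h2 : d = j <;> by_cases h3 : b = j <;> by_cases h4 : d = i <;>
      by_cases h5 : i = j <;> simp_all [eq_comm]
  simp only [h, add_smul, Finset.sum_add_distrib, RMat_sum_row]
  by_cases hij : i = j
  · simp [hij]
  · rw [Finset.sum_eq_single j, Finset.sum_eq_single i]
    · simp [hij, sub_smul]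
    · intro d _ hd; simp [hd]
    · simp
    · intro b _ hb; exact Finset.sum_eq_zero fun d _ => by simp [hb]
    · simp

/-- The Yang-Baxter equation, contracted with an arbitrary tensor so that it applies directly to
components of vectors. By the ice rule only permutations of `(a, c, s)` occur, and the coefficients
depend only on the relative order of these indices; each order type is a rational identity. -/
theorem yang_baxter {u v w : ℂ} (hq : q ≠ 0) (huv : u ≠ v) (huw : u ≠ w) (hvw : v ≠ w)
    (a c s : Fin n) (X : Fin n → Fin n → Fin n → M) :
    (∑ b, ∑ d, RMat q n u v (a, c) (b, d) • ∑ b', ∑ s', RMat q n u w (b, s) (b', s') •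
      ∑ d', ∑ s'', RMat q n v w (d, s') (d', s'') • X b' d' s'') =
    ∑ d, ∑ s', RMat q n v w (c, s) (d, s') • ∑ b, ∑ s'', RMat q n u w (a, s') (b, s'') •
      ∑ b', ∑ d', RMat q n u v (b, d) (b', d') • X b' d' s'' := by
  have h1 := sub_ne_zero.mpr huv
  have h2 := sub_ne_zero.mpr huw
  have h3 := sub_ne_zero.mpr hvw
  simp only [RMat_sum_row, gOff]
  rcases lt_trichotomy a c with hac | hac | hac <;> rcases lt_trichotomy a s with has | has | has <;>
  rcases lt_trichotomy c s with hcs | hcs | hcs <;> first | (exfalso; omega) | skip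
  all_goals
    first
    | subst hac
    | have := hac.ne
      have := hac.ne'
      have := hac.not_gt
    first
    | subst has
    | have := has.ne
      have := has.ne'
      have := has.not_gt
    first
    | subst hcs
    | have := hcs.ne
      have := hcs.ne'
      have := hcs.not_gt
    | clear hcs
    simp only [*, if_true, if_false, fFun, gFun, lt_irrefl]
    first | done | (match_scalars <;> field_simp <;> ring)

end RMatrix

/-! ## Monodromy matrices and one-site extensions -/


section Monodromy

variable {q : ℂ} {n : ℕ} {K : Type*} [CommRing K] [Algebra ℂ K]
  {H : Type*} [AddCommGroup H] [Module K H] [Module ℂ H] [IsScalarTower ℂ K H]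

/-- The `RTT`-relation for spectral parameters in a set `U`. -/
def IsRTT (q : ℂ) (U : Set ℂ) (T : Fin n → Fin n → ℂ → Module.End K H) : Prop :=
  ∀ u ∈ U, ∀ v ∈ U, u ≠ v → ∀ (a c i j : Fin n) (x : H),
    (∑ b, ∑ d, RMat q n u v (a, c) (b, d) • T b i u (T d j v x)) =
      ∑ b, ∑ d, RMat q n u v (b, d) (i, j) • T c d v (T a b u x)

theorem sum_comm_pairs (F : Fin n → Fin n → Fin n → Fin n → H) :
    ∑ b, ∑ d, ∑ k, ∑ l, F b d k l = ∑ k, ∑ l, ∑ b, ∑ d, F b d k l := by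
  have := Finset.sum_comm (s := Finset.univ) (t := Finset.univ)
    (f := fun (p r : Fin n × Fin n) => F p.1 p.2 r.1 r.2)
  simpa only [Fintype.sum_prod_type] using this

namespace IsRTT

variable {U : Set ℂ} {T : Fin n → Fin n → ℂ → Module.End K H}

theorem ne_ne (h : IsRTT q U T) {u v : ℂ} (hu : u ∈ U) (hv : v ∈ U) (huv : u ≠ v)
    {a c i j : Fin n} (hac : a ≠ c) (hij : i ≠ j) (x : H) :
    T a i u (T c j v x) + gOff q u v a c • T c i u (T a j v x) =
      T c j v (T a i u x) + gOff q u v j i • T c i v (T a j u x) := by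
  have := h u hu v hv huv a c i j x
  rw [RMat_sum_row u v a c fun b d => T b i u (T d j v x),
    RMat_sum_col u v i j fun b d => T c d v (T a b u x)] at this
  simpa [hac, hij] using this

theorem ne_eq (h : IsRTT q U T) {u v : ℂ} (hu : u ∈ U) (hv : v ∈ U) (huv : u ≠ v)
    {a c : Fin n} (i : Fin n) (hac : a ≠ c) (x : H) :
    T a i u (T c i v x) + gOff q u v a c • T c i u (T a i v x) =
      fFun q u v • T c i v (T a i u x) := by
  have := h u hu v hv huv a c i i x
  rw [RMat_sum_row u v a c fun b d => T b i u (T d i v x),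
    RMat_sum_col u v i i fun b d => T c d v (T a b u x)] at this
  simpa [hac] using this

theorem eq_ne (h : IsRTT q U T) {u v : ℂ} (hu : u ∈ U) (hv : v ∈ U) (huv : u ≠ v)
    (a : Fin n) {i j : Fin n} (hij : i ≠ j) (x : H) :
    fFun q u v • T a i u (T a j v x) =
      T a j v (T a i u x) + gOff q u v j i • T a i v (T a j u x) := by
  have := h u hu v hv huv a a i j x
  rw [RMat_sum_row u v a a fun b d => T b i u (T d j v x),
    RMat_sum_col u v i j fun b d => T a d v (T a b u x)] at this
  simpa [hij] using this

theorem eq_eq (h : IsRTT q U T) {u v : ℂ} (hu : u ∈ U) (hv : v ∈ U) (huv : u ≠ v)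
    (a i : Fin n) (x : H) :
    fFun q u v • T a i u (T a i v x) = fFun q u v • T a i v (T a i u x) := by
  have := h u hu v hv huv a a i i x
  rw [RMat_sum_row u v a a fun b d => T b i u (T d i v x),
    RMat_sum_col u v i i fun b d => T a d v (T a b u x)] at this
  simpa using this

theorem mono (h : IsRTT q U T) {U' : Set ℂ} (hU : U' ⊆ U) : IsRTT q U' T :=
  fun u hu v hv => h u (hU hu) v (hU hv)

theorem mul {A B : Fin n → Fin n → ℂ → Module.End K H} (hA : IsRTT q U A) (hB : IsRTT q U B)
    (hAB : ∀ u v i k j l x, A i k u (B j l v x) = B j l v (A i k u x)) :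
    IsRTT q U (fun i j u => ∑ k, A i k u ∘ₗ B k j u) := by
  intro u hu v hv huv a c i j x
  have hsm : ∀ (c : ℂ) (i j : Fin n) (u : ℂ) (y : H), c • A i j u y = A i j u (c • y) :=
    fun c i j u y => ((A i j u).map_smul_of_tower c y).symm
  calc ∑ b, ∑ d, RMat q n u v (a, c) (b, d) •
      (∑ k, A b k u ∘ₗ B k i u) ((∑ k, A d k v ∘ₗ B k j v) x)
      = ∑ b, ∑ d, ∑ k, ∑ l, RMat q n u v (a, c) (b, d) •
          A b k u (A d l v (B k i u (B l j v x))) := by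
        simp only [LinearMap.sum_apply, LinearMap.comp_apply, map_sum, Finset.smul_sum, hAB]
        exact Finset.sum_congr rfl fun b _ => Finset.sum_congr rfl fun d _ => Finset.sum_comm
    _ = ∑ k, ∑ l, ∑ b, ∑ d, RMat q n u v (b, d) (k, l) •
          A c d v (A a b u (B k i u (B l j v x))) := by
        rw [sum_comm_pairs]
        exact Finset.sum_congr rfl fun k _ => Finset.sum_congr rfl fun l _ =>
          hA u hu v hv huv a c k l _
    _ = ∑ b, ∑ d, A c d v (A a b u (∑ k, ∑ l, RMat q n u v (b, d) (k, l) •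
          B k i u (B l j v x))) := by
        rw [sum_comm_pairs]
        simp only [map_sum, hsm]
    _ = ∑ b, ∑ d, ∑ k, ∑ l, RMat q n u v (k, l) (i, j) •
          A c d v (B d l v (A a b u (B b k u x))) := by
        simp only [hB u hu v hv huv _ _ i j x, map_sum, ← hsm, ← hAB]
    _ = _ := by
        rw [sum_comm_pairs]
        refine Finset.sum_congr rfl fun k _ => Finset.sum_congr rfl fun l _ => ?_
        simp only [LinearMap.sum_apply, LinearMap.comp_apply, map_sum, Finset.smul_sum]

end IsRTT

/-- The entries of the R-matrix `r(u, z)` acting in one additional site. -/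
noncomputable def siteR (q : ℂ) (z : ℂ) (i j : Fin n) (u : ℂ) : Module.End K (Fin n → H) :=
  LinearMap.pi fun c => ∑ d, RMat q n u z (i, c) (j, d) • LinearMap.proj d

/-- The monodromy matrix `D(u) r(u, z)` with one additional site. -/
noncomputable def site (q : ℂ) (D : Fin n → Fin n → ℂ → Module.End K H) (z : ℂ)
    (i j : Fin n) (u : ℂ) : Module.End K (Fin n → H) :=
  LinearMap.pi fun c => ∑ k, ∑ d, RMat q n u z (k, c) (j, d) • (D i k u ∘ₗ LinearMap.proj d)

section site

variable (D : Fin n → Fin n → ℂ → Module.End K H) (z : ℂ)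

theorem site_apply (i j : Fin n) (u : ℂ) (X : Fin n → H) (c : Fin n) :
    site q D z i j u X c = ∑ k, ∑ d, RMat q n u z (k, c) (j, d) • D i k u (X d) := by
  simp [site, LinearMap.sum_apply]

/-- By the ice rule, column `j` of the extended matrix mixes components only in the component of
index `j`; in all others `D` acts alone (`site_apply_ne`). This dichotomy replaces the R-matrix in
what follows. -/
theorem site_apply_self (i j : Fin n) (u : ℂ) (X : Fin n → H) :
    site q D z i j u X j = ∑ k, (if k = j then fFun q u z else gOff q u z k j) • D i k u (X k) := by
  rw [site_apply]
  refine Finset.sum_congr rfl fun k _ => ?_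
  rw [Finset.sum_eq_single k]
  · by_cases hk : k = j
    · subst hk; simp [RMat_apply]
    · simp [RMat_apply, hk]
  · intro d _ hd
    by_cases hk : k = j
    · subst hk; simp [RMat_apply, hd.symm]
    · simp [RMat_apply, hk, hd.symm]
  · simp

theorem site_apply_ne {i j c : Fin n} (hc : c ≠ j) (u : ℂ) (X : Fin n → H) :
    site q D z i j u X c = D i j u (X c) := by
  rw [site_apply, Finset.sum_eq_single j, Finset.sum_eq_single c]
  · simp [RMat_apply, hc.symm]
  · intro d _ hd; simp [RMat_apply, hd.symm, hc]
  · simp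
  · intro k _ hk
    exact Finset.sum_eq_zero fun d _ => by simp [RMat_apply, hk, hc]
  · simp

theorem siteR_apply (i j : Fin n) (u : ℂ) (X : Fin n → H) (c : Fin n) :
    siteR (K := K) q z i j u X c = ∑ d, RMat q n u z (i, c) (j, d) • X d := by
  simp [siteR, LinearMap.sum_apply]

theorem isRTT_siteR (hq : q ≠ 0) {U : Set ℂ} (hz : z ∉ U) :
    IsRTT q U (siteR (K := K) (H := H) (n := n) q z) := by
  intro u hu v hv huv a c i j x
  ext s
  have huz : u ≠ z := fun h => hz (h ▸ hu)
  have hvz : v ≠ z := fun h => hz (h ▸ hv)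
  -- The delta in the first two slots selects the columns `i` and `j`; the third slot carries the
  -- vector.
  have := yang_baxter hq huv huz hvz a c s
    (fun b' d' s'' => if b' = i ∧ d' = j then x s'' else 0)
  simp only [Finset.sum_apply, Pi.smul_apply, siteR_apply]
  simp only [ite_and, smul_ite, smul_zero, Finset.sum_ite_eq', Finset.sum_ite_irrel,
    Finset.sum_const_zero, Finset.mem_univ, if_true, Finset.smul_sum] at this ⊢
  rw [this, Finset.sum_comm (s := Finset.univ) (t := Finset.univ) (f := fun b d => ∑ s', ∑ s'',
    RMat q n u v (b, d) (i, j) • RMat q n v z (c, s) (d, s') • RMat q n u z (a, s') (b, s'') •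
      x s'')]
  refine Finset.sum_congr rfl fun d _ => ?_
  rw [Finset.sum_comm (s := Finset.univ) (t := Finset.univ) (f := fun b s' => ∑ s'',
    RMat q n u v (b, d) (i, j) • RMat q n v z (c, s) (d, s') • RMat q n u z (a, s') (b, s'') •
      x s'')]
  refine Finset.sum_congr rfl fun s' _ => Finset.sum_congr rfl fun b _ =>
    Finset.sum_congr rfl fun s'' _ => ?_
  simp only [smul_smul]
  congr 1
  ring

theorem IsRTT.oneSite {D : Fin n → Fin n → ℂ → Module.End K H} (hq : q ≠ 0) {U : Set ℂ} (hz : z ∉ U)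
    (hD : IsRTT q U D) : IsRTT q U (site q D z) := by
  have hA : IsRTT q U (fun i j u => LinearMap.pi fun c => D i j u ∘ₗ LinearMap.proj c :
      Fin n → Fin n → ℂ → Module.End K (Fin n → H)) := by
    intro u hu v hv huv a c i j x
    ext s
    simpa [Finset.sum_apply] using hD u hu v hv huv a c i j (x s)
  have hB := isRTT_siteR (K := K) (H := H) (n := n) z hq hz
  convert hA.mul hB ?_ using 4 with i j u
  · ext X c
    simp [site_apply, siteR_apply]
  · intro u v i k j l x
    ext c
    simp [siteR_apply, map_sum]

end site

/-- A monodromy matrix with a pseudovacuum: the `RTT`-relation and the vacuum conditions hold for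
spectral parameters in a cofinite set `U`, on which the vacuum eigenvalues are invertible. -/
structure IsVacModel (q : ℂ) (U : Set ℂ) (T : Fin n → Fin n → ℂ → Module.End K H) (vac : H)
    (ell : Fin n → ℂ → K) : Prop where
  rtt : IsRTT q U T
  diag : ∀ u ∈ U, ∀ i, T i i u vac = ell i u • vac
  lower : ∀ u ∈ U, ∀ i j, j < i → T i j u vac = 0
  unit : ∀ u ∈ U, ∀ i, IsUnit (ell i u)
  cofinite : Uᶜ.Finite

/-- The spectral parameters at which the one-site extension of a model is nondegenerate. -/
def siteSet (q z : ℂ) (U : Set ℂ) : Set ℂ := {u ∈ U | u ≠ z ∧ fFun q u z ≠ 0}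

/-- The vacuum eigenvalues of a one-site extension. -/
noncomputable def siteEll (q z : ℂ) (ell : Fin (n + 1) → ℂ → K) (i : Fin (n + 1)) (u : ℂ) : K :=
  if i = 0 then algebraMap ℂ K (fFun q u z) * ell 0 u else ell i u

theorem fFun_ne_zero_of_ne {q u z : ℂ} (h : u ≠ z) (h' : q * u - q⁻¹ * z ≠ 0) :
    fFun q u z ≠ 0 := div_ne_zero h' (sub_ne_zero.mpr h)

theorem siteSet_cofinite (hq : q ≠ 0) (z : ℂ) {U : Set ℂ} (hU : Uᶜ.Finite) :
    (siteSet q z U)ᶜ.Finite := by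
  refine (hU.union (Set.toFinite {z, q⁻¹ * (q⁻¹ * z)})).subset fun u hu => ?_
  by_contra h
  simp only [Set.mem_union, Set.mem_compl_iff, not_or, not_not, Set.mem_insert_iff,
    Set.mem_singleton_iff] at h
  refine hu ⟨h.1, h.2.1, fFun_ne_zero_of_ne h.2.1 fun h0 => h.2.2 ?_⟩
  rw [← sub_eq_zero.mp h0, inv_mul_cancel_left₀ hq]

theorem IsVacModel.oneSite (hq : q ≠ 0) {U : Set ℂ}
    {T : Fin (n + 1) → Fin (n + 1) → ℂ → Module.End K H} {vac : H} {ell : Fin (n + 1) → ℂ → K}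
    (h : IsVacModel q U T vac ell) (z : ℂ) :
    IsVacModel q (siteSet q z U) (site q T z) (Pi.single 0 vac) (siteEll q z ell) where
  rtt := (h.rtt.mono fun u hu => hu.1).oneSite z hq fun hz => hz.2.1 rfl
  diag u hu i := by
    ext c
    by_cases hc : c = i
    · subst hc
      rw [site_apply_self, Finset.sum_eq_single 0]
      · by_cases hc : c = 0
        · subst hc
          simp [siteEll, h.diag u hu.1, mul_smul]
        · simp [siteEll, hc, Ne.symm hc, h.lower u hu.1 c 0 (Fin.pos_of_ne_zero hc)]
      · intro k _ hk; simp [hk]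
      · simp
    · rw [site_apply_ne _ _ hc]
      by_cases hc0 : c = 0
      · subst hc0
        simp [siteEll, Ne.symm hc, h.diag u hu.1]
      · simp [hc0]
  lower u hu i j hij := by
    ext c
    by_cases hc : c = j
    · subst hc
      rw [site_apply_self, Finset.sum_eq_single 0]
      · simp [h.lower u hu.1 i 0 ((Fin.zero_le c).trans_lt hij)]
      · intro k _ hk; simp [hk]
      · simp
    · rw [site_apply_ne _ _ hc]
      by_cases hc0 : c = 0
      · subst hc0
        simp [h.lower u hu.1 i j hij]
      · simp [hc0]
  unit u hu i := by
    unfold siteEll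
    split_ifs
    · exact ((IsUnit.mk0 _ hu.2.2).map _).mul (h.unit u hu.1 0)
    · exact h.unit u hu.1 i
  cofinite := siteSet_cofinite hq z h.cofinite

/-- The lower right block of a monodromy matrix. -/
def lowerBlock (T : Fin (n + 1) → Fin (n + 1) → ℂ → Module.End K H) (i j : Fin n) (u : ℂ) :
    Module.End K H := T i.succ j.succ u

theorem gOff_succ (u v : ℂ) (a c : Fin n) : gOff q u v a.succ c.succ = gOff q u v a c := by
  simp [gOff]

theorem IsRTT.block {U : Set ℂ} {T : Fin (n + 1) → Fin (n + 1) → ℂ → Module.End K H}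
    (h : IsRTT q U T) : IsRTT q U (lowerBlock T) := by
  intro u hu v hv huv a c i j x
  have := h u hu v hv huv a.succ c.succ i.succ j.succ x
  rw [RMat_sum_row u v _ _ fun b d => T b i.succ u (T d j.succ v x),
    RMat_sum_col u v _ _ fun b d => T c.succ d v (T a.succ b u x)] at this
  rw [RMat_sum_row u v a c fun b d => lowerBlock T b i u (lowerBlock T d j v x),
    RMat_sum_col u v i j fun b d => lowerBlock T c d v (lowerBlock T a b u x)]
  simpa [gOff_succ, Fin.succ_inj, lowerBlock] using this

theorem IsVacModel.block {U : Set ℂ} {T : Fin (n + 1) → Fin (n + 1) → ℂ → Module.End K H}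
    {vac : H} {ell : Fin (n + 1) → ℂ → K} (h : IsVacModel q U T vac ell) :
    IsVacModel q U (lowerBlock T) vac (fun i => ell i.succ) where
  rtt := h.rtt.block
  diag u hu i := h.diag u hu i.succ
  lower u hu _ _ hij := h.lower u hu _ _ (Fin.succ_lt_succ_iff.mpr hij)
  unit u hu i := h.unit u hu i.succ
  cofinite := h.cofinite

end Monodromy

/-! ## Bethe vectors by recursion over lists -/

section Bethe

variable {q : ℂ} {n : ℕ} {K : Type*} [CommRing K] [Algebra ℂ K]
  {H : Type*} [AddCommGroup H] [Module K H] [Module ℂ H] [IsScalarTower ℂ K H]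

/-- The chain `D(u) r_{0,r}(u, x_r) ⋯ r_{0,1}(u, x_1)` over a list of inhomogeneities. -/
noncomputable def chainL (q : ℂ) (D : Fin n → Fin n → ℂ → Module.End K H) (l : List ℂ) :
    Fin n → Fin n → ℂ → Module.End K ((Fin l.length → Fin n) → H) :=
  chainMonodromy q n D l.length l.get

/-- The pseudovacuum of a chain. -/
noncomputable def vacL (n : ℕ) (vac : H) (l : List ℂ) : (Fin l.length → Fin (n + 1)) → H :=
  Pi.single (fun _ => 0) vac

/-- `W ↦ ∑_κ T_{1,κ₁}(l₁) ⋯ T_{1,κ_r}(l_r) W_κ`. -/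
noncomputable def evL (T : Fin (n + 1) → Fin (n + 1) → ℂ → Module.End K H) (l : List ℂ) :
    ((Fin l.length → Fin n) → H) →ₗ[K] H :=
  ∑ κ : Fin l.length → Fin n,
    (List.ofFn fun j => T 0 (κ j).succ (l.get j)).prod ∘ₗ LinearMap.proj κ

/-- The Bethe vector without the normalization by the vacuum eigenvalues. -/
noncomputable def bv (q : ℂ) (N : ℕ) (T : Fin (N + 1) → Fin (N + 1) → ℂ → Module.End K H)
    (vac : H) (t : Fin N → List ℂ) : H :=
  betheVec q N T (fun _ _ => (1 : K)) vac t

theorem evL_nil (T : Fin (n + 1) → Fin (n + 1) → ℂ → Module.End K H)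
    (W : (Fin ([] : List ℂ).length → Fin n) → H) : evL T [] W = W Fin.elim0 := by
  have : ∀ κ : Fin 0 → Fin n, κ = Fin.elim0 := fun κ => Subsingleton.elim _ _
  simp only [evL, LinearMap.sum_apply]
  exact (Fintype.sum_unique (ι := Fin 0 → Fin n) _).trans (by simp [this])

theorem evL_cons (T : Fin (n + 1) → Fin (n + 1) → ℂ → Module.End K H) (a : ℂ) (l : List ℂ)
    (W : (Fin (a :: l).length → Fin n) → H) :
    evL T (a :: l) W = ∑ k, T 0 k.succ a (evL T l fun κ => W (Fin.cons k κ)) := by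
  simp only [evL, LinearMap.sum_apply, map_sum]
  rw [← Fintype.sum_prod_type']
  refine (Fintype.sum_equiv (Fin.consEquiv fun _ : Fin (l.length + 1) => Fin n) _ _ ?_).symm
  rintro ⟨k, κ⟩
  simp [Fin.consEquiv, List.ofFn_succ]

theorem chainL_nil (D : Fin n → Fin n → ℂ → Module.End K H) (i j : Fin n) (u : ℂ)
    (X : (Fin ([] : List ℂ).length → Fin n) → H) (κ) : chainL q D [] i j u X κ = D i j u (X κ) :=
  rfl

/-- The head of the list is the outermost site, so a chain is an iterated one-site extension and
facts about one site lift to chains by induction. -/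
theorem chainL_cons (D : Fin n → Fin n → ℂ → Module.End K H) (a : ℂ) (l : List ℂ) (i j : Fin n)
    (u : ℂ) (X : (Fin (a :: l).length → Fin n) → H) (c : Fin n) (κ) :
    chainL q D (a :: l) i j u X (Fin.cons c κ) =
      site q (chainL q D l) a i j u (fun d κ' => X (Fin.cons d κ')) c κ := by
  simp only [site_apply, chainL, List.length_cons, chainMonodromy, LinearMap.pi_apply,
    LinearMap.sum_apply, Finset.sum_apply, Pi.smul_apply, algebraMap_smul, LinearMap.smul_apply]
  simp only [LinearMap.comp_apply, LinearMap.proj_apply, Fin.tail_cons, Fin.cons_zero]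
  rfl

theorem vacL_cons (vac : H) (a : ℂ) (l : List ℂ) (c : Fin (n + 1)) (κ) :
    vacL n vac (a :: l) (Fin.cons c κ) =
      (Pi.single 0 (vacL n vac l) : Fin (n + 1) → (Fin l.length → Fin (n + 1)) → H) c κ := by
  by_cases hc : c = 0
  · subst hc
    by_cases hk : κ = fun _ => 0
    · subst hk
      have : (Fin.cons 0 (fun _ => 0) : Fin (l.length + 1) → Fin (n + 1)) = fun _ => 0 := by
        ext i; refine Fin.cases ?_ (fun _ => ?_) i <;> simp
      simp only [vacL, List.length_cons, Pi.single_eq_same]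
      rw [this, Pi.single_eq_same]
    · have : (Fin.cons 0 κ : Fin (l.length + 1) → Fin (n + 1)) ≠ fun _ => 0 := by
        intro h
        exact hk (funext fun i => by simpa using congrFun h i.succ)
      simp only [vacL, List.length_cons, Pi.single_eq_same]
      rw [Pi.single_eq_of_ne this, Pi.single_eq_of_ne hk]
  · have : (Fin.cons c κ : Fin (l.length + 1) → Fin (n + 1)) ≠ fun _ => 0 := by
      intro h
      exact hc (by simpa using congrFun h 0)
    simp only [vacL, List.length_cons]
    rw [Pi.single_eq_of_ne this, Pi.single_eq_of_ne hc, Pi.zero_apply]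

theorem bv_zero (T : Fin (0 + 1) → Fin (0 + 1) → ℂ → Module.End K H) (vac : H)
    (t : Fin 0 → List ℂ) : bv q 0 T vac t = vac := rfl

theorem bv_succ {N : ℕ} (T : Fin (N + 1 + 1) → Fin (N + 1 + 1) → ℂ → Module.End K H) (vac : H)
    (t : Fin (N + 1) → List ℂ) :
    bv q (N + 1) T vac t = (fProd q (colorOr t 1) (t 0))⁻¹ • evL T (t 0)
      (bv q N (chainL q (lowerBlock T) (t 0)) (vacL N vac (t 0)) fun k => t k.succ) := by
  simp only [bv, betheVec, List.map_const', List.prod_replicate, one_pow, one_mul,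
    algebraMap_smul, evL, LinearMap.sum_apply, LinearMap.comp_apply, LinearMap.proj_apply]
  rfl

/-- Linear relations. -/
structure IsLinRel {H H' : Type*} [AddCommGroup H] [Module ℂ H] [AddCommGroup H'] [Module ℂ H']
    (Rel : H → H' → Prop) : Prop where
  zero : Rel 0 0
  add : ∀ {x y x' y'}, Rel x x' → Rel y y' → Rel (x + y) (x' + y')
  smul : ∀ (c : ℂ) {x x'}, Rel x x' → Rel (c • x) (c • x')

section Rel

variable {K' : Type*} [CommRing K'] [Algebra ℂ K']
  {H' : Type*} [AddCommGroup H'] [Module K' H'] [Module ℂ H'] [IsScalarTower ℂ K' H']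

theorem IsLinRel.sum {Rel : H → H' → Prop} (hR : IsLinRel Rel) {ι : Type*} (s : Finset ι)
    (f : ι → H) (g : ι → H') (h : ∀ i, Rel (f i) (g i)) : Rel (∑ i ∈ s, f i) (∑ i ∈ s, g i) := by
  classical
  induction s using Finset.induction_on with
  | empty => simpa using hR.zero
  | insert a s ha ih => rw [Finset.sum_insert ha, Finset.sum_insert ha]; exact hR.add (h a) ih

theorem IsLinRel.pi {Rel : H → H' → Prop} (hR : IsLinRel Rel) (ι : Type*) :
    IsLinRel fun (X : ι → H) (Y : ι → H') => ∀ i, Rel (X i) (Y i) where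
  zero _ := hR.zero
  add hx hy i := hR.add (hx i) (hy i)
  smul c _ _ hx i := hR.smul c (hx i)

theorem chainMonodromy_rel {Rel Rel' : H → H' → Prop} (hR : IsLinRel Rel') {u : ℂ}
    {D : Fin n → Fin n → ℂ → Module.End K H} {D' : Fin n → Fin n → ℂ → Module.End K' H'}
    (hD : ∀ i j x y, Rel x y → Rel' (D i j u x) (D' i j u y)) :
    ∀ (r : ℕ) (a : Fin r → ℂ) (i j : Fin n) (X : (Fin r → Fin n) → H) (Y : (Fin r → Fin n) → H'),
      (∀ κ, Rel (X κ) (Y κ)) →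
      ∀ κ, Rel' (chainMonodromy q n D r a i j u X κ) (chainMonodromy q n D' r a i j u Y κ)
  | 0, _, i, j, _, _, h, κ => hD i j _ _ (h κ)
  | r + 1, a, i, j, X, Y, h, κ => by
    simp only [chainMonodromy, LinearMap.pi_apply, LinearMap.sum_apply, algebraMap_smul, LinearMap.smul_apply]
    refine hR.sum _ _ _ fun k => hR.sum _ _ _ fun d => hR.smul _ ?_
    exact chainMonodromy_rel hR hD r _ i k _ _ (fun κ' => h _) _

theorem evL_rel {Rel : H → H' → Prop} (hR : IsLinRel Rel)
    {T : Fin (n + 1) → Fin (n + 1) → ℂ → Module.End K H}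
    {T' : Fin (n + 1) → Fin (n + 1) → ℂ → Module.End K' H'} :
    ∀ (l : List ℂ) (_ : ∀ u ∈ l, ∀ j x y, Rel x y → Rel (T 0 j u x) (T' 0 j u y))
      (X : (Fin l.length → Fin n) → H) (Y : (Fin l.length → Fin n) → H'),
      (∀ κ, Rel (X κ) (Y κ)) → Rel (evL T l X) (evL T' l Y)
  | [], _, _, _, h => by rw [evL_nil, evL_nil]; exact h _
  | a :: l, hT, X, Y, h => by
    rw [evL_cons, evL_cons]
    refine hR.sum _ _ _ fun k => hT a (by simp) _ _ _ ?_
    exact evL_rel hR l (fun u hu => hT u (by simp [hu])) _ _ fun κ => h _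

end Rel

/-- A Bethe vector is built from the vacuum by complex linear combinations and monodromy entries, so
a linear relation respected by these passes to Bethe vectors. Maps of modules, rescaling of the
vacuum and re-indexing of the tensor factors are all instances. -/
theorem bv_rel {K K' : Type*} [CommRing K] [Algebra ℂ K] [CommRing K'] [Algebra ℂ K'] :
    ∀ (N : ℕ) {H H' : Type*} [AddCommGroup H] [Module K H] [Module ℂ H] [IsScalarTower ℂ K H]
      [AddCommGroup H'] [Module K' H'] [Module ℂ H'] [IsScalarTower ℂ K' H']
      {Rel : H → H' → Prop} (_ : IsLinRel Rel)
      {T : Fin (N + 1) → Fin (N + 1) → ℂ → Module.End K H}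
      {T' : Fin (N + 1) → Fin (N + 1) → ℂ → Module.End K' H'} {vac : H} {vac' : H'}
      (t : Fin N → List ℂ)
      (_ : ∀ k, ∀ u ∈ t k, ∀ i j x y, Rel x y → Rel (T i j u x) (T' i j u y)) (_ : Rel vac vac'),
      Rel (bv q N T vac t) (bv q N T' vac' t)
  | 0, _, _, _, _, _, _, _, _, _, _, _, _, _, _, _, _, _, _, h => h
  | N + 1, H, H', _, _, _, _, _, _, _, _, Rel, hR, T, T', vac, vac', t, hT, hv => by
    rw [bv_succ, bv_succ]
    refine hR.smul _ (evL_rel hR _ (fun u hu j => hT 0 u hu 0 j) _ _ ?_)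
    refine bv_rel N (hR.pi _) _ (fun k u hu i j x y h => ?_) ?_
    · exact chainMonodromy_rel hR (fun i j x y => hT k.succ u hu i.succ j.succ x y) _ _ _ _ _ _ h
    · intro κ
      by_cases h : κ = fun _ => 0
      · subst h; simpa [vacL] using hv
      · simpa [vacL, h] using hR.zero

theorem bv_map {N : ℕ} {H' : Type*} [AddCommGroup H'] [Module K H'] [Module ℂ H']
    [IsScalarTower ℂ K H'] (Φ : H →ₗ[K] H')
    {T : Fin (N + 1) → Fin (N + 1) → ℂ → Module.End K H}
    {T' : Fin (N + 1) → Fin (N + 1) → ℂ → Module.End K H'} (vac : H) (t : Fin N → List ℂ)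
    (hT : ∀ k, ∀ u ∈ t k, ∀ i j x, Φ (T i j u x) = T' i j u (Φ x)) :
    Φ (bv q N T vac t) = bv q N T' (Φ vac) t :=
  bv_rel N (Rel := fun x y => Φ x = y)
    ⟨map_zero _, fun h h' => by rw [map_add, h, h'],
      fun c _ _ h => by rw [LinearMap.map_smul_of_tower, h]⟩ t
    (fun k u hu i j x y h => by rw [hT k u hu, h]) rfl

theorem bv_smul {N : ℕ} (T : Fin (N + 1) → Fin (N + 1) → ℂ → Module.End K H) (c : ℂ) (vac : H)
    (t : Fin N → List ℂ) : bv q N T (c • vac) t = c • bv q N T vac t :=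
  (bv_rel N (Rel := fun x y => c • x = y) (T := T) (T' := T) (vac := vac)
    ⟨smul_zero _, fun h h' => by rw [smul_add, h, h'], fun d _ _ h => by rw [smul_comm, h]⟩ t
    (fun k u hu i j x y h => by rw [← h, LinearMap.map_smul_of_tower]) rfl).symm

theorem bv_chainL_cons {N : ℕ} (D : Fin (N + 1) → Fin (N + 1) → ℂ → Module.End K H) (vac : H)
    (a : ℂ) (l : List ℂ) (t : Fin N → List ℂ) (c : Fin (N + 1)) (κ) :
    bv q N (chainL q D (a :: l)) (vacL N vac (a :: l)) t (Fin.cons c κ) =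
      bv q N (site q (chainL q D l) a) (Pi.single 0 (vacL N vac l)) t c κ := by
  refine bv_rel (q := q) N (Rel := fun (X : (Fin (a :: l).length → Fin (N + 1)) → H)
      (Y : Fin (N + 1) → (Fin l.length → Fin (N + 1)) → H) => ∀ c κ, X (Fin.cons c κ) = Y c κ)
    ⟨fun _ _ => rfl, fun h h' c κ => ?_, fun z _ _ h c κ => ?_⟩ t (fun k u hu i j x y h c κ => ?_)
    (vacL_cons vac a l) c κ
  · simp [h c κ, h' c κ]
  · simp [h c κ]
  · rw [chainL_cons]
    have : (fun d κ' => x (Fin.cons d κ')) = y := funext fun d => funext fun κ' => h d κ'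
    rw [this]

end Bethe

/-! ## Symmetry of the Bethe vectors -/

section Symmetry

variable {q : ℂ} {n : ℕ} {K : Type*} [CommRing K] [Algebra ℂ K]
  {H : Type*} [AddCommGroup H] [Module K H] [Module ℂ H] [IsScalarTower ℂ K H]

/-- The set of parameters at which a chain is nondegenerate. -/
def chainSet (q : ℂ) (l : List ℂ) (U : Set ℂ) : Set ℂ := {u ∈ U | ∀ x ∈ l, u ≠ x ∧ fFun q u x ≠ 0}

/-- The vacuum eigenvalues of a chain. -/
noncomputable def chainEll (q : ℂ) (l : List ℂ) (ell : Fin (n + 1) → ℂ → K) (i : Fin (n + 1))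
    (u : ℂ) : K :=
  if i = 0 then algebraMap ℂ K (l.map fun x => fFun q u x).prod * ell 0 u else ell i u

theorem IsVacModel.of_injective {H' : Type*} [AddCommGroup H'] [Module K H'] [Module ℂ H']
    [IsScalarTower ℂ K H'] {U : Set ℂ} {T : Fin n → Fin n → ℂ → Module.End K H}
    {T' : Fin n → Fin n → ℂ → Module.End K H'} {vac : H} {vac' : H'} {ell : Fin n → ℂ → K}
    (h : IsVacModel q U T vac ell) (Φ : H' →ₗ[K] H) (hΦ : Function.Injective Φ)
    (hT : ∀ i j u x, Φ (T' i j u x) = T i j u (Φ x)) (hv : Φ vac' = vac) :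
    IsVacModel q U T' vac' ell where
  rtt u hu v hv huv a c i j x := hΦ (by
    simp only [map_sum, LinearMap.map_smul_of_tower, hT]
    exact h.rtt u hu v hv huv a c i j (Φ x))
  diag u hu i := hΦ (by rw [hT, hv, h.diag u hu, map_smul, hv])
  lower u hu i j hij := hΦ (by rw [hT, hv, h.lower u hu i j hij, map_zero])
  unit := h.unit
  cofinite := h.cofinite

/-- The first site of a chain, separated. -/
def uncons (K : Type*) [CommRing K] [Module K H] (n r : ℕ) :
    ((Fin (r + 1) → Fin n) → H) →ₗ[K] (Fin n → (Fin r → Fin n) → H) where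
  toFun X := fun d κ => X (Fin.cons d κ)
  map_add' _ _ := rfl
  map_smul' _ _ := rfl

theorem uncons_injective (r : ℕ) : Function.Injective (uncons (H := H) K n r) := by
  intro X Y h
  funext κ
  have := congrFun (congrFun h (κ 0)) (Fin.tail κ)
  simpa [uncons] using this

theorem IsVacModel.chainL (hq : q ≠ 0) {U : Set ℂ}
    {T : Fin (n + 1) → Fin (n + 1) → ℂ → Module.End K H} {vac : H} {ell : Fin (n + 1) → ℂ → K}
    (h : IsVacModel q U T vac ell) : ∀ l : List ℂ,
    IsVacModel q (chainSet q l U) (chainL q T l) (vacL n vac l) (chainEll q l ell)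
  | [] => by
    have hU : chainSet q [] U = U := by simp [chainSet]
    have he : chainEll q [] ell = ell := by
      funext i u
      by_cases hi : i = 0 <;> simp [chainEll, hi]
    rw [hU, he]
    refine h.of_injective (T' := _root_.chainL q T []) (LinearMap.proj Fin.elim0)
      (fun X Y hXY => ?_) (fun i j u x => rfl) ?_
    · funext κ
      have : κ = Fin.elim0 := Subsingleton.elim (α := Fin 0 → Fin (n + 1)) _ _
      rw [this]; exact hXY
    · have : (Fin.elim0 : Fin 0 → Fin (n + 1)) = fun _ => 0 := Subsingleton.elim _ _
      simp only [LinearMap.proj_apply, vacL, List.length_nil, this, Pi.single_eq_same]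
  | a :: l => by
    have hU : chainSet q (a :: l) U = siteSet q a (chainSet q l U) := by
      ext u
      simp only [chainSet, siteSet, List.mem_cons, forall_eq_or_imp, Set.mem_ofPred_eq]
      tauto
    have he : chainEll q (a :: l) ell = siteEll q a (chainEll q l ell) := by
      funext i u
      by_cases hi : i = 0 <;> simp [chainEll, siteEll, hi, mul_assoc]
    rw [hU, he]
    refine ((h.chainL hq l).oneSite hq a).of_injective (uncons K (n + 1) l.length)
      (uncons_injective _) (fun i j u X => ?_) ?_
    · funext c κ
      exact chainL_cons T a l i j u X c κ
    · funext c κ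
      exact vacL_cons vac a l c κ

/-- The R-matrix, followed by the permutation of the two sites. -/
noncomputable def rCheck (K : Type*) [CommRing K] [Algebra ℂ K] [Module K H] [IsScalarTower ℂ K H]
    (q : ℂ) (n : ℕ) (a x : ℂ) : (Fin n → Fin n → H) →ₗ[K] (Fin n → Fin n → H) where
  toFun X := fun s k => ∑ j, ∑ d, RMat q n a x (k, s) (j, d) • X j d
  map_add' X Y := by
    funext s k
    simp [Finset.sum_add_distrib]
  map_smul' c X := by
    funext s k
    simp only [Pi.smul_apply, RingHom.id_apply, Finset.smul_sum]
    exact Finset.sum_congr rfl fun _ _ => Finset.sum_congr rfl fun _ _ => smul_comm _ _ _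

theorem rCheck_apply (a x : ℂ) (X : Fin n → Fin n → H) (s k : Fin n) :
    rCheck K q n a x X s k = ∑ j, ∑ d, RMat q n a x (k, s) (j, d) • X j d := rfl

theorem sum_rotate {ι : Type*} [Fintype ι] (F : ι → ι → ι → H) :
    ∑ a, ∑ b, ∑ c, F a b c = ∑ c, ∑ a, ∑ b, F a b c := by
  calc _ = ∑ a, ∑ c, ∑ b, F a b c := Finset.sum_congr rfl fun a _ => Finset.sum_comm
    _ = _ := Finset.sum_comm

/-- Yang-Baxter for the parameters `u, a, x`: the R-matrix of two neighboring sites exchanges their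
inhomogeneities. -/
theorem rCheck_site (hq : q ≠ 0) (D : Fin n → Fin n → ℂ → Module.End K H) {a x u : ℂ}
    (hax : a ≠ x) (hua : u ≠ a) (hux : u ≠ x) (i j : Fin n) (X : Fin n → Fin n → H) :
    rCheck K q n a x (site q (site q D x) a i j u X) =
      site q (site q D a) x i j u (rCheck K q n a x X) := by
  funext s k
  have hsm : ∀ (c : ℂ) (p : Fin n) (y : H), c • D i p u y = D i p u (c • y) :=
    fun c p y => ((D i p u).map_smul_of_tower c y).symm
  have yb := fun p' => yang_baxter hq hua hux hax p' k s
    (fun b' d' s'' => if b' = j then X d' s'' else 0)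
  simp only [smul_ite, smul_zero, Finset.sum_ite_irrel, Finset.sum_const_zero,
    Finset.sum_ite_eq', Finset.mem_univ, if_true] at yb
  have yb' : ∀ p', (∑ p, ∑ e, RMat q n u a (p', k) (p, e) • ∑ e', RMat q n u x (p, s) (j, e') •
      rCheck K q n a x X e' e) = ∑ k', ∑ s', RMat q n a x (k, s) (k', s') • ∑ p, ∑ e',
        RMat q n u x (p', s') (p, e') • ∑ e, RMat q n u a (p, k') (j, e) • X e e' := yb
  calc rCheck K q n a x (site q (site q D x) a i j u X) s k
      = ∑ p', D i p' u (∑ k', ∑ s', RMat q n a x (k, s) (k', s') • ∑ p, ∑ e',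
          RMat q n u x (p', s') (p, e') • ∑ e, RMat q n u a (p, k') (j, e) • X e e') := by
        simp only [rCheck_apply, site_apply, Finset.sum_apply, Pi.smul_apply]
        simp only [hsm, Finset.smul_sum, map_sum]
        symm
        refine (sum_rotate _).symm.trans (Finset.sum_congr rfl fun k' _ =>
          Finset.sum_congr rfl fun s' _ => ?_)
        rw [Finset.sum_comm]
        refine Finset.sum_congr rfl fun p _ => ?_
        rw [sum_rotate]
        refine Finset.sum_congr rfl fun e _ => Finset.sum_congr rfl fun p' _ =>
          Finset.sum_congr rfl fun e' _ => ?_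
        rw [smul_comm (RMat q n u x (p', s') (p, e'))]
    _ = _ := by
        simp only [← yb']
        simp only [site_apply, Finset.sum_apply, Pi.smul_apply]
        simp only [hsm, Finset.smul_sum, map_sum]
        rw [Finset.sum_comm]
        refine Finset.sum_congr rfl fun p _ => ?_
        rw [sum_rotate]
        refine Finset.sum_congr rfl fun e' _ => Finset.sum_congr rfl fun p' _ =>
          Finset.sum_congr rfl fun e _ => ?_
        rw [smul_comm]

theorem rCheck_single {n : ℕ} (a x : ℂ) (vac : H) :
    rCheck K q (n + 1) a x (Pi.single 0 (Pi.single 0 vac)) =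
      fFun q a x • Pi.single 0 (Pi.single 0 vac) := by
  funext s k
  rw [rCheck_apply, Finset.sum_eq_single 0, Finset.sum_eq_single 0]
  · by_cases hs : s = 0
    · subst hs
      by_cases hk : k = 0
      · subst hk
        simp [RMat_apply]
      · simp [RMat_apply, hk]
    · simp [RMat_apply, hs]
  · intro d _ hd; simp [hd]
  · simp
  · intro j _ hj; simp [hj]
  · simp

/-- RTT with both row indices equal to 0: there one of the two R-matrices acts as the scalar
`f(a,x)`. The same scalar appears on the vacuum in `rCheck_single`, which is why it cancels in Bethe
vectors. -/
theorem IsRTT.contract_rCheck {U : Set ℂ}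
    {T : Fin (n + 1) → Fin (n + 1) → ℂ → Module.End K H} (h : IsRTT q U T) {a x : ℂ} (ha : a ∈ U)
    (hx : x ∈ U) (hax : a ≠ x) (Y : Fin n → Fin n → H) :
    ∑ s, T 0 s.succ x (∑ k, T 0 k.succ a (rCheck K q n a x Y s k)) =
      fFun q a x • ∑ i, T 0 i.succ a (∑ j, T 0 j.succ x (Y i j)) := by
  have h0 : ∀ (i j : Fin n) (y : H), fFun q a x • T 0 i.succ a (T 0 j.succ x y) =
      ∑ b, ∑ d, RMat q n a x (b, d) (i, j) • T 0 (Fin.succ d) x (T 0 (Fin.succ b) a y) := by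
    intro i j y
    have h1 := h a ha x hx hax 0 0 i.succ j.succ y
    rw [RMat_sum_row a x _ _ fun b d => T b i.succ a (T d j.succ x y),
      RMat_sum_col a x _ _ fun b d => T 0 d x (T 0 b a y), if_pos rfl] at h1
    rw [h1, RMat_sum_col a x i j fun b d => T 0 (Fin.succ d) x (T 0 (Fin.succ b) a y)]
    simp [gOff_succ, Fin.succ_inj]
  have hsm : ∀ (c : ℂ) (k : Fin (n + 1)) (u : ℂ) (y : H), c • T 0 k u y = T 0 k u (c • y) :=
    fun c k u y => ((T 0 k u).map_smul_of_tower c y).symm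
  simp only [map_sum, Finset.smul_sum, h0, rCheck_apply, ← hsm]
  rw [Finset.sum_comm, sum_comm_pairs]

/-- All values `f(a, b)` on a set of parameters are nonzero. -/
def Nondeg (q : ℂ) (S : Set ℂ) : Prop := ∀ a ∈ S, ∀ b ∈ S, a ≠ b → fFun q a b ≠ 0

theorem funext_cons {r : ℕ} {α β : Type*} {X Y : (Fin (r + 1) → α) → β}
    (h : ∀ c κ, X (Fin.cons c κ) = Y (Fin.cons c κ)) : X = Y := by
  funext κ
  simpa using h (κ 0) (Fin.tail κ)

/-- Reordering the sites of a chain. -/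
theorem exists_perm_intertwiner (hq : q ≠ 0) {U S : Set ℂ}
    {T : Fin (n + 1 + 1) → Fin (n + 1 + 1) → ℂ → Module.End K H} (hT : IsRTT q U T) (vac : H)
    (hS : S ⊆ U) (hf : Nondeg q S) {l l' : List ℂ} (hl : l.Perm l') :
    l.Nodup → (∀ x ∈ l, x ∈ S) →
    ∃ (Φ : ((Fin l.length → Fin (n + 1)) → H) →ₗ[K] ((Fin l'.length → Fin (n + 1)) → H)) (c : ℂ),
      c ≠ 0 ∧
      (∀ u, u ∉ l → ∀ i j X, Φ (chainL q (lowerBlock T) l i j u X) =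
        chainL q (lowerBlock T) l' i j u (Φ X)) ∧
      Φ (vacL n vac l) = c • vacL n vac l' ∧ ∀ X, evL T l' (Φ X) = c • evL T l X := by
  -- The intertwiner is composed from adjacent transpositions. The scalar `c` is a product of values
  -- `f(a,x)`, nonzero by `Nondeg`, and is the same on the vacuum and in the contraction with row 0.
  induction hl with
  | nil => exact fun _ _ => ⟨LinearMap.id, 1, one_ne_zero, by simp, by simp, by simp⟩
  | @cons a l l' hl ih =>
    intro hnd hmem
    obtain ⟨Φ, c, hc, h1, h2, h3⟩ := ih (List.nodup_cons.mp hnd).2 fun x hx => hmem x (by simp [hx])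
    let Ψ : ((Fin (a :: l).length → Fin (n + 1)) → H) →ₗ[K]
        ((Fin (a :: l').length → Fin (n + 1)) → H) :=
      LinearMap.pi fun κ => LinearMap.proj (Fin.tail κ) ∘ₗ Φ ∘ₗ LinearMap.proj (κ 0) ∘ₗ
        uncons K (n + 1) l.length
    have hΨ : ∀ X d κ, Ψ X (Fin.cons d κ) = Φ (fun κ' => X (Fin.cons d κ')) κ := fun _ _ _ => rfl
    refine ⟨Ψ, c, hc, fun u hu i j X => ?_, ?_, fun X => ?_⟩
    · refine funext_cons fun d κ => ?_
      rw [hΨ, chainL_cons]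
      have : (fun κ' => chainL q (lowerBlock T) (a :: l) i j u X (Fin.cons d κ')) =
        site q (chainL q (lowerBlock T) l) a i j u (fun d κ' => X (Fin.cons d κ')) d :=
        funext fun κ' => chainL_cons _ a l i j u X d κ'
      rw [this, site_apply, site_apply]
      simp only [map_sum, LinearMap.map_smul_of_tower, h1 u (fun h => hu (by simp [h]))]
      rfl
    · refine funext_cons fun d κ => ?_
      rw [hΨ]
      have : (fun κ' => vacL n vac (a :: l) (Fin.cons d κ')) =
        (Pi.single 0 (vacL n vac l) : Fin (n + 1) → (Fin l.length → Fin (n + 1)) → H) d :=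
        funext fun κ' => vacL_cons vac a l d κ'
      rw [this, Pi.smul_apply, vacL_cons]
      by_cases hd : d = 0
      · subst hd; simp [h2]
      · simp [hd]
    · rw [evL_cons, evL_cons, Finset.smul_sum]
      refine Finset.sum_congr rfl fun k _ => ?_
      simp only [hΨ]
      rw [← LinearMap.map_smul_of_tower, ← h3]
  | swap x a l =>
    intro hnd hmem
    have hax : a ≠ x := by simp at hnd; tauto
    let Ψ : ((Fin (a :: x :: l).length → Fin (n + 1)) → H) →ₗ[K]
        ((Fin (x :: a :: l).length → Fin (n + 1)) → H) :=
      LinearMap.pi fun κ => LinearMap.proj (Fin.tail (Fin.tail κ)) ∘ₗ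
        LinearMap.proj (Fin.tail κ 0) ∘ₗ LinearMap.proj (κ 0) ∘ₗ rCheck K q (n + 1) a x ∘ₗ
          LinearMap.pi (fun d => uncons K (n + 1) l.length ∘ₗ LinearMap.proj d) ∘ₗ
          uncons K (n + 1) (l.length + 1)
    have hΨ : ∀ X s k κ, Ψ X (Fin.cons s (Fin.cons k κ : Fin (l.length + 1) → Fin (n + 1))) =
        rCheck K q (n + 1) a x (fun d d' κ' => X (Fin.cons d
          (Fin.cons d' κ' : Fin (l.length + 1) → Fin (n + 1)))) s k κ := fun _ _ _ _ => rfl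
    have hch : ∀ a x i j u X d d' κ, chainL q (lowerBlock T) (a :: x :: l) i j u X (Fin.cons d
          (Fin.cons d' κ : Fin (l.length + 1) → Fin (n + 1))) =
        site q (site q (chainL q (lowerBlock T) l) x) a i j u (fun d d' κ' => X (Fin.cons d
          (Fin.cons d' κ' : Fin (l.length + 1) → Fin (n + 1)))) d d' κ := by
      intro a x i j u X d d' κ
      rw [chainL_cons]
      simp only [site_apply (chainL q (lowerBlock T) (x :: l)),
        site_apply (site q (chainL q (lowerBlock T) l) x), Finset.sum_apply, Pi.smul_apply]
      simp only [chainL_cons]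
    have hva : ∀ a x d d' κ, vacL n vac (a :: x :: l) (Fin.cons d
          (Fin.cons d' κ : Fin (l.length + 1) → Fin (n + 1))) =
        (Pi.single 0 (Pi.single 0 (vacL n vac l)) :
          Fin (n + 1) → Fin (n + 1) → (Fin l.length → Fin (n + 1)) → H) d d' κ := by
      intro a x d d' κ
      rw [vacL_cons]
      by_cases hd : d = 0
      · subst hd; simp only [Pi.single_eq_same]; exact vacL_cons ..
      · simp [hd]
    refine ⟨Ψ, fFun q a x, hf a (hmem _ (by simp)) x (hmem _ (by simp)) hax, fun u hu i j X => ?_,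
      ?_, fun X => ?_⟩
    · refine funext_cons fun s => ?_
      refine congrFun (funext_cons fun k κ => ?_)
      rw [hΨ, hch]
      simp only [hch]
      simp only [List.mem_cons, not_or] at hu
      exact congrFun (congrFun (congrFun (rCheck_site hq (chainL q (lowerBlock T) l) hax hu.1 hu.2.1
        i j _) s) k) κ
    · refine funext_cons fun s => ?_
      refine congrFun (funext_cons fun k κ => ?_)
      rw [hΨ, Pi.smul_apply, hva]
      simp only [hva]
      exact congrFun (congrFun (congrFun (rCheck_single a x (vacL n vac l)) s) k) κ
    · have := hT.contract_rCheck (hS (hmem a (by simp))) (hS (hmem x (by simp))) hax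
        fun d d' => evL T l fun κ' => X (Fin.cons d
          (Fin.cons d' κ' : Fin (l.length + 1) → Fin (n + 1)))
      have he : ∀ a x (X : (Fin (a :: x :: l).length → Fin (n + 1)) → H), evL T (a :: x :: l) X =
          ∑ s, T 0 s.succ a (∑ k, T 0 k.succ x (evL T l fun κ => X (Fin.cons s
            (Fin.cons k κ : Fin (l.length + 1) → Fin (n + 1))))) := by
        intro a x X
        rw [evL_cons]
        exact Finset.sum_congr rfl fun s _ => congrArg _ (evL_cons T x l _)
      rw [he, he, ← this]
      refine Finset.sum_congr rfl fun s _ => congrArg _ (Finset.sum_congr rfl fun k _ =>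
        congrArg _ ?_)
      simp only [rCheck_apply, ← LinearMap.map_smul_of_tower, ← map_sum]
      congr 1
  | trans hl hl' ih ih' =>
    intro hnd hmem
    obtain ⟨Φ, c, hc, h1, h2, h3⟩ := ih hnd hmem
    obtain ⟨Φ', c', hc', h1', h2', h3'⟩ := ih' (hl.nodup_iff.mp hnd)
      fun x hx => hmem x (hl.mem_iff.mpr hx)
    refine ⟨Φ' ∘ₗ Φ, c * c', mul_ne_zero hc hc', fun u hu i j X => ?_, ?_, fun X => ?_⟩
    · rw [LinearMap.comp_apply, h1 u hu, h1' u fun h => hu (hl.mem_iff.mpr h), LinearMap.comp_apply]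
    · rw [LinearMap.comp_apply, h2, LinearMap.map_smul_of_tower, h2', smul_smul]
    · rw [LinearMap.comp_apply, h3', h3, smul_smul, mul_comm]

end Symmetry

/-! ### Products of `f` and collections of distinct variables -/

section Letters

variable {q : ℂ}

theorem fProd_nil_left (vs : List ℂ) : fProd q [] vs = 1 := by simp [fProd]

theorem fProd_nil_right (us : List ℂ) : fProd q us [] = 1 := by simp [fProd]

theorem fProd_cons_left (u : ℂ) (us vs : List ℂ) :
    fProd q (u :: us) vs = fProd q [u] vs * fProd q us vs := by simp [fProd]

theorem fProd_singleton (u v : ℂ) : fProd q [u] [v] = fFun q u v := by simp [fProd]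

theorem fProd_cons_right (us vs : List ℂ) (v : ℂ) :
    fProd q us (v :: vs) = fProd q us [v] * fProd q us vs := by
  induction us with
  | nil => simp [fProd]
  | cons u us ih =>
    rw [fProd_cons_left, ih, fProd_cons_left u us [v], fProd_cons_left u us vs]
    simp only [fProd, List.map_cons, List.map_nil, List.prod_cons, List.prod_nil]
    ring

theorem fProd_perm {us us' vs vs' : List ℂ} (h : us.Perm us') (h' : vs.Perm vs') :
    fProd q us vs = fProd q us' vs' := by
  have : ∀ u, (vs.map fun v => fFun q u v).prod = (vs'.map fun v => fFun q u v).prod :=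
    fun u => (h'.map _).prod_eq
  simp only [fProd, this]
  exact (h.map _).prod_eq

theorem fProd_ne_zero {us vs : List ℂ} (h : ∀ u ∈ us, ∀ v ∈ vs, fFun q u v ≠ 0) :
    fProd q us vs ≠ 0 := by
  simp only [fProd]
  refine List.prod_ne_zero fun h0 => ?_
  obtain ⟨u, hu, h0⟩ := List.mem_map.mp h0
  refine List.prod_ne_zero (fun h1 => ?_) h0
  obtain ⟨v, hv, h1⟩ := List.mem_map.mp h1
  exact h u hu v hv h1

/-- The collections `t` consist of pairwise distinct elements of `S`. -/
structure Distinct (S : Set ℂ) {N : ℕ} (t : Fin N → List ℂ) : Prop where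
  nodup : ∀ k, (t k).Nodup
  mem : ∀ k, ∀ x ∈ t k, x ∈ S
  disj : ∀ k l, k ≠ l → ∀ x ∈ t k, x ∉ t l

namespace Distinct

variable {S : Set ℂ} {N : ℕ}

theorem perm {t t' : Fin N → List ℂ} (h : Distinct S t) (hp : ∀ k, (t k).Perm (t' k)) :
    Distinct S t' where
  nodup k := (hp k).nodup_iff.mp (h.nodup k)
  mem k x hx := h.mem k x ((hp k).mem_iff.mpr hx)
  disj k l hkl x hx hx' := h.disj k l hkl x ((hp k).mem_iff.mpr hx) ((hp l).mem_iff.mpr hx')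

theorem tail {t : Fin (N + 1) → List ℂ} (h : Distinct S t) :
    Distinct (S \ {x | x ∈ t 0}) fun k => t k.succ where
  nodup _ := h.nodup _
  mem k x hx := ⟨h.mem _ x hx, h.disj _ _ (Fin.succ_ne_zero k) x hx⟩
  disj _ _ hkl := h.disj _ _ fun h => hkl (Fin.succ_inj.mp h)

theorem mono {S' : Set ℂ} {t : Fin N → List ℂ} (h : Distinct S t) (hS : S ⊆ S') : Distinct S' t :=
  ⟨h.nodup, fun k x hx => hS (h.mem k x hx), h.disj⟩

theorem sublist {t t' : Fin N → List ℂ} (h : Distinct S t) (hs : ∀ k, (t' k).Sublist (t k)) :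
    Distinct S t' where
  nodup k := (h.nodup k).sublist (hs k)
  mem k x hx := h.mem k x ((hs k).subset hx)
  disj k l hkl x hx hx' := h.disj k l hkl x ((hs k).subset hx) ((hs l).subset hx')

end Distinct

theorem Nondeg.mono {S S' : Set ℂ} (h : Nondeg q S) (hS : S' ⊆ S) : Nondeg q S' :=
  fun a ha b hb => h a (hS ha) b (hS hb)

theorem diff_subset_chainSet {S U : Set ℂ} (hS : S ⊆ U) (hf : Nondeg q S) {l : List ℂ}
    (hl : ∀ x ∈ l, x ∈ S) : S \ {x | x ∈ l} ⊆ chainSet q l U :=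
  fun u hu => ⟨hS hu.1, fun x hx =>
    have : u ≠ x := fun h => hu.2 (h ▸ hx)
    ⟨this, hf u hu.1 x (hl x hx) this⟩⟩

theorem colorOr_zero {N : ℕ} (t : Fin (N + 1) → List ℂ) : colorOr t 0 = t 0 := by simp [colorOr]

theorem colorOr_succ {N : ℕ} (t : Fin (N + 1) → List ℂ) (k : ℕ) :
    colorOr t (k + 1) = colorOr (fun k => t k.succ) k := by
  simp [colorOr]

theorem colorOr_perm {N : ℕ} {t t' : Fin N → List ℂ} (hp : ∀ k, (t k).Perm (t' k)) (k : ℕ) :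
    (colorOr t k).Perm (colorOr t' k) := by
  unfold colorOr
  split_ifs with h
  · exact hp _
  · exact .refl _

theorem mem_colorOr {N : ℕ} {t : Fin N → List ℂ} {k : ℕ} {x : ℂ} (h : x ∈ colorOr t k) :
    ∃ hk : k < N, x ∈ t ⟨k, hk⟩ := by
  unfold colorOr at h
  split_ifs at h with hk
  · exact ⟨hk, h⟩
  · simp at h

end Letters

/-! ### Invariance of Bethe vectors under permutations within each color -/

section

variable {q : ℂ} {K : Type*} [CommRing K] [Algebra ℂ K]

/-- The first color is reordered by the intertwiner, which carries the inner Bethe vector of one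
chain to that of the other. The higher colors follow by induction, with the chain itself as a model;
its parameters must avoid the inhomogeneities, so `S` loses the variables of the first color. -/
theorem bv_perm (hq : q ≠ 0) : ∀ {N : ℕ} {H : Type*} [AddCommGroup H] [Module K H] [Module ℂ H]
    [IsScalarTower ℂ K H] {U S : Set ℂ} {T : Fin (N + 1) → Fin (N + 1) → ℂ → Module.End K H}
    {vac : H} {ell : Fin (N + 1) → ℂ → K} (_ : IsVacModel q U T vac ell) (_ : S ⊆ U)
    (_ : Nondeg q S) {t t' : Fin N → List ℂ} (_ : Distinct S t) (_ : ∀ k, (t k).Perm (t' k)),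
    bv q N T vac t = bv q N T vac t'
  | 0, _, _, _, _, _, _, _, _, _, _, _, _, _, _, _, _, _ => rfl
  | N + 1, H, _, _, _, _, U, S, T, vac, ell, hT, hS, hf, t, t', ht, hp => by
    obtain ⟨Φ, c, hc, h1, h2, h3⟩ := exists_perm_intertwiner hq hT.rtt vac hS hf (hp 0)
      (ht.nodup 0) (ht.mem 0)
    have hch := hT.block.chainL hq (t 0)
    have ih := bv_perm hq hch (diff_subset_chainSet hS hf (ht.mem 0))
      (hf.mono Set.sdiff_subset) ht.tail fun k => hp k.succ
    rw [bv_succ, bv_succ, fProd_perm (colorOr_perm hp 1) (hp 0), ih]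
    congr 1
    refine smul_right_injective H hc ?_
    simp only
    rw [← h3, bv_map (T' := chainL q (lowerBlock T) (t' 0)) Φ, h2, bv_smul,
      LinearMap.map_smul_of_tower]
    intro k u hu i j x
    exact h1 u (ht.disj k.succ 0 (Fin.succ_ne_zero k) u ((hp k.succ).mem_iff.mpr hu)) i j x

end

/-! ## Vector-valued polynomials -/

section VPoly

variable {H H' : Type*} [AddCommGroup H] [Module ℂ H] [AddCommGroup H'] [Module ℂ H']

/-- Polynomial functions of degree less than `r` with values in `H`. -/
def VPoly (r : ℕ) (P : ℂ → H) : Prop := ∃ h : ℕ → H, ∀ z, P z = ∑ j ∈ Finset.range r, z ^ j • h j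

namespace VPoly

variable {r : ℕ} {P Q : ℂ → H}

theorem zero : VPoly r fun _ => (0 : H) := ⟨0, by simp⟩

theorem add (hP : VPoly r P) (hQ : VPoly r Q) : VPoly r fun z => P z + Q z := by
  obtain ⟨h, hh⟩ := hP
  obtain ⟨k, hk⟩ := hQ
  exact ⟨h + k, fun z => by simp [hh, hk, Finset.sum_add_distrib]⟩

theorem sum {ι : Type*} (s : Finset ι) {P : ι → ℂ → H} (hP : ∀ i ∈ s, VPoly r (P i)) :
    VPoly r fun z => ∑ i ∈ s, P i z := by
  classical
  induction s using Finset.induction_on with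
  | empty => simpa using zero
  | insert a s ha ih =>
    simpa [Finset.sum_insert ha] using
      (hP a (by simp)).add (ih fun i hi => hP i (by simp [hi]))

theorem const (x : H) : VPoly 1 fun _ => x := ⟨fun _ => x, by simp⟩

theorem mono (hP : VPoly r P) {r' : ℕ} (hr : r ≤ r') : VPoly r' P := by
  obtain ⟨h, hh⟩ := hP
  refine ⟨fun j => if j < r then h j else 0, fun z => ?_⟩
  rw [hh, ← Finset.sum_subset (Finset.range_mono hr)]
  · exact Finset.sum_congr rfl fun j hj => by simp [Finset.mem_range.mp hj]
  · intro j _ hj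
    simp [Finset.mem_range] at hj
    simp [hj.not_gt]

theorem map {K : Type*} [CommRing K] [Algebra ℂ K] [Module K H] [IsScalarTower ℂ K H]
    [Module K H'] [IsScalarTower ℂ K H'] (f : H →ₗ[K] H') (hP : VPoly r P) :
    VPoly r fun z => f (P z) := by
  obtain ⟨h, hh⟩ := hP
  exact ⟨fun j => f (h j), fun z => by simp only [hh, map_sum, LinearMap.map_smul_of_tower]⟩

theorem smul_linear (a b : ℂ) (hP : VPoly r P) : VPoly (r + 1) fun z => (a + b * z) • P z := by
  obtain ⟨h, hh⟩ := hP
  have h1 : VPoly (r + 1) fun z => a • P z :=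
    mono ⟨fun j => a • h j, fun z => by simp [hh, Finset.smul_sum, smul_comm a]⟩ r.le_succ
  have h2 : VPoly (r + 1) fun z => (b * z) • P z := by
    refine ⟨fun j => if j = 0 then 0 else b • h (j - 1), fun z => ?_⟩
    simp only [hh]
    rw [Finset.sum_range_succ']
    simp [Finset.smul_sum, smul_smul, pow_succ, mul_comm, mul_assoc]
  simpa only [add_smul] using h1.add h2

theorem smul_const (a : ℂ) (hP : VPoly r P) : VPoly r fun z => a • P z := by
  obtain ⟨h, hh⟩ := hP
  exact ⟨fun j => a • h j, fun z => by simp [hh, Finset.smul_sum, smul_comm a]⟩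

theorem prod_smul {ι : Type*} (l : List ι) (a b : ι → ℂ) (x : H) :
    VPoly (l.length + 1) fun z => (l.map fun i => a i + b i * z).prod • x := by
  induction l with
  | nil => simpa using const x
  | cons i l ih => simpa [mul_smul] using ih.smul_linear (a i) (b i)

theorem eq_interpolate (hP : VPoly r P) {s : Finset ℂ} (hs : r ≤ s.card) (z : ℂ) :
    P z = ∑ i ∈ s, (Lagrange.basis s id i).eval z • P i := by
  obtain ⟨h, hh⟩ := hP
  simp only [hh, Finset.smul_sum]
  rw [Finset.sum_comm]
  refine Finset.sum_congr rfl fun j hj => ?_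
  simp only [smul_smul, ← Finset.sum_smul]
  congr 1
  have hdeg : (Polynomial.X ^ j : Polynomial ℂ).degree < s.card := by
    rw [Polynomial.degree_X_pow]
    exact_mod_cast (Finset.mem_range.mp hj).trans_le hs
  have := congrArg (Polynomial.eval z)
    (Lagrange.eq_interpolate (v := id) Function.injective_id.injOn hdeg)
  simpa [Lagrange.interpolate_apply, Polynomial.eval_finsetSum, mul_comm] using this

theorem eq_of_eqOn (hP : VPoly r P) (hQ : VPoly r Q) {s : Finset ℂ} (hs : r ≤ s.card)
    (h : ∀ i ∈ s, P i = Q i) (z : ℂ) : P z = Q z := by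
  rw [hP.eq_interpolate hs, hQ.eq_interpolate hs]
  exact Finset.sum_congr rfl fun i hi => by rw [h i hi]

/-- Extends identities proved for a generic inhomogeneity to the special points used as
interpolation nodes. -/
theorem eq_of_cofinite (hP : VPoly r P) (hQ : VPoly r Q) {U : Set ℂ} (hU : Uᶜ.Finite)
    (h : ∀ z ∈ U, P z = Q z) (z : ℂ) : P z = Q z := by
  have hinf : U.Infinite := fun hfin => Set.infinite_univ (α := ℂ)
    ((Set.union_compl_self U) ▸ hfin.union hU)
  obtain ⟨s, hs, hc⟩ := hinf.exists_subset_card_eq r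
  exact hP.eq_of_eqOn hQ hc.ge (fun i hi => h i (hs hi)) z

end VPoly
end VPoly

/-! ## Graded invariance of Bethe vectors -/

section Graded

variable {q : ℂ} {K K' : Type*} [CommRing K] [Algebra ℂ K] [CommRing K'] [Algebra ℂ K']

theorem evL_rel_graded {n : ℕ} {H H' : Type*} [AddCommGroup H] [Module K H] [Module ℂ H]
    [IsScalarTower ℂ K H] [AddCommGroup H'] [Module K' H'] [Module ℂ H'] [IsScalarTower ℂ K' H']
    {Rel : Set ℂ → H → H' → Prop} (hR : ∀ A, IsLinRel (Rel A))
    {T : Fin (n + 1) → Fin (n + 1) → ℂ → Module.End K H}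
    {T' : Fin (n + 1) → Fin (n + 1) → ℂ → Module.End K' H'} (A : Set ℂ) :
    ∀ (l : List ℂ) (_ : l.Nodup) (_ : ∀ u ∈ l, u ∉ A)
      (_ : ∀ u ∈ l, ∀ A, u ∉ A → ∀ j x y, Rel A x y → Rel (insert u A) (T 0 j u x) (T' 0 j u y))
      (X : (Fin l.length → Fin n) → H) (Y : (Fin l.length → Fin n) → H'),
      (∀ κ, Rel A (X κ) (Y κ)) → Rel ({x | x ∈ l} ∪ A) (evL T l X) (evL T' l Y)
  | [], _, _, _, _, _, h => by
    rw [evL_nil, evL_nil]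
    simpa using h _
  | a :: l, hnd, hA, hT, X, Y, h => by
    rw [evL_cons, evL_cons]
    have hset : ({x | x ∈ a :: l} ∪ A : Set ℂ) = insert a ({x | x ∈ l} ∪ A) := by
      ext x; simp [or_assoc]
    rw [hset]
    refine (hR _).sum _ _ _ fun k => hT a (by simp) _ ?_ _ _ _ ?_
    · simp only [Set.mem_union, Set.mem_ofPred_eq, not_or]
      exact ⟨(List.nodup_cons.mp hnd).1, hA a (by simp)⟩
    · exact evL_rel_graded hR A l (List.nodup_cons.mp hnd).2 (fun u hu => hA u (by simp [hu]))
        (fun u hu => hT u (by simp [hu])) _ _ fun κ => h _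

/-- Every variable is the argument of exactly one operator. The relation therefore may depend on the
set of variables already used, and compatibility with `T(u)` is needed only while `u` is unused.
This serves properties such as `FirstCol` at `u`, which need not survive the application of `T(u)`.
-/
theorem bv_rel_graded :
    ∀ (N : ℕ) {H H' : Type*} [AddCommGroup H] [Module K H] [Module ℂ H] [IsScalarTower ℂ K H]
      [AddCommGroup H'] [Module K' H'] [Module ℂ H'] [IsScalarTower ℂ K' H']
      {Rel : Set ℂ → H → H' → Prop} (_ : ∀ A, IsLinRel (Rel A))
      {T : Fin (N + 1) → Fin (N + 1) → ℂ → Module.End K H}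
      {T' : Fin (N + 1) → Fin (N + 1) → ℂ → Module.End K' H'} {vac : H} {vac' : H'}
      (t : Fin N → List ℂ) (_ : Distinct Set.univ t)
      (_ : ∀ k, ∀ u ∈ t k, ∀ A, u ∉ A → ∀ i j x y, Rel A x y →
        Rel (insert u A) (T i j u x) (T' i j u y)) (_ : Rel ∅ vac vac'),
      Rel {x | ∃ k, x ∈ t k} (bv q N T vac t) (bv q N T' vac' t)
  | 0, _, _, _, _, _, _, _, _, _, _, _, _, _, _, _, _, _, _, _, h => by
    simpa [bv_zero] using h
  | N + 1, H, H', _, _, _, _, _, _, _, _, Rel, hR, T, T', vac, vac', t, ht, hT, hv => by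
    rw [bv_succ, bv_succ]
    have hset : ({x | ∃ k, x ∈ t k} : Set ℂ) =
        {x | x ∈ t 0} ∪ {x | ∃ k : Fin N, x ∈ t k.succ} := by
      ext x; simp [Fin.exists_fin_succ]
    rw [hset]
    refine (hR _).smul _ (evL_rel_graded hR _ _ (ht.nodup 0) ?_
      (fun u hu A hA j => hT 0 u hu A hA 0 j) _ _ ?_)
    · rintro u hu ⟨k, hk⟩
      exact ht.disj 0 k.succ (Fin.succ_ne_zero k).symm u hu hk
    · refine bv_rel_graded N (Rel := fun A (X : (Fin (t 0).length → Fin (N + 1)) → H)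
          (Y : (Fin (t 0).length → Fin (N + 1)) → H') => ∀ κ, Rel A (X κ) (Y κ)) (fun A => (hR A).pi _)
        _ (ht.tail.mono (Set.subset_univ _)) (fun k u hu A hA i j x y h => ?_) ?_
      · exact chainMonodromy_rel (hR _)
          (fun i j x y => hT k.succ u hu A hA i.succ j.succ x y) _ _ _ _ _ _ h
      · intro κ
        by_cases h : κ = fun _ => 0
        · subst h; simpa [vacL] using hv
        · simpa [vacL, h] using (hR _).zero

end Graded

/-! ## Components of the Bethe vectors of a one-site extension -/

section OneSite

variable {q : ℂ} {n : ℕ} {K : Type*} [CommRing K] [Algebra ℂ K]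
  {H : Type*} [AddCommGroup H] [Module K H] [Module ℂ H] [IsScalarTower ℂ K H]

/-- `X ↦ ∑_k T_{p,k}(y) X_k`. -/
noncomputable def theta (T : Fin n → Fin n → ℂ → Module.End K H) (p : Fin n) (y : ℂ) :
    (Fin n → H) →ₗ[K] H := ∑ k, T p k y ∘ₗ LinearMap.proj k

theorem theta_apply (T : Fin n → Fin n → ℂ → Module.End K H) (p : Fin n) (y : ℂ) (X : Fin n → H) :
    theta T p y X = ∑ k, T p k y (X k) := by simp [theta]

theorem theta_single (T : Fin (n + 1) → Fin (n + 1) → ℂ → Module.End K H) (p : Fin (n + 1))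
    (y : ℂ) (x : H) : theta T p y (Pi.single 0 x) = T p 0 y x := by
  rw [theta_apply, Finset.sum_eq_single 0]
  · simp
  · intro k _ hk; simp [hk]
  · simp

/-- The Yangian exchange relation between `theta` and a one-site extension. -/
theorem IsRTT.theta_site {U : Set ℂ} {T : Fin n → Fin n → ℂ → Module.End K H} (h : IsRTT q U T)
    {v y : ℂ} (hv : v ∈ U) (hy : y ∈ U) (hvy : v ≠ y) (a c j : Fin n) (X : Fin n → H) :
    theta T a y (site q T y c j v X) =
      if c = a then fFun q v y • T a j v (theta T a y X)
      else T c j v (theta T a y X) + gOff q v y c a • T a j v (theta T c y X) := by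
  have h1 : theta T a y (site q T y c j v X) = ∑ k, if k = j then
      fFun q v y • T a j y (T c j v (X j))
      else T a k y (T c j v (X k)) + gOff q v y k j • T a j y (T c k v (X k)) := by
    rw [theta_apply, ← Finset.add_sum_erase _ _ (Finset.mem_univ j),
      ← Finset.add_sum_erase _ _ (Finset.mem_univ j), if_pos rfl, site_apply_self,
      ← Finset.add_sum_erase _ _ (Finset.mem_univ j), if_pos rfl, map_add,
      LinearMap.map_smul_of_tower, add_assoc]
    congr 1
    rw [map_sum, ← Finset.sum_add_distrib]
    refine Finset.sum_congr rfl fun k hk => ?_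
    have hkj := Finset.ne_of_mem_erase hk
    rw [if_neg hkj, if_neg hkj, site_apply_ne _ _ hkj, LinearMap.map_smul_of_tower, add_comm]
  have h2 : ∀ k, (if k = j then fFun q v y • T a j y (T c j v (X j))
      else T a k y (T c j v (X k)) + gOff q v y k j • T a j y (T c k v (X k))) =
      if c = a then fFun q v y • T a j v (T a k y (X k))
      else T c j v (T a k y (X k)) + gOff q v y c a • T a j v (T c k y (X k)) := by
    intro k
    by_cases hkj : k = j <;> by_cases hca : c = a
    · subst hkj; subst hca
      simp [h.eq_eq hv hy hvy]
    · subst hkj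
      simp [hca, h.ne_eq hv hy hvy k hca]
    · subst hca
      simp [hkj, h.eq_ne hv hy hvy c (Ne.symm hkj)]
    · simp [hkj, hca, h.ne_ne hv hy hvy hca (Ne.symm hkj)]
  rw [h1, Finset.sum_congr rfl fun k _ => h2 k]
  split_ifs
  · simp only [theta_apply, map_sum, Finset.smul_sum]
  · simp only [theta_apply, map_sum, Finset.smul_sum, Finset.sum_add_distrib]

/-- The condition that the first column acts on `h` at the parameter `s` as on a pseudovacuum. -/
def FirstCol (T : Fin (n + 1) → Fin (n + 1) → ℂ → Module.End K H) (ell : Fin (n + 1) → ℂ → K)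
    (s : ℂ) (h : H) : Prop := (∀ i ≠ 0, T i 0 s h = 0) ∧ T 0 0 s h = ell 0 s • h

/-- When a first-column entry at `s` is moved through a block entry at `u`, the exchange terms apply
a first-column entry at `s` or at `u` to `h`. Hence the condition is needed at both points and
survives at `s` only. -/
theorem FirstCol.map_block {U : Set ℂ} {T : Fin (n + 1) → Fin (n + 1) → ℂ → Module.End K H}
    {ell : Fin (n + 1) → ℂ → K} (hT : IsRTT q U T) {s u : ℂ} (hs : s ∈ U) (hu : u ∈ U)
    (hsu : s ≠ u) {h : H} (h1 : FirstCol T ell s h) (h2 : FirstCol T ell u h) (a b : Fin n) :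
    FirstCol T ell s (lowerBlock T a b u h) := by
  have ha := Fin.succ_ne_zero a
  have hb := Fin.succ_ne_zero b
  constructor
  · intro i hi
    by_cases hai : a.succ = i
    · have := hT.eq_ne hu hs hsu.symm a.succ hb h
      rw [h1.1 _ ha, h2.1 _ ha] at this
      simpa [← hai, lowerBlock] using this.symm
    · have := hT.ne_ne hu hs hsu.symm hai hb h
      rw [h1.1 _ ha, h2.1 _ ha, h1.1 _ hi] at this
      simpa [lowerBlock] using this.symm
  · have := hT.ne_ne hu hs hsu.symm ha hb h
    rw [h1.1 _ ha, h2.1 _ ha, h1.2] at this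
    simpa [lowerBlock] using this.symm

theorem lowerBlock_site_single {T : Fin (n + 1) → Fin (n + 1) → ℂ → Module.End K H}
    {ell : Fin (n + 1) → ℂ → K} (z : ℂ) {u : ℂ} {h : H} (h2 : FirstCol T ell u h) (a b : Fin n) :
    lowerBlock (site q T z) a b u (Pi.single 0 h) = Pi.single 0 (lowerBlock T a b u h) := by
  funext c
  simp only [lowerBlock]
  by_cases hc : c = b.succ
  · subst hc
    rw [site_apply_self, Finset.sum_eq_single 0]
    · simp [h2.1]
    · intro k _ hk; simp [hk]
    · simp
  · rw [site_apply_ne _ _ hc]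
    by_cases hc0 : c = 0
    · subst hc0; simp
    · simp [hc0]

theorem isLinRel_firstCol (T : Fin (n + 1) → Fin (n + 1) → ℂ → Module.End K H)
    (ell : Fin (n + 1) → ℂ → K) (S A : Set ℂ) :
    IsLinRel fun (x : H) (y : Fin (n + 1) → H) =>
      (∀ s ∈ S, s ∉ A → FirstCol T ell s x) ∧ y = Pi.single 0 x where
  zero := ⟨fun s _ _ => ⟨fun _ _ => map_zero _, by simp⟩, by simp⟩
  add := by
    rintro x y _ _ ⟨h1, rfl⟩ ⟨h2, rfl⟩
    refine ⟨fun s hs hA => ⟨fun i hi => ?_, ?_⟩, (Pi.single_add _ _ _).symm⟩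
    · rw [map_add, (h1 s hs hA).1 i hi, (h2 s hs hA).1 i hi, add_zero]
    · rw [map_add, (h1 s hs hA).2, (h2 s hs hA).2, smul_add]
  smul := by
    rintro c x _ ⟨h1, rfl⟩
    refine ⟨fun s hs hA => ⟨fun i hi => ?_, ?_⟩, (Pi.single_smul _ _ _).symm⟩
    · rw [LinearMap.map_smul_of_tower, (h1 s hs hA).1 i hi, smul_zero]
    · rw [LinearMap.map_smul_of_tower, (h1 s hs hA).2, smul_comm]

/-- The inner levels use only the lower right block. On vectors satisfying `FirstCol`, this block
cannot excite the additional site (`lowerBlock_site_single`), which therefore stays in its state 0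
until the first row acts. -/
theorem bv_lowerBlock_site {N : ℕ} {U S : Set ℂ}
    {T : Fin (N + 1 + 1) → Fin (N + 1 + 1) → ℂ → Module.End K H} {vac : H}
    {ell : Fin (N + 1 + 1) → ℂ → K} (hT : IsVacModel q U T vac ell) (hS : S ⊆ U) (z : ℂ)
    (l : List ℂ) (t : Fin N → List ℂ) (ht : Distinct S t) (κ) :
    (∀ s ∈ S, (∀ k, s ∉ t k) → FirstCol T ell s
      (bv q N (chainL q (lowerBlock T) l) (vacL N vac l) t κ)) ∧
    bv q N (chainL q (lowerBlock (site q T z)) l) (vacL N (Pi.single 0 vac) l) t κ =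
      Pi.single 0 (bv q N (chainL q (lowerBlock T) l) (vacL N vac l) t κ) := by
  have := bv_rel_graded (q := q) N (Rel := fun A (X : (Fin l.length → Fin (N + 1)) → H)
    (Y : (Fin l.length → Fin (N + 1)) → Fin (N + 1 + 1) → H) => ∀ κ,
      (∀ s ∈ S, s ∉ A → FirstCol T ell s (X κ)) ∧ Y κ = Pi.single 0 (X κ))
    (T := chainL q (lowerBlock T) l) (T' := chainL q (lowerBlock (site q T z)) l)
    (vac := vacL N vac l) (vac' := vacL N (Pi.single 0 vac) l) ?_ t
    (ht.mono (Set.subset_univ _)) ?_ ?_ κ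
  · refine ⟨fun s hs hst => this.1 s hs ?_, this.2⟩
    rintro ⟨k, hk⟩
    exact hst k hk
  · intro A
    exact (isLinRel_firstCol T ell S A).pi _
  · intro k u hu A huA i j X Y h
    have huS := ht.mem k u hu
    refine chainMonodromy_rel (Rel := fun (x : H) (y : Fin (N + 1 + 1) → H) =>
      (∀ s ∈ S, s ∉ A → FirstCol T ell s x) ∧ y = Pi.single 0 x)
      (Rel' := fun (x : H) (y : Fin (N + 1 + 1) → H) =>
      (∀ s ∈ S, s ∉ insert u A → FirstCol T ell s x) ∧ y = Pi.single 0 x) ?_ ?_ _ _ _ _ _ _ h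
    · exact isLinRel_firstCol T ell S _
    · rintro i j x _ ⟨h1, rfl⟩
      refine ⟨fun s hs hsA => ?_, lowerBlock_site_single z (h1 u huS huA) i j⟩
      simp only [Set.mem_insert_iff, not_or] at hsA
      exact (h1 s hs hsA.2).map_block hT.rtt (hS hs) (hS huS) hsA.1 (h1 u huS huA) i j
  · intro κ
    by_cases hκ : κ = fun _ => 0
    · subst hκ
      simp only [vacL, Pi.single_eq_same, and_true]
      exact fun s hs _ => ⟨fun i hi => hT.lower s (hS hs) i 0 (Fin.pos_of_ne_zero hi),
        hT.diag s (hS hs) 0⟩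
    · simp only [vacL, Pi.single_eq_of_ne hκ, Pi.single_zero, and_true]
      exact fun s _ _ => ⟨fun _ _ => map_zero _, by simp⟩

end OneSite

/-! ### Interpolation in the inhomogeneity of the additional site -/

section OneSiteFormula

variable {q : ℂ} {n : ℕ} {K : Type*} [CommRing K] [Algebra ℂ K]
  {H : Type*} [AddCommGroup H] [Module K H] [Module ℂ H] [IsScalarTower ℂ K H]

theorem perm_getD_cons_eraseIdx {l : List ℂ} {i : ℕ} (hi : i < l.length) :
    l.Perm (l.getD i 0 :: l.eraseIdx i) := by
  rw [List.getD_eq_getElem _ _ hi]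
  exact (List.getElem_cons_eraseIdx_perm hi).symm

/-- The monodromy matrix of a one-site extension, multiplied by its denominator. -/
noncomputable def siteHat (q : ℂ) (T : Fin n → Fin n → ℂ → Module.End K H) (z : ℂ) (i j : Fin n)
    (u : ℂ) (X : Fin n → H) (c : Fin n) : H :=
  if c = j then ∑ k, (if k = j then q * u - q⁻¹ * z else (q - q⁻¹) * if k < j then u else z) •
    T i k u (X k)
  else (u - z) • T i j u (X c)

theorem siteHat_eq (T : Fin n → Fin n → ℂ → Module.End K H) {z u : ℂ} (h : u ≠ z) (i j : Fin n)
    (X : Fin n → H) : siteHat q T z i j u X = (u - z) • site q T z i j u X := by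
  have h0 := sub_ne_zero.mpr h
  funext c
  rw [siteHat, Pi.smul_apply]
  split_ifs with hc
  · subst hc
    rw [site_apply_self, Finset.smul_sum]
    refine Finset.sum_congr rfl fun k _ => ?_
    rw [smul_smul]
    congr 1
    by_cases hk : k = c
    · simp only [hk, if_true, fFun]
      field_simp
    · simp only [hk, if_false, gOff, gFun]
      split_ifs <;> field_simp
  · rw [site_apply_ne _ _ hc]

/-- At coinciding parameters the numerator of the R-matrix is a multiple of the permutation; this
makes the values at the interpolation nodes computable. -/
theorem siteHat_self (T : Fin n → Fin n → ℂ → Module.End K H) (u : ℂ) (i j : Fin n)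
    (X : Fin n → H) (c : Fin n) :
    siteHat q T u i j u X c = if c = j then ((q - q⁻¹) * u) • theta T i u X else 0 := by
  rw [siteHat]
  split_ifs with hc
  · rw [theta_apply, Finset.smul_sum]
    refine Finset.sum_congr rfl fun k _ => ?_
    congr 1
    split_ifs <;> ring
  · simp

/-- The contraction of a tensor with the first row of a one-site extension, multiplied by the
denominators; polynomial in the inhomogeneity. -/
noncomputable def sitePoly (q : ℂ) (T : Fin (n + 1) → Fin (n + 1) → ℂ → Module.End K H) (z : ℂ) :
    (l : List ℂ) → ((Fin l.length → Fin n) → H) → Fin (n + 1) → H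
  | [], W => Pi.single 0 (W Fin.elim0)
  | a :: l, W => ∑ k, siteHat q T z 0 k.succ a (sitePoly q T z l fun κ => W (Fin.cons k κ))

theorem sitePoly_eq (T : Fin (n + 1) → Fin (n + 1) → ℂ → Module.End K H) {z : ℂ} :
    ∀ (l : List ℂ) (_ : ∀ x ∈ l, x ≠ z) (W : (Fin l.length → Fin n) → H),
      sitePoly q T z l W = (l.map fun x => x - z).prod •
        evL (site q T z) l fun κ => Pi.single 0 (W κ)
  | [], _, W => by rw [evL_nil]; simp [sitePoly]
  | a :: l, h, W => by
    rw [sitePoly, evL_cons, List.map_cons, List.prod_cons, Finset.smul_sum]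
    refine Finset.sum_congr rfl fun k _ => ?_
    rw [siteHat_eq _ (h a (by simp)), sitePoly_eq T l (fun x hx => h x (by simp [hx])),
      LinearMap.map_smul_of_tower, smul_smul]

theorem sitePoly_vpoly (T : Fin (n + 1) → Fin (n + 1) → ℂ → Module.End K H) :
    ∀ (l : List ℂ) (W : (Fin l.length → Fin n) → H),
      (∀ c : Fin n, VPoly l.length fun z => sitePoly q T z l W c.succ) ∧
      VPoly (l.length + 1) fun z => sitePoly q T z l W 0
  | [], W => ⟨fun c => by simpa [sitePoly] using VPoly.zero,
      by simpa [sitePoly] using VPoly.const _⟩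
  | a :: l, W => by
    have ih := fun k => sitePoly_vpoly T l fun κ => W (Fin.cons k κ)
    constructor
    · intro c
      simp only [sitePoly, Finset.sum_apply]
      refine VPoly.sum _ fun k _ => ?_
      simp only [siteHat]
      by_cases hc : c.succ = k.succ
      · simp only [hc, if_true]
        refine VPoly.sum _ fun d _ => ?_
        refine Fin.cases ?_ (fun d => ?_) d
        -- Component 0 has one degree more than the others. It enters here with a coefficient free
        -- of `z`, because `0 < k.succ` selects `u` and not `z` in the R-matrix, so the degree bound
        -- is kept.
        · have := (((ih k).2.map (T 0 0 a)).smul_const ((q - q⁻¹) * a))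
          simpa [(Fin.succ_ne_zero k).symm] using this
        · have hd := ((ih k).1 d).map (T 0 d.succ a)
          by_cases hdk : d.succ = k.succ
          · simpa [hdk, sub_eq_add_neg] using hd.smul_linear (q * a) (-q⁻¹)
          · by_cases hlt : d.succ < k.succ
            · simpa [hdk, hlt] using (hd.smul_const ((q - q⁻¹) * a)).mono (Nat.le_succ _)
            · simpa [hdk, hlt] using hd.smul_linear 0 (q - q⁻¹)
      · simp only [hc, if_false]
        simpa [sub_eq_add_neg] using (((ih k).1 c).map (T 0 k.succ a)).smul_linear a (-1)
    · simp only [sitePoly, Finset.sum_apply]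
      refine VPoly.sum _ fun k _ => ?_
      simp only [siteHat, (Fin.succ_ne_zero k).symm, if_false]
      simpa [sub_eq_add_neg] using ((ih k).2.map (T 0 k.succ a)).smul_linear a (-1)

theorem evL_site_zero (T : Fin (n + 1) → Fin (n + 1) → ℂ → Module.End K H) (z : ℂ) :
    ∀ (l : List ℂ) (Y : (Fin l.length → Fin n) → Fin (n + 1) → H),
      evL (site q T z) l Y 0 = evL T l fun κ => Y κ 0
  | [], Y => by rw [evL_nil, evL_nil]
  | a :: l, Y => by
    rw [evL_cons, evL_cons, Finset.sum_apply]
    refine Finset.sum_congr rfl fun k _ => ?_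
    rw [site_apply_ne _ _ (Fin.succ_ne_zero k).symm, evL_site_zero T z l]

/-- For equal rows `IsRTT.theta_site` has no exchange term: `theta` passes through the first row and
collects `f`. -/
theorem theta_zero_evL {U : Set ℂ} {T : Fin (n + 1) → Fin (n + 1) → ℂ → Module.End K H}
    (hT : IsRTT q U T) {y : ℂ} (hy : y ∈ U) :
    ∀ (l : List ℂ) (_ : ∀ x ∈ l, x ∈ U ∧ x ≠ y) (Y : (Fin l.length → Fin n) → Fin (n + 1) → H),
      theta T 0 y (evL (site q T y) l Y) = fProd q l [y] • evL T l fun κ => theta T 0 y (Y κ)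
  | [], _, Y => by rw [evL_nil, evL_nil, fProd_nil_left, one_smul]
  | a :: l, h, Y => by
    rw [evL_cons, evL_cons, map_sum, Finset.smul_sum]
    refine Finset.sum_congr rfl fun k _ => ?_
    rw [hT.theta_site (h a (by simp)).1 hy (h a (by simp)).2, if_pos rfl,
      theta_zero_evL hT hy l (fun x hx => h x (by simp [hx])), fProd_cons_left, fProd_singleton,
      LinearMap.map_smul_of_tower, smul_smul]

/-- At the node `z = a`, with `a` in the first place, the leftmost operator becomes `theta` by
`siteHat_self`. It passes through the rest of the row, reaches a vector on which `T_{0,0}(a)` is the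
eigenvalue, and leaves index `k` of the first tensor factor open. -/
theorem sitePoly_head {U : Set ℂ} {T : Fin (n + 1) → Fin (n + 1) → ℂ → Module.End K H}
    (hT : IsRTT q U T) {ell : Fin (n + 1) → ℂ → K} {a : ℂ} (ha : a ∈ U) {l : List ℂ}
    (hl : ∀ x ∈ l, x ∈ U ∧ x ≠ a) (W : (Fin (a :: l).length → Fin n) → H)
    (hW : ∀ κ, FirstCol T ell a (W κ)) (k : Fin n) :
    sitePoly q T a (a :: l) W k.succ =
      ((q - q⁻¹) * a * (l.map fun x => x - a).prod * fProd q l [a]) •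
        ell 0 a • evL T l fun κ => W (Fin.cons k κ) := by
  rw [sitePoly, Finset.sum_apply, Finset.sum_eq_single k]
  · rw [siteHat_self, if_pos rfl, sitePoly_eq T l fun x hx => (hl x hx).2,
      LinearMap.map_smul_of_tower, theta_zero_evL hT ha l hl]
    simp only [theta_single, (hW _).2]
    have : (fun κ : Fin l.length → Fin n => ell 0 a • W (Fin.cons k κ)) =
      ell 0 a • fun κ : Fin l.length → Fin n => W (Fin.cons k κ) := rfl
    rw [this, map_smul, smul_smul, smul_smul, mul_assoc]
  · intro k' _ hk
    rw [siteHat_self, if_neg fun h => hk (Fin.succ_inj.mp h).symm]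
  · simp

theorem finite_letters {N : ℕ} (t : Fin N → List ℂ) : {x | ∃ k, x ∈ t k}.Finite := by
  have : {x | ∃ k, x ∈ t k} = ⋃ k, {x | x ∈ t k} := by ext; simp
  rw [this]
  exact Set.finite_iUnion fun k => List.finite_toSet _

theorem cofinite_inhomogeneity (hq : q ≠ 0) {S : Set ℂ} (hS : S.Finite) :
    {z | ∀ x ∈ S, x ≠ z ∧ fFun q x z ≠ 0}ᶜ.Finite := by
  refine (hS.union (hS.image fun x => q * (q * x))).subset fun z hz => ?_
  by_contra h
  simp only [Set.mem_union, not_or, Set.mem_image, not_exists, not_and] at h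
  refine hz fun x hx => ?_
  have hxz : x ≠ z := fun h' => h.1 (h' ▸ hx)
  refine ⟨hxz, fFun_ne_zero_of_ne hxz fun h0 => h.2 x hx ?_⟩
  rw [sub_eq_zero.mp h0, mul_inv_cancel_left₀ hq]


theorem vpoly_eraseIdx {l : List ℂ} {i : ℕ} (hi : i < l.length) (a b : ℂ → ℂ) (x : H) :
    VPoly l.length fun z => ((l.eraseIdx i).map fun x => a x + b x * z).prod • x := by
  have := VPoly.prod_smul (l.eraseIdx i) a b x
  rwa [List.length_eraseIdx_of_lt hi, Nat.sub_add_cancel (by omega)] at this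

theorem exists_nodup_index {l : List ℂ} {x : ℂ} (hx : x ∈ l) : ∃ i < l.length, l.getD i 0 = x := by
  obtain ⟨i, hi, h⟩ := List.getElem_of_mem hx
  exact ⟨i, hi, by rw [List.getD_eq_getElem _ _ hi, h]⟩

theorem getD_mem {l : List ℂ} {i : ℕ} (hi : i < l.length) : l.getD i 0 ∈ l := by
  rw [List.getD_eq_getElem _ _ hi]
  exact List.getElem_mem hi

theorem getD_notMem_eraseIdx {l : List ℂ} (hl : l.Nodup) {i : ℕ} (hi : i < l.length) :
    l.getD i 0 ∉ l.eraseIdx i :=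
  (List.nodup_cons.mp ((perm_getD_cons_eraseIdx hi).nodup_iff.mp hl)).1

theorem getD_mem_eraseIdx {l : List ℂ} (hl : l.Nodup) {i j : ℕ} (hi : i < l.length)
    (hj : j < l.length) (hij : i ≠ j) : l.getD i 0 ∈ l.eraseIdx j := by
  rcases List.mem_cons.mp ((perm_getD_cons_eraseIdx hj).mem_iff.mp (getD_mem hi)) with h | h
  · rw [List.getD_eq_getElem _ _ hi, List.getD_eq_getElem _ _ hj, hl.getElem_inj_iff] at h
    exact absurd h hij
  · exact h

theorem Distinct.perm_head {N : ℕ} {S : Set ℂ} {l l' : List ℂ} {t : Fin N → List ℂ}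
    (h : Distinct S (Fin.cons l t : Fin (N + 1) → List ℂ)) (hp : l.Perm l') :
    Distinct S (Fin.cons l' t : Fin (N + 1) → List ℂ) :=
  h.perm fun k => by refine Fin.cases hp (fun k => ?_) k; exact .refl _

theorem Distinct.sublist_head {N : ℕ} {S : Set ℂ} {l l' : List ℂ} {t : Fin N → List ℂ}
    (h : Distinct S (Fin.cons l t : Fin (N + 1) → List ℂ)) (hp : l'.Sublist l) :
    Distinct S (Fin.cons l' t : Fin (N + 1) → List ℂ) :=
  h.sublist fun k => by refine Fin.cases hp (fun k => ?_) k; exact .refl _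

theorem Distinct.cons_tail {N : ℕ} {S : Set ℂ} {l : List ℂ} {t : Fin N → List ℂ}
    (h : Distinct S (Fin.cons l t : Fin (N + 1) → List ℂ)) : Distinct (S \ {x | x ∈ l}) t := h.tail

theorem bv_cons {N : ℕ} (T : Fin (N + 1 + 1) → Fin (N + 1 + 1) → ℂ → Module.End K H) (vac : H)
    (l : List ℂ) (t : Fin N → List ℂ) :
    bv q (N + 1) T vac (Fin.cons l t : Fin (N + 1) → List ℂ) = (fProd q (colorOr t 0) l)⁻¹ •
      evL T l (bv q N (chainL q (lowerBlock T) l) (vacL N vac l) t) := by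
  rw [bv_succ, colorOr_succ]
  rfl

/-- This is `bv_perm` for the one-site extension, with the common normalizing factor removed;
`bv_lowerBlock_site` identifies the inner vectors. -/
theorem evL_site_perm (hq : q ≠ 0) {N : ℕ} {U S : Set ℂ}
    {T : Fin (N + 1 + 1) → Fin (N + 1 + 1) → ℂ → Module.End K H} {vac : H}
    {ell : Fin (N + 1 + 1) → ℂ → K} (hT : IsVacModel q U T vac ell) (hS : S ⊆ U)
    (hf : Nondeg q S) {l l' : List ℂ} {t : Fin N → List ℂ}
    (ht : Distinct S (Fin.cons l t : Fin (N + 1) → List ℂ)) (hl : l.Perm l') {z : ℂ}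
    (hz : ∀ k, ∀ x ∈ (Fin.cons l t : Fin (N + 1) → List ℂ) k, x ≠ z ∧ fFun q x z ≠ 0) :
    (evL (site q T z) l fun κ =>
      Pi.single 0 (bv q N (chainL q (lowerBlock T) l) (vacL N vac l) t κ)) =
    evL (site q T z) l' fun κ =>
      Pi.single 0 (bv q N (chainL q (lowerBlock T) l') (vacL N vac l') t κ) := by
  have h1 := ht.cons_tail.mono Set.sdiff_subset
  have e : ∀ l, (fun κ =>
      (Pi.single 0 (bv q N (chainL q (lowerBlock T) l) (vacL N vac l) t κ) : Fin (N + 2) → H)) =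
      bv q N (chainL q (lowerBlock (site q T z)) l) (vacL N (Pi.single 0 vac) l) t := fun l =>
    funext fun κ => ((bv_lowerBlock_site hT hS z l t h1 κ).2).symm
  have h2 : Distinct {x ∈ S | x ≠ z ∧ fFun q x z ≠ 0} (Fin.cons l t : Fin (N + 1) → List ℂ) :=
    ⟨ht.nodup, fun k x hx => ⟨ht.mem k x hx, hz k x hx⟩, ht.disj⟩
  have h3 := bv_perm hq (hT.oneSite hq z) (fun x hx => ⟨hS hx.1, hx.2⟩ :
    {x ∈ S | x ≠ z ∧ fFun q x z ≠ 0} ⊆ siteSet q z U) (hf.mono fun x hx => hx.1) h2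
    (t' := Fin.cons l' t) (fun k => by refine Fin.cases hl (fun k => ?_) k; exact .refl _)
  rw [bv_cons, bv_cons, fProd_perm (.refl _) hl] at h3
  rw [e, e]
  refine smul_right_injective _ (inv_ne_zero (fProd_ne_zero (q := q) fun u hu v hv => ?_)) h3
  obtain ⟨k, hu⟩ := mem_colorOr hu
  have hv := hl.mem_iff.mpr hv
  have hu' := ht.disj (Fin.succ ⟨_, k⟩) 0 (Fin.succ_ne_zero _) u hu
  exact hf u (ht.mem (Fin.succ ⟨_, k⟩) u hu) v (ht.mem 0 v hv) fun h => hu' (h ▸ hv)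

/-- The symmetry of the extended Bethe vector requires `z` to avoid the variables. Both sides are
polynomial in `z`, so it persists at `z ∈ l`, where it is applied. -/
theorem sitePoly_perm (hq : q ≠ 0) {N : ℕ} {U S : Set ℂ}
    {T : Fin (N + 1 + 1) → Fin (N + 1 + 1) → ℂ → Module.End K H} {vac : H}
    {ell : Fin (N + 1 + 1) → ℂ → K} (hT : IsVacModel q U T vac ell) (hS : S ⊆ U)
    (hf : Nondeg q S) {l l' : List ℂ} {t : Fin N → List ℂ}
    (ht : Distinct S (Fin.cons l t : Fin (N + 1) → List ℂ)) (hl : l.Perm l') (z : ℂ)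
    (k : Fin (N + 1)) :
    sitePoly q T z l (bv q N (chainL q (lowerBlock T) l) (vacL N vac l) t) k.succ =
      sitePoly q T z l' (bv q N (chainL q (lowerBlock T) l') (vacL N vac l') t) k.succ := by
  refine ((sitePoly_vpoly T l _).1 k).eq_of_cofinite
    (hl.length_eq ▸ (sitePoly_vpoly T l' _).1 k) (cofinite_inhomogeneity hq
      (finite_letters (Fin.cons l t : Fin (N + 1) → List ℂ))) (fun z hz => ?_) z
  rw [sitePoly_eq T l fun x hx => (hz x ⟨0, hx⟩).1,
    sitePoly_eq T l' fun x hx => (hz x ⟨0, hl.mem_iff.mpr hx⟩).1, (hl.map _).prod_eq,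
    evL_site_perm hq hT hS hf ht hl fun k x hx => hz x ⟨k, hx⟩]

theorem bv_site_zero {N : ℕ} {U S : Set ℂ}
    {T : Fin (N + 1) → Fin (N + 1) → ℂ → Module.End K H} {vac : H}
    {ell : Fin (N + 1) → ℂ → K} (hT : IsVacModel q U T vac ell) (hS : S ⊆ U) (z : ℂ)
    {t : Fin N → List ℂ} (ht : Distinct S t) :
    bv q N (site q T z) (Pi.single 0 vac) t 0 = bv q N T vac t := by
  cases N with
  | zero => simp [bv_zero]
  | succ N =>
    rw [bv_succ, bv_succ, Pi.smul_apply, evL_site_zero]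
    congr 2
    funext κ
    rw [(bv_lowerBlock_site hT hS z _ _ (ht.tail.mono Set.sdiff_subset) κ).2, Pi.single_eq_same]

/-- Lagrange interpolation at the elements of `l`: the degree is less than `l.length`, and the value
at each node follows from `sitePoly_head` once that element is moved to the front. The surviving
term is a component of an inner Bethe vector with an additional site at the node, which prepares the
iteration over colors. -/
theorem bv_site_succ (hq : q ≠ 0) {N : ℕ} {U S : Set ℂ}
    {T : Fin (N + 1 + 1) → Fin (N + 1 + 1) → ℂ → Module.End K H} {vac : H}
    {ell : Fin (N + 1 + 1) → ℂ → K} (hT : IsVacModel q U T vac ell) (hS : S ⊆ U)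
    (hf : Nondeg q S) {l : List ℂ} {t : Fin N → List ℂ}
    (ht : Distinct S (Fin.cons l t : Fin (N + 1) → List ℂ)) {z : ℂ} (hz : ∀ x ∈ l, x ≠ z)
    (k : Fin (N + 1)) :
    bv q (N + 1) (site q T z) (Pi.single 0 vac) (Fin.cons l t : Fin (N + 1) → List ℂ) k.succ =
      (fProd q (colorOr t 0) l)⁻¹ • ∑ i ∈ Finset.range l.length,
        (gL q (l.getD i 0) z * fProd q (l.eraseIdx i) [l.getD i 0]) • ell 0 (l.getD i 0) •
          evL T (l.eraseIdx i) (bv q N (site q (chainL q (lowerBlock T) (l.eraseIdx i))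
            (l.getD i 0)) (Pi.single 0 (vacL N vac (l.eraseIdx i))) t k) := by
  have h1 := ht.cons_tail.mono Set.sdiff_subset
  have hnd : l.Nodup := ht.nodup 0
  have hlS : ∀ x ∈ l, x ∈ S := ht.mem 0
  set Y : ℕ → H := fun i => ell 0 (l.getD i 0) •
          evL T (l.eraseIdx i) (bv q N (site q (chainL q (lowerBlock T) (l.eraseIdx i))
            (l.getD i 0)) (Pi.single 0 (vacL N vac (l.eraseIdx i))) t k) with hY
  have key : ∀ z, sitePoly q T z l (bv q N (chainL q (lowerBlock T) l) (vacL N vac l) t) k.succ =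
      ∑ i ∈ Finset.range l.length, ((l.eraseIdx i).map fun x => x + -1 * z).prod •
        ((q - q⁻¹) * l.getD i 0 * fProd q (l.eraseIdx i) [l.getD i 0]) • Y i := by
    refine ((sitePoly_vpoly T l _).1 k).eq_of_eqOn (VPoly.sum _ fun i hi =>
      vpoly_eraseIdx (Finset.mem_range.mp hi) _ _ _) (s := l.toFinset)
      (List.toFinset_card_of_nodup hnd).ge fun a ha => ?_
    obtain ⟨i, hi, rfl⟩ := exists_nodup_index (List.mem_toFinset.mp ha)
    have hni := getD_notMem_eraseIdx hnd hi
    rw [sitePoly_perm hq hT hS hf ht (perm_getD_cons_eraseIdx hi),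
      sitePoly_head hT.rtt (ell := ell) (hS (hlS _ (getD_mem hi))) (fun x hx => ⟨hS (hlS x
        (List.mem_of_mem_eraseIdx hx)), fun h => hni (h ▸ hx)⟩) _ (fun κ =>
        -- The inhomogeneity `0` is a dummy value: the `FirstCol` half of the statement does not
        -- involve it.
        (bv_lowerBlock_site hT hS 0 _ t h1 κ).1 _ (hlS _ (getD_mem hi)) fun k hk =>
          ht.disj k.succ 0 (Fin.succ_ne_zero k) _ hk (getD_mem hi)),
      Finset.sum_eq_single i]
    · simp only [bv_chainL_cons, smul_smul, hY]
      congr 1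
      simp only [sub_eq_add_neg, neg_one_mul]
      ring
    · intro j hj hji
      rw [List.prod_eq_zero, zero_smul]
      exact List.mem_map.mpr ⟨_, getD_mem_eraseIdx hnd hi (Finset.mem_range.mp hj) hji.symm,
        by ring⟩
    · intro h; exact absurd (Finset.mem_range.mpr hi) h
  have hz' := key z
  rw [sitePoly_eq T l hz, Pi.smul_apply] at hz'
  have hne : (l.map fun x => x - z).prod ≠ 0 := by
    refine List.prod_ne_zero fun h0 => ?_
    obtain ⟨x, hx, h0⟩ := List.mem_map.mp h0
    exact hz x hx (sub_eq_zero.mp h0)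
  rw [bv_cons, Pi.smul_apply]
  congr 1
  refine smul_right_injective H hne ?_
  simp only
  rw [funext fun κ => (bv_lowerBlock_site hT hS z l t h1 κ).2, hz', Finset.smul_sum]
  refine Finset.sum_congr rfl fun i hi => ?_
  have hi := Finset.mem_range.mp hi
  rw [smul_smul, smul_smul]
  congr 1
  rw [((perm_getD_cons_eraseIdx hi).map fun x => x - z).prod_eq, List.map_cons, List.prod_cons,
    gL, gFun]
  have := sub_ne_zero.mpr (hz _ (getD_mem hi))
  simp only [sub_eq_add_neg, neg_one_mul] at this ⊢
  field_simp

end OneSiteFormula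

/-! ## The leading part of the action of the first column -/

section FirstColumn

variable {q : ℂ} {n : ℕ} {K : Type*} [CommRing K] [Algebra ℂ K]
  {H : Type*} [AddCommGroup H] [Module K H] [Module ℂ H] [IsScalarTower ℂ K H]

/-- A multi-index with one more entry at the end. -/
def snocIdx (a : ℂ) : (l : List ℂ) → (Fin l.length → Fin n) → Fin n →
    (Fin (l ++ [a]).length → Fin n)
  | [], _, k => (Fin.cons k Fin.elim0 : Fin 1 → Fin n)
  | _ :: l, κ, k => (Fin.cons (κ 0) (snocIdx a l (Fin.tail κ) k) :
      Fin ((l ++ [a]).length + 1) → Fin n)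

theorem snocIdx_cons (a x : ℂ) (l : List ℂ) (c : Fin n) (κ : Fin l.length → Fin n) (k : Fin n) :
    snocIdx a (x :: l) (Fin.cons c κ) k =
      (Fin.cons c (snocIdx a l κ k) : Fin ((l ++ [a]).length + 1) → Fin n) := rfl

/-- The last element of the list is the innermost site, so it can be absorbed into `D`. -/
theorem chainL_snoc (D : Fin n → Fin n → ℂ → Module.End K H) (a : ℂ) (i j : Fin n) (u : ℂ) :
    ∀ (l : List ℂ) (X : (Fin (l ++ [a]).length → Fin n) → H) (κ : Fin l.length → Fin n) (k : Fin n),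
      chainL q D (l ++ [a]) i j u X (snocIdx a l κ k) =
        chainL q (site q D a) l i j u (fun κ k => X (snocIdx a l κ k)) κ k
  | [], X, κ, k => by
    have h1 := chainL_cons (q := q) D a [] i j u X k Fin.elim0
    rw [site_apply, Finset.sum_apply] at h1
    rw [chainL_nil, site_apply]
    refine h1.trans (Finset.sum_congr rfl fun k _ => ?_)
    rw [Finset.sum_apply]
    rfl
  | x :: l, X, κ, k => by
    obtain ⟨c, κ, rfl⟩ : ∃ c κ', κ = Fin.cons c κ' := ⟨κ 0, Fin.tail κ, (Fin.cons_self_tail κ).symm⟩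
    rw [snocIdx_cons, chainL_cons (site q D a) x l]
    refine (chainL_cons (q := q) D x (l ++ [a]) i j u X c _).trans ?_
    simp only [site_apply (chainL q D (l ++ [a])), site_apply (chainL q (site q D a) l),
      Finset.sum_apply, Pi.smul_apply, chainL_snoc D a]
    rfl

theorem vacL_snoc (vac : H) (a : ℂ) :
    ∀ (l : List ℂ) (κ : Fin l.length → Fin (n + 1)) (k : Fin (n + 1)),
      vacL n vac (l ++ [a]) (snocIdx a l κ k) =
        vacL n (Pi.single 0 vac : Fin (n + 1) → H) l κ k
  | [], κ, k => by
    have h : ∀ κ : Fin 0 → Fin (n + 1), κ = fun _ => 0 := fun κ => Subsingleton.elim _ _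
    refine (vacL_cons vac a [] k Fin.elim0).trans ?_
    by_cases hk : k = 0
    · subst hk
      simp only [Pi.single_eq_same, vacL, List.length_nil, h Fin.elim0, h κ]
    · simp only [Pi.single_eq_of_ne hk, vacL, List.length_nil, h κ, Pi.single_eq_same, Pi.zero_apply]
  | x :: l, κ, k => by
    obtain ⟨c, κ, rfl⟩ : ∃ c κ', κ = Fin.cons c κ' := ⟨κ 0, Fin.tail κ, (Fin.cons_self_tail κ).symm⟩
    rw [snocIdx_cons, vacL_cons]
    refine (vacL_cons vac x (l ++ [a]) c _).trans ?_
    by_cases hc : c = 0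
    · subst hc
      simp only [Pi.single_eq_same]
      exact vacL_snoc vac a l κ k
    · simp only [Pi.single_eq_of_ne hc, Pi.zero_apply]

theorem bv_chainL_snoc {N : ℕ} (D : Fin (N + 1) → Fin (N + 1) → ℂ → Module.End K H) (vac : H)
    (a : ℂ) (l : List ℂ) (t : Fin N → List ℂ) (κ k) :
    bv q N (chainL q D (l ++ [a])) (vacL N vac (l ++ [a])) t (snocIdx a l κ k) =
      bv q N (chainL q (site q D a) l) (vacL N (Pi.single 0 vac) l) t κ k := by
  refine bv_rel (q := q) N (Rel := fun (X : (Fin (l ++ [a]).length → Fin (N + 1)) → H)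
      (Y : (Fin l.length → Fin (N + 1)) → Fin (N + 1) → H) => ∀ κ k, X (snocIdx a l κ k) = Y κ k)
    ⟨fun _ _ => rfl, fun h h' c κ => ?_, fun z _ _ h c κ => ?_⟩ t (fun k u hu i j x y h κ k => ?_)
    (vacL_snoc vac a l) κ k
  · simp [h c κ, h' c κ]
  · simp [h c κ]
  · rw [chainL_snoc]
    have : (fun κ k => x (snocIdx a l κ k)) = y := funext fun κ => funext fun k => h κ k
    rw [this]

/-- Moving the last site of a chain to the front. -/
theorem exists_move_intertwiner (hq : q ≠ 0)
    (D : Fin (n + 1) → Fin (n + 1) → ℂ → Module.End K H) (vac : H) (a : ℂ) :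
    ∀ (l : List ℂ) (_ : a ∉ l),
    ∃ Ω : (Fin (n + 1) → (Fin l.length → Fin (n + 1)) → H) →ₗ[K]
        ((Fin l.length → Fin (n + 1)) → Fin (n + 1) → H),
      (∀ u, u ≠ a → u ∉ l → ∀ i j X, Ω (site q (chainL q D l) a i j u X) =
        chainL q (site q D a) l i j u (Ω X)) ∧
      Ω (Pi.single 0 (vacL n vac l)) = fProd q [a] l • vacL n (Pi.single 0 vac) l ∧
      ∀ p X κ, theta D p a (Ω X κ) = theta (chainL q D l) p a X κ
  | [], _ => by
    refine ⟨LinearMap.pi fun κ => LinearMap.pi fun k => LinearMap.proj κ ∘ₗ LinearMap.proj k,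
      fun u _ _ i j X => ?_, ?_, fun p X κ => ?_⟩
    · funext κ k
      rw [chainL_nil]
      simp only [LinearMap.pi_apply, LinearMap.comp_apply, LinearMap.proj_apply, site_apply,
        Finset.sum_apply, Pi.smul_apply, chainL_nil]
    · funext κ k
      have h : ∀ κ : Fin 0 → Fin (n + 1), κ = fun _ => 0 := fun κ => Subsingleton.elim _ _
      by_cases hk : k = 0
      · subst hk
        simp [vacL, fProd_nil_right, h κ]
      · simp [vacL, h κ, hk]
    · rw [theta_apply, theta_apply, Finset.sum_apply]
      rfl
  | x :: l, ha => by
    have hax : a ≠ x := fun h => ha (by simp [h])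
    obtain ⟨Ω, h1, h2, h3⟩ := exists_move_intertwiner hq D vac a l fun h => ha (by simp [h])
    let Ψ : (Fin (n + 1) → (Fin (x :: l).length → Fin (n + 1)) → H) →ₗ[K]
        ((Fin (x :: l).length → Fin (n + 1)) → Fin (n + 1) → H) :=
      LinearMap.pi fun κ => LinearMap.proj (Fin.tail κ) ∘ₗ Ω ∘ₗ LinearMap.proj (κ 0) ∘ₗ
        rCheck K q (n + 1) a x ∘ₗ
          LinearMap.pi (fun d => uncons K (n + 1) l.length ∘ₗ LinearMap.proj d)
    have hΨ : ∀ X s κ, Ψ X (Fin.cons s κ) =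
        Ω (rCheck K q (n + 1) a x (fun k d κ' => X k (Fin.cons d κ')) s) κ := fun _ _ _ => rfl
    refine ⟨Ψ, fun u hua hul i j X => ?_, ?_, fun p X κ => ?_⟩
    · refine funext_cons fun s κ => ?_
      simp only [List.mem_cons, not_or] at hul
      rw [hΨ, chainL_cons]
      have e : (fun k d κ' => site q (chainL q D (x :: l)) a i j u X k (Fin.cons d κ')) =
          site q (site q (chainL q D l) x) a i j u fun k d κ' => X k (Fin.cons d κ') := by
        funext k d κ'
        rw [site_apply, site_apply]
        simp only [Finset.sum_apply, Pi.smul_apply, chainL_cons]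
      rw [e, rCheck_site hq _ hax hua hul.1, site_apply, site_apply]
      simp only [map_sum, LinearMap.map_smul_of_tower, h1 u hua hul.2]
      rfl
    · refine funext_cons fun s κ => ?_
      have e : (fun k d κ' => (Pi.single 0 (vacL n vac (x :: l)) :
          Fin (n + 1) → (Fin (x :: l).length → Fin (n + 1)) → H) k (Fin.cons d κ')) =
          Pi.single 0 (Pi.single 0 (vacL n vac l)) := by
        funext k d κ'
        by_cases hk : k = 0
        · subst hk; simp only [Pi.single_eq_same]; exact vacL_cons ..
        · simp [hk]
      rw [hΨ, e, rCheck_single, Pi.smul_apply, LinearMap.map_smul_of_tower, Pi.smul_apply,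
        Pi.smul_apply, vacL_cons, fProd_cons_right, fProd_singleton, mul_smul]
      congr 1
      by_cases hs : s = 0
      · subst hs; simp [h2]
      · simp [hs]
    · obtain ⟨s, κ, rfl⟩ : ∃ c κ', κ = Fin.cons c κ' :=
        ⟨κ 0, Fin.tail κ, (Fin.cons_self_tail κ).symm⟩
      rw [hΨ, h3, theta_apply, theta_apply]
      simp only [Finset.sum_apply, chainL_cons, site_apply, rCheck_apply, map_sum,
        LinearMap.map_smul_of_tower, Pi.smul_apply]
      rw [Finset.sum_comm]

/-- The evaluation at a node leaves the site `a` innermost, next to `D`, whereas the iteration over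
colors needs it outermost, over the chain. The transport preserves `theta` and multiplies the vacuum
by `f(a, l)`. -/
theorem theta_bv_move (hq : q ≠ 0) {N : ℕ} (D : Fin (N + 1) → Fin (N + 1) → ℂ → Module.End K H)
    (vac : H) {a : ℂ} {l : List ℂ} (ha : a ∉ l) (t : Fin N → List ℂ)
    (ht : ∀ k, ∀ x ∈ t k, x ≠ a ∧ x ∉ l) (p : Fin (N + 1)) (κ) :
    theta (chainL q D l) p a (bv q N (site q (chainL q D l) a) (Pi.single 0 (vacL N vac l)) t) κ =
      fProd q [a] l •
        theta D p a (bv q N (chainL q (site q D a) l) (vacL N (Pi.single 0 vac) l) t κ) := by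
  obtain ⟨Ω, h1, h2, h3⟩ := exists_move_intertwiner hq D vac a l ha
  rw [← h3, bv_map (T' := chainL q (site q D a) l) Ω _ t fun k u hu i j x =>
    h1 u (ht k u hu).1 (ht k u hu).2 i j x, h2, bv_smul, Pi.smul_apply,
    LinearMap.map_smul_of_tower]

/-- The contraction of a tensor with the first row, one entry of which is replaced by the entry of
the row `p`. -/
noncomputable def rowSum (q : ℂ) (T : Fin (n + 1) → Fin (n + 1) → ℂ → Module.End K H)
    (p : Fin (n + 1)) (y : ℂ) : (l : List ℂ) → ((Fin l.length → Fin n) → H) → H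
  | [], _ => 0
  | a :: l, W => ∑ k, (T 0 k.succ a (rowSum q T p y l fun κ => W (Fin.cons k κ)) +
      (gL q a y * fProd q l [y]) • T p k.succ a (evL T l fun κ => W (Fin.cons k κ)))

/-- `rowSum`, multiplied by the denominators; polynomial in `y`. -/
noncomputable def rowPoly (q : ℂ) (T : Fin (n + 1) → Fin (n + 1) → ℂ → Module.End K H)
    (p : Fin (n + 1)) (y : ℂ) : (l : List ℂ) → ((Fin l.length → Fin n) → H) → H
  | [], _ => 0
  | a :: l, W => ∑ k, ((a - y) • T 0 k.succ a (rowPoly q T p y l fun κ => W (Fin.cons k κ)) +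
      ((q - q⁻¹) * a * (l.map fun x => q * x - q⁻¹ * y).prod) •
        T p k.succ a (evL T l fun κ => W (Fin.cons k κ)))

/-- Each passage of `theta` in row `p` through a row-0 entry either leaves both rows or swaps them.
If they never swap, the innermost vector is annihilated; after one swap `theta` is in row 0,
collects `f` and ends in the eigenvalue. Hence exactly one entry of the row is replaced. -/
theorem theta_evL {U : Set ℂ} {T : Fin (n + 1) → Fin (n + 1) → ℂ → Module.End K H}
    (hT : IsRTT q U T) {ell : Fin (n + 1) → ℂ → K} {y : ℂ} (hy : y ∈ U) {p : Fin (n + 1)}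
    (hp : p ≠ 0) :
    ∀ (l : List ℂ) (_ : ∀ x ∈ l, x ∈ U ∧ x ≠ y) (W : (Fin l.length → Fin n) → H)
      (_ : ∀ κ, FirstCol T ell y (W κ)),
      theta T p y (evL (site q T y) l fun κ => Pi.single 0 (W κ)) = ell 0 y • rowSum q T p y l W
  | [], _, W, hW => by
    rw [evL_nil, theta_single, (hW _).1 p hp, rowSum, smul_zero]
  | a :: l, h, W, hW => by
    have h' : ∀ x ∈ l, x ∈ U ∧ x ≠ y := fun x hx => h x (by simp [hx])
    rw [evL_cons, map_sum, rowSum, Finset.smul_sum]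
    refine Finset.sum_congr rfl fun k _ => ?_
    rw [hT.theta_site (h a (by simp)).1 hy (h a (by simp)).2, if_neg hp.symm,
      theta_evL hT hy hp l h' _ fun κ => hW _, theta_zero_evL hT hy l h']
    simp only [theta_single, (hW _).2]
    have : (fun κ : Fin l.length → Fin n => ell 0 y • W (Fin.cons k κ)) =
      ell 0 y • fun κ : Fin l.length → Fin n => W (Fin.cons k κ) := rfl
    rw [this, LinearMap.map_smul, LinearMap.map_smul, LinearMap.map_smul_of_tower,
      LinearMap.map_smul, smul_add, smul_smul]
    congr 1
    rw [smul_comm, gOff, if_pos (Fin.pos_of_ne_zero hp), gL]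

theorem prod_mul_fProd {y : ℂ} : ∀ {l : List ℂ} (_ : ∀ x ∈ l, x ≠ y),
    (l.map fun x => x - y).prod * fProd q l [y] = (l.map fun x => q * x - q⁻¹ * y).prod
  | [], _ => by simp [fProd]
  | a :: l, h => by
    have := sub_ne_zero.mpr (h a (by simp))
    rw [fProd_cons_left, fProd_singleton, List.map_cons, List.prod_cons, List.map_cons,
      List.prod_cons, ← prod_mul_fProd fun x hx => h x (by simp [hx]), fFun]
    field_simp

theorem rowPoly_eq (T : Fin (n + 1) → Fin (n + 1) → ℂ → Module.End K H) (p : Fin (n + 1)) {y : ℂ} :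
    ∀ (l : List ℂ) (_ : ∀ x ∈ l, x ≠ y) (W : (Fin l.length → Fin n) → H),
      rowPoly q T p y l W = (l.map fun x => x - y).prod • rowSum q T p y l W
  | [], _, W => by simp [rowPoly, rowSum]
  | a :: l, h, W => by
    have h' : ∀ x ∈ l, x ≠ y := fun x hx => h x (by simp [hx])
    rw [rowPoly, rowSum, Finset.smul_sum]
    refine Finset.sum_congr rfl fun k _ => ?_
    rw [rowPoly_eq T p l h', LinearMap.map_smul_of_tower, smul_add, smul_smul, smul_smul,
      List.map_cons, List.prod_cons, ← prod_mul_fProd h', gL, gFun]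
    congr 2
    have := sub_ne_zero.mpr (h a (by simp))
    field_simp

theorem rowPoly_vpoly (T : Fin (n + 1) → Fin (n + 1) → ℂ → Module.End K H) (p : Fin (n + 1)) :
    ∀ (l : List ℂ) (W : (Fin l.length → Fin n) → H),
      VPoly l.length fun y => rowPoly q T p y l W
  | [], _ => VPoly.zero
  | a :: l, W => by
    simp only [rowPoly]
    refine VPoly.sum _ fun k _ => VPoly.add ?_ ?_
    · simpa [sub_eq_add_neg] using
        ((rowPoly_vpoly T p l fun κ => W (Fin.cons k κ)).map (T 0 k.succ a)).smul_linear a (-1)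
    · simpa [sub_eq_add_neg, mul_smul] using (VPoly.prod_smul l (fun x => q * x) (fun _ => -q⁻¹)
        (T p k.succ a (evL T l fun κ => W (Fin.cons k κ)))).smul_const ((q - q⁻¹) * a)

/-- The node `y = q²a` is the zero of `q a - q⁻¹ y`. This factor occurs in every term whose replaced
entry stands before the last place, so only the replacement at `a` itself survives. -/
theorem rowPoly_last (hq : q ≠ 0) (T : Fin (n + 1) → Fin (n + 1) → ℂ → Module.End K H)
    (p : Fin n) (a : ℂ) :
    ∀ (l : List ℂ) (W : (Fin (l ++ [a]).length → Fin n) → H),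
      rowPoly q T p.succ (q * (q * a)) (l ++ [a]) W =
        ((q - q⁻¹) * a * (l.map fun x => x - q * (q * a)).prod) •
          evL T l fun κ => theta (lowerBlock T) p a fun k => W (snocIdx a l κ k)
  | [], W => by
    have : rowPoly q T p.succ (q * (q * a)) [a] W = ((q - q⁻¹) * a) •
        ∑ k : Fin n, T p.succ k.succ a (W (Fin.cons k Fin.elim0)) := by
      simp only [rowPoly, map_zero, smul_zero, zero_add, List.map_nil, List.prod_nil, mul_one,
        Finset.smul_sum]
      refine Finset.sum_congr rfl fun k _ => ?_
      rw [evL_nil]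
    refine this.trans ?_
    rw [evL_nil, theta_apply]
    simp only [List.map_nil, List.prod_nil, mul_one]
    rfl
  | x :: l, W => by
    have h0 : ((l ++ [a]).map fun x => q * x - q⁻¹ * (q * (q * a))).prod = 0 := by
      refine List.prod_eq_zero (List.mem_map.mpr ⟨a, by simp, ?_⟩)
      rw [inv_mul_cancel_left₀ hq, sub_self]
    have : rowPoly q T p.succ (q * (q * a)) (x :: (l ++ [a])) W = ∑ k, (x - q * (q * a)) •
        T 0 k.succ x (rowPoly q T p.succ (q * (q * a)) (l ++ [a]) fun κ => W (Fin.cons k κ)) := by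
      simp only [rowPoly, h0, mul_zero, zero_smul, add_zero]
    refine this.trans ?_
    rw [evL_cons, Finset.smul_sum]
    refine Finset.sum_congr rfl fun k _ => ?_
    rw [rowPoly_last hq T p a l, LinearMap.map_smul_of_tower, smul_smul, List.map_cons,
      List.prod_cons]
    congr 1
    ring

end FirstColumn

/-! ### Interpolation for the contraction with a row -/

section FirstColumnFormula

variable {q : ℂ} {N : ℕ} {K : Type*} [CommRing K] [Algebra ℂ K]
  {H : Type*} [AddCommGroup H] [Module K H] [Module ℂ H] [IsScalarTower ℂ K H] {U S : Set ℂ}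

/-- This case terminates the iteration over colors. -/
theorem theta_bv_zero {T : Fin (N + 1) → Fin (N + 1) → ℂ → Module.End K H} {vac : H}
    {ell : Fin (N + 1) → ℂ → K} (hT : IsVacModel q U T vac ell) (hS : S ⊆ U)
    {t : Fin N → List ℂ} (ht : Distinct S t) {y : ℂ} (hy : y ∈ U) (hyt : ∀ k, ∀ x ∈ t k, x ≠ y) :
    theta T 0 y (bv q N (site q T y) (Pi.single 0 vac) t) =
      fProd q (colorOr t 0) [y] • ell 0 y • bv q N T vac t := by
  cases N with
  | zero => simp [bv_zero, theta_single, hT.diag y hy, colorOr, fProd_nil_left]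
  | succ N =>
    have h1 : insert y S ⊆ U := Set.insert_subset hy hS
    have h2 := ht.tail.mono (Set.sdiff_subset.trans (Set.subset_insert y S))
    rw [bv_succ, bv_succ, LinearMap.map_smul_of_tower, theta_zero_evL hT.rtt hy _ fun x hx =>
      ⟨hS (ht.mem 0 x hx), hyt 0 x hx⟩, colorOr_zero]
    have : (fun κ => theta T 0 y (bv q N (chainL q (lowerBlock (site q T y)) (t 0))
        (vacL N (Pi.single 0 vac) (t 0)) (fun k => t k.succ) κ)) =
        ell 0 y • bv q N (chainL q (lowerBlock T) (t 0)) (vacL N vac (t 0))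
          (fun k => t k.succ) := by
      funext κ
      have h3 := bv_lowerBlock_site hT h1 y (t 0) _ h2 κ
      rw [h3.2, theta_single, (h3.1 y (by simp) fun k hk => hyt k.succ y hk rfl).2]
      rfl
    rw [this, LinearMap.map_smul, smul_comm]
    congr 1
    rw [smul_comm _ (ell 0 y)]

theorem firstCol_bv {T : Fin (N + 1 + 1) → Fin (N + 1 + 1) → ℂ → Module.End K H} {vac : H}
    {ell : Fin (N + 1 + 1) → ℂ → K} (hT : IsVacModel q U T vac ell) (hS : S ⊆ U) {l : List ℂ}
    {t : Fin N → List ℂ} (ht : Distinct S t) {y : ℂ} (hy : y ∈ U) (hyt : ∀ k, ∀ x ∈ t k, x ≠ y)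
    (κ) : FirstCol T ell y (bv q N (chainL q (lowerBlock T) l) (vacL N vac l) t κ) :=
  (bv_lowerBlock_site hT (Set.insert_subset hy hS) y l t (ht.mono (Set.subset_insert y S)) κ).1 y
    (by simp) fun k hk => hyt k y hk rfl

theorem theta_evL_bv {T : Fin (N + 1 + 1) → Fin (N + 1 + 1) → ℂ → Module.End K H} {vac : H}
    {ell : Fin (N + 1 + 1) → ℂ → K} (hT : IsVacModel q U T vac ell) (hS : S ⊆ U) {l : List ℂ}
    {t : Fin N → List ℂ} (ht : Distinct S (Fin.cons l t : Fin (N + 1) → List ℂ)) {y : ℂ}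
    (hy : y ∈ U) (hyt : ∀ k, ∀ x ∈ (Fin.cons l t : Fin (N + 1) → List ℂ) k, x ≠ y)
    (p : Fin (N + 1)) :
    theta T p.succ y (evL (site q T y) l fun κ =>
      Pi.single 0 (bv q N (chainL q (lowerBlock T) l) (vacL N vac l) t κ)) =
      ell 0 y • rowSum q T p.succ y l (bv q N (chainL q (lowerBlock T) l) (vacL N vac l) t) :=
  theta_evL hT.rtt hy (Fin.succ_ne_zero p) l (fun x hx => ⟨hS (ht.mem 0 x hx), hyt 0 x hx⟩) _
    fun κ => firstCol_bv hT hS (ht.cons_tail.mono Set.sdiff_subset) hy (fun k => hyt k.succ) κ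

/-- For generic `y` this is the symmetry of the extended Bethe vector, with the invertible
eigenvalue `ell 0 y` cancelled. The nodes `y = q²a` are not generic, since `f(a, q²a) = 0`;
polynomiality in `y` reaches them. -/
theorem rowPoly_perm (hq : q ≠ 0) {T : Fin (N + 1 + 1) → Fin (N + 1 + 1) → ℂ → Module.End K H}
    {vac : H} {ell : Fin (N + 1 + 1) → ℂ → K} (hT : IsVacModel q U T vac ell) (hS : S ⊆ U)
    (hf : Nondeg q S) {l l' : List ℂ} {t : Fin N → List ℂ}
    (ht : Distinct S (Fin.cons l t : Fin (N + 1) → List ℂ)) (hl : l.Perm l') (p : Fin (N + 1))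
    (y : ℂ) :
    rowPoly q T p.succ y l (bv q N (chainL q (lowerBlock T) l) (vacL N vac l) t) =
      rowPoly q T p.succ y l' (bv q N (chainL q (lowerBlock T) l') (vacL N vac l') t) := by
  refine (rowPoly_vpoly T p.succ l _).eq_of_cofinite (hl.length_eq ▸ rowPoly_vpoly T p.succ l' _)
    (U := {z | ∀ x ∈ {x | ∃ k, x ∈ (Fin.cons l t : Fin (N + 1) → List ℂ) k},
      x ≠ z ∧ fFun q x z ≠ 0} ∩ U) ?_ (fun y hy => ?_) y
  · rw [Set.compl_inter]
    exact (cofinite_inhomogeneity hq (finite_letters _)).union hT.cofinite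
  · obtain ⟨hy, hyU⟩ := hy
    rw [rowPoly_eq T _ l fun x hx => (hy x ⟨0, hx⟩).1,
      rowPoly_eq T _ l' fun x hx => (hy x ⟨0, hl.mem_iff.mpr hx⟩).1, (hl.map _).prod_eq]
    congr 1
    refine ((hT.unit y hyU 0).smul_left_cancel).mp ?_
    rw [← theta_evL_bv hT hS ht hyU (fun k x hx => (hy x ⟨k, hx⟩).1), ← theta_evL_bv hT hS
      (ht.perm_head hl) hyU, evL_site_perm hq hT hS hf ht hl fun k x hx => hy x ⟨k, hx⟩]
    intro k
    refine Fin.cases (fun x hx => ?_) (fun k x hx => ?_) k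
    · exact (hy x ⟨0, hl.mem_iff.mpr hx⟩).1
    · exact (hy x ⟨k.succ, hx⟩).1

/-- Matches the prefactor in `rowPoly_last` with the interpolation weight at `q²a` and the factor
`f(a, l)` of `theta_bv_move`. -/
theorem prod_sub_eq_fProd_mul (hq : q ≠ 0) {a : ℂ} : ∀ {l : List ℂ} (_ : a ∉ l),
    (l.map fun x => x - q * (q * a)).prod =
      (l.map fun x => q * x - q⁻¹ * (q * (q * a))).prod * fProd q [a] l
  | [], _ => by simp [fProd]
  | x :: l, h => by
    have h0 : a - x ≠ 0 := sub_ne_zero.mpr fun h' => h (by simp [h'])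
    rw [List.map_cons, List.prod_cons, List.map_cons, List.prod_cons, fProd_cons_right,
      fProd_singleton, prod_sub_eq_fProd_mul hq fun h' => h (by simp [h']),
      inv_mul_cancel_left₀ hq, fFun]
    field_simp
    ring

/-- Interpolation in `y` at the points `q²a`, `a ∈ l`, with `a` moved to the last place. The result
has the same shape one nesting level deeper: the contraction at `a` for the chain over the remaining
variables. -/
theorem theta_bv_succ (hq : q ≠ 0) {T : Fin (N + 1 + 1) → Fin (N + 1 + 1) → ℂ → Module.End K H}
    {vac : H} {ell : Fin (N + 1 + 1) → ℂ → K} (hT : IsVacModel q U T vac ell) (hS : S ⊆ U)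
    (hf : Nondeg q S) {l : List ℂ} {t : Fin N → List ℂ}
    (ht : Distinct S (Fin.cons l t : Fin (N + 1) → List ℂ)) {y : ℂ} (hy : y ∈ U)
    (hyt : ∀ k, ∀ x ∈ (Fin.cons l t : Fin (N + 1) → List ℂ) k, x ≠ y) (p : Fin (N + 1)) :
    theta T p.succ y (bv q (N + 1) (site q T y) (Pi.single 0 vac)
        (Fin.cons l t : Fin (N + 1) → List ℂ)) =
      ell 0 y • (fProd q (colorOr t 0) l)⁻¹ • ∑ i ∈ Finset.range l.length,
        (gL q (l.getD i 0) y * fProd q (l.eraseIdx i) [y]) •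
          evL T (l.eraseIdx i) fun κ => theta (chainL q (lowerBlock T) (l.eraseIdx i)) p
            (l.getD i 0) (bv q N (site q (chainL q (lowerBlock T) (l.eraseIdx i)) (l.getD i 0))
              (Pi.single 0 (vacL N vac (l.eraseIdx i))) t) κ := by
  have h1 := ht.cons_tail.mono Set.sdiff_subset
  have hnd : l.Nodup := ht.nodup 0
  have hlS : ∀ x ∈ l, x ∈ S := ht.mem 0
  set Y : ℕ → H := fun i => evL T (l.eraseIdx i) fun κ =>
    theta (chainL q (lowerBlock T) (l.eraseIdx i)) p
            (l.getD i 0) (bv q N (site q (chainL q (lowerBlock T) (l.eraseIdx i)) (l.getD i 0))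
              (Pi.single 0 (vacL N vac (l.eraseIdx i))) t) κ with hY
  have key : ∀ y, rowPoly q T p.succ y l (bv q N (chainL q (lowerBlock T) l) (vacL N vac l) t) =
      ∑ i ∈ Finset.range l.length, ((l.eraseIdx i).map fun x => q * x + -q⁻¹ * y).prod •
        ((q - q⁻¹) * l.getD i 0) • Y i := by
    have hinj : Function.Injective fun x => q * (q * x) := fun x y h =>
      mul_left_cancel₀ hq (mul_left_cancel₀ hq h)
    refine (rowPoly_vpoly T p.succ l _).eq_of_eqOn (VPoly.sum _ fun i hi =>
      vpoly_eraseIdx (Finset.mem_range.mp hi) _ _ _)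
      (s := l.toFinset.image fun x => q * (q * x)) ?_ fun a ha => ?_
    · rw [Finset.card_image_of_injective _ hinj, List.toFinset_card_of_nodup hnd]
    obtain ⟨b, hb, rfl⟩ := Finset.mem_image.mp ha
    obtain ⟨i, hi, rfl⟩ := exists_nodup_index (List.mem_toFinset.mp hb)
    have hni := getD_notMem_eraseIdx hnd hi
    rw [rowPoly_perm hq hT hS hf ht ((perm_getD_cons_eraseIdx hi).trans
      (List.perm_append_singleton _ _).symm), rowPoly_last hq, Finset.sum_eq_single i]
    · have h2 : fProd q [l.getD i 0] (l.eraseIdx i) ≠ 0 := fProd_ne_zero fun u hu v hv => by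
        rw [List.mem_singleton.mp hu]
        exact hf _ (hlS _ (getD_mem hi)) _ (hlS _ (List.mem_of_mem_eraseIdx hv))
          fun h => hni (h ▸ hv)
      have h3 : Y i = fProd q [l.getD i 0] (l.eraseIdx i) • evL T (l.eraseIdx i) fun κ =>
          theta (lowerBlock T) p (l.getD i 0) fun k =>
            bv q N (chainL q (lowerBlock T) (l.eraseIdx i ++ [l.getD i 0]))
              (vacL N vac (l.eraseIdx i ++ [l.getD i 0])) t (snocIdx (l.getD i 0) _ κ k) := by
        rw [← LinearMap.map_smul_of_tower]
        simp only [hY]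
        congr 1
        funext κ
        have h4 := theta_bv_move hq (lowerBlock T) vac hni t (fun k x hx => ⟨fun h =>
          ht.disj k.succ 0 (Fin.succ_ne_zero k) x hx (h ▸ getD_mem hi), fun h =>
          ht.disj k.succ 0 (Fin.succ_ne_zero k) x hx (List.mem_of_mem_eraseIdx h)⟩) p κ
        rw [h4, Pi.smul_apply]
        simp only [bv_chainL_snoc]
      rw [h3, smul_smul, smul_smul, prod_sub_eq_fProd_mul hq hni]
      congr 1
      simp only [sub_eq_add_neg, neg_mul]
      ring
    · intro j hj hji
      rw [List.prod_eq_zero, zero_smul]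
      refine List.mem_map.mpr ⟨_, getD_mem_eraseIdx hnd hi (Finset.mem_range.mp hj) hji.symm, ?_⟩
      rw [neg_mul, inv_mul_cancel_left₀ hq, add_neg_cancel]
    · intro h; exact absurd (Finset.mem_range.mpr hi) h
  have hz : ∀ x ∈ l, x ≠ y := hyt 0
  have hz' := key y
  rw [rowPoly_eq T _ l hz] at hz'
  have hne : (l.map fun x => x - y).prod ≠ 0 := by
    refine List.prod_ne_zero fun h0 => ?_
    obtain ⟨x, hx, h0⟩ := List.mem_map.mp h0
    exact hz x hx (sub_eq_zero.mp h0)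
  rw [bv_cons, LinearMap.map_smul_of_tower,
    funext fun κ => (bv_lowerBlock_site hT hS y l t h1 κ).2, theta_evL_bv hT hS ht hy hyt,
    smul_comm (ell 0 y)]
  congr 2
  refine smul_right_injective H hne ?_
  simp only
  rw [hz', Finset.smul_sum]
  refine Finset.sum_congr rfl fun i hi => ?_
  have hi := Finset.mem_range.mp hi
  rw [smul_smul, smul_smul]
  congr 1
  have h5 := prod_mul_fProd (q := q) (y := y) (l := l.eraseIdx i)
    fun x hx => hz x (List.mem_of_mem_eraseIdx hx)
  have h6 : ((l.eraseIdx i).map fun x => q * x + -q⁻¹ * y) =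
    (l.eraseIdx i).map fun x => q * x - q⁻¹ * y := by
    simp only [sub_eq_add_neg, neg_mul]
  rw [((perm_getD_cons_eraseIdx hi).map fun x => x - y).prod_eq, List.map_cons, List.prod_cons,
    h6, ← h5, gL, gFun]
  have := sub_ne_zero.mpr (hz _ (getD_mem hi))
  field_simp

end FirstColumnFormula

/-! ## Iteration over the colors -/

section Choices

variable {q : ℂ} {N : ℕ}

theorem sum_choices_zero {M : Type*} [AddCommMonoid M] (l : List ℂ) (t : Fin N → List ℂ)
    (F : (Fin (N + 1) → ℕ) → M) :
    ∑ I ∈ choices (Fin.cons l t : Fin (N + 1) → List ℂ) 0, F I =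
      ∑ i ∈ Finset.range l.length, F (Fin.cons i 0) := by
  symm
  refine Finset.sum_nbij' (fun i => (Fin.cons i 0 : Fin (N + 1) → ℕ)) (fun I => I 0)
    (fun i hi => ?_) (fun I hI => ?_) (fun i _ => rfl) (fun I hI => ?_) fun _ _ => rfl
  · refine Fintype.mem_piFinset.mpr fun k => ?_
    refine Fin.cases (by simpa using hi) (fun k => ?_) k
    simp
  · simpa using Fintype.mem_piFinset.mp hI 0
  · funext k
    refine Fin.cases rfl (fun k => ?_) k
    have : I k.succ = 0 := by simpa using Fintype.mem_piFinset.mp hI k.succ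
    exact this.symm

theorem sum_choices_succ {M : Type*} [AddCommMonoid M] (l : List ℂ) (t : Fin N → List ℂ)
    (p : Fin N) (F : (Fin (N + 1) → ℕ) → M) :
    ∑ I ∈ choices (Fin.cons l t : Fin (N + 1) → List ℂ) p.succ, F I =
      ∑ i ∈ Finset.range l.length, ∑ I ∈ choices t p, F (Fin.cons i I) := by
  rw [← Finset.sum_product']
  symm
  refine Finset.sum_nbij' (fun i => (Fin.cons i.1 i.2 : Fin (N + 1) → ℕ))
    (fun I => (I 0, Fin.tail I))
    (fun i hi => ?_) (fun I hI => ?_) (fun i _ => rfl) (fun I hI => Fin.cons_self_tail I)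
    fun _ _ => rfl
  · obtain ⟨h1, h2⟩ := Finset.mem_product.mp hi
    refine Fintype.mem_piFinset.mpr fun k => ?_
    refine Fin.cases (by simpa using h1) (fun k => ?_) k
    simpa using Fintype.mem_piFinset.mp h2 k
  · refine Finset.mem_product.mpr ⟨by simpa using Fintype.mem_piFinset.mp hI 0,
      Fintype.mem_piFinset.mpr fun k => ?_⟩
    simpa [Fin.tail] using Fintype.mem_piFinset.mp hI k.succ

theorem chosen_cons (l : List ℂ) (t : Fin N → List ℂ) (i : ℕ) (I : Fin N → ℕ) :
    chosen (Fin.cons l t : Fin (N + 1) → List ℂ) (Fin.cons i I) =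
      Fin.cons (l.getD i 0) (chosen t I) :=
  funext fun k => Fin.cases rfl (fun _ => rfl) k

theorem remaining_cons_succ (l : List ℂ) (t : Fin N → List ℂ) (p : Fin N) (i : ℕ)
    (I : Fin N → ℕ) :
    remaining (Fin.cons l t : Fin (N + 1) → List ℂ) p.succ (Fin.cons i I) =
      Fin.cons (l.eraseIdx i) (remaining t p I) :=
  funext fun k => Fin.cases (by simp [remaining]) (fun k => by simp [remaining]) k

theorem remaining_cons_zero (l : List ℂ) (t : Fin N → List ℂ) (i : ℕ) (I : Fin N → ℕ) :
    remaining (Fin.cons l t : Fin (N + 1) → List ℂ) 0 (Fin.cons i I) =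
      Fin.cons (l.eraseIdx i) t :=
  funext fun k => Fin.cases (by simp [remaining]) (fun k => by simp [remaining]) k

theorem remaining_sublist (t : Fin N → List ℂ) (p : Fin N) (I : Fin N → ℕ) (k : Fin N) :
    (remaining t p I k).Sublist (t k) := by
  unfold remaining
  split_ifs
  · exact List.eraseIdx_sublist _ _
  · exact .refl _

theorem lt_length_of_mem_choices {t : Fin N → List ℂ} {p : Fin N} {I : Fin N → ℕ}
    (hI : I ∈ choices t p) {k : Fin N} (hk : k ≤ p) : I k < (t k).length := by
  simpa [hk] using Fintype.mem_piFinset.mp hI k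

/-- The rational coefficient of a component of a Bethe vector of a one-site extension. -/
noncomputable def osCoeff (q z : ℂ) (t : Fin N → List ℂ) (p : Fin N) (I : Fin N → ℕ) : ℂ :=
  ∏ ν with ν ≤ p, gL q (chosen t I ν) ((Fin.cons z (chosen t I) : Fin (N + 1) → ℂ) ν.castSucc) *
    fProd q ((t ν).eraseIdx (I ν)) [chosen t I ν] / fProd q (colorOr t (ν + 1)) [chosen t I ν]

/-- The rational coefficient in the action of the first column; `l` stands for the collection
before the first one. -/
noncomputable def fcCoeff (q z : ℂ) (l : List ℂ) (t : Fin N → List ℂ) (p : Fin N)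
    (I : Fin N → ℕ) : ℂ :=
  ∏ ν with ν ≤ p, gL q (chosen t I ν) ((Fin.cons z (chosen t I) : Fin (N + 1) → ℂ) ν.castSucc) *
    fProd q [chosen t I ν] ((t ν).eraseIdx (I ν)) /
      fProd q [chosen t I ν] ((Fin.cons l t : Fin (N + 1) → List ℂ) ν.castSucc)

/-- The product of eigenvalues at the chosen elements. -/
noncomputable def ellProd {K : Type*} [CommRing K] (ell : Fin N → ℂ → K) (t : Fin N → List ℂ)
    (p : Fin N) (I : Fin N → ℕ) : K := ∏ ν with ν ≤ p, ell ν (chosen t I ν)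

theorem prod_le_zero {M : Type*} [CommMonoid M] (F : Fin (N + 1) → M) :
    ∏ ν with ν ≤ (0 : Fin (N + 1)), F ν = F 0 := by
  rw [Finset.prod_filter, Fin.prod_univ_succ]
  simp

theorem prod_le_succ {M : Type*} [CommMonoid M] (F : Fin (N + 1) → M) (p : Fin N) :
    ∏ ν with ν ≤ p.succ, F ν = F 0 * ∏ ν with ν ≤ p, F ν.succ := by
  rw [Finset.prod_filter, Fin.prod_univ_succ, Finset.prod_filter]
  simp

theorem osCoeff_zero (z : ℂ) (l : List ℂ) (t : Fin N → List ℂ) (i : ℕ) (I : Fin N → ℕ) :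
    osCoeff q z (Fin.cons l t : Fin (N + 1) → List ℂ) 0 (Fin.cons i I) =
      gL q (l.getD i 0) z * fProd q (l.eraseIdx i) [l.getD i 0] /
        fProd q (colorOr t 0) [l.getD i 0] := by
  rw [osCoeff, prod_le_zero, chosen_cons, Fin.val_zero, colorOr_succ]
  rfl

theorem osCoeff_succ (z : ℂ) (l : List ℂ) (t : Fin N → List ℂ) (p : Fin N) (i : ℕ)
    (I : Fin N → ℕ) :
    osCoeff q z (Fin.cons l t : Fin (N + 1) → List ℂ) p.succ (Fin.cons i I) =
      gL q (l.getD i 0) z * fProd q (l.eraseIdx i) [l.getD i 0] /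
        fProd q (colorOr t 0) [l.getD i 0] * osCoeff q (l.getD i 0) t p I := by
  rw [osCoeff, prod_le_succ, chosen_cons, Fin.val_zero, colorOr_succ, osCoeff]
  congr 1
  refine Finset.prod_congr rfl fun ν _ => ?_
  rw [Fin.val_succ, colorOr_succ]
  rfl

theorem fcCoeff_zero (z : ℂ) (l₀ l : List ℂ) (t : Fin N → List ℂ) (i : ℕ) (I : Fin N → ℕ) :
    fcCoeff q z l₀ (Fin.cons l t : Fin (N + 1) → List ℂ) 0 (Fin.cons i I) =
      gL q (l.getD i 0) z * fProd q [l.getD i 0] (l.eraseIdx i) / fProd q [l.getD i 0] l₀ := by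
  rw [fcCoeff, prod_le_zero, chosen_cons]
  rfl

theorem fcCoeff_succ (z : ℂ) (l₀ l : List ℂ) (t : Fin N → List ℂ) (p : Fin N) (i : ℕ)
    (I : Fin N → ℕ) :
    fcCoeff q z l₀ (Fin.cons l t : Fin (N + 1) → List ℂ) p.succ (Fin.cons i I) =
      gL q (l.getD i 0) z * fProd q [l.getD i 0] (l.eraseIdx i) / fProd q [l.getD i 0] l₀ *
        fcCoeff q (l.getD i 0) l t p I := by
  rw [fcCoeff, prod_le_succ, chosen_cons, fcCoeff]
  rfl

theorem fcCoeff_nil (z : ℂ) (l₀ : List ℂ) (t : Fin (N + 1) → List ℂ) (p : Fin (N + 1))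
    (I : Fin (N + 1) → ℕ) :
    fcCoeff q z l₀ t p I = (fProd q [chosen t I 0] l₀)⁻¹ * fcCoeff q z [] t p I := by
  obtain ⟨l, t, rfl⟩ : ∃ l t', t = Fin.cons l t' := ⟨t 0, Fin.tail t, (Fin.cons_self_tail t).symm⟩
  obtain ⟨i, I, rfl⟩ : ∃ i I', I = Fin.cons i I' := ⟨I 0, Fin.tail I, (Fin.cons_self_tail I).symm⟩
  refine Fin.cases ?_ (fun p => ?_) p
  · rw [fcCoeff_zero, fcCoeff_zero, fProd_nil_right, chosen_cons, Fin.cons_zero]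
    ring
  · rw [fcCoeff_succ, fcCoeff_succ, fProd_nil_right, chosen_cons, Fin.cons_zero]
    ring

variable {K : Type*} [CommRing K] [Algebra ℂ K]

theorem ellProd_zero (ell : Fin (N + 1) → ℂ → K) (l : List ℂ) (t : Fin N → List ℂ) (i : ℕ)
    (I : Fin N → ℕ) :
    ellProd ell (Fin.cons l t : Fin (N + 1) → List ℂ) 0 (Fin.cons i I) = ell 0 (l.getD i 0) := by
  rw [ellProd, prod_le_zero]
  rfl

theorem ellProd_succ (ell : Fin (N + 1) → ℂ → K) (l : List ℂ) (t : Fin N → List ℂ) (p : Fin N)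
    (i : ℕ) (I : Fin N → ℕ) :
    ellProd ell (Fin.cons l t : Fin (N + 1) → List ℂ) p.succ (Fin.cons i I) =
      ell 0 (l.getD i 0) * ellProd (fun k => ell k.succ) t p I := by
  rw [ellProd, prod_le_succ]
  rfl

/-- A chain alters only the first eigenvalue. The extra factor `f(t_I, l)` completes `f(t_II, l)` to
the normalizing factor of the full collection in `evL_sum_choices`. -/
theorem ellProd_chainEll (ell : Fin (N + 1 + 1) → ℂ → K) (l : List ℂ) (t : Fin (N + 1) → List ℂ)
    (p : Fin (N + 1)) (I : Fin (N + 1) → ℕ) :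
    ellProd (fun k => chainEll q l ell k.castSucc) t p I =
      algebraMap ℂ K (fProd q [chosen t I 0] l) * ellProd (fun k => ell k.castSucc) t p I := by
  obtain ⟨l', t, rfl⟩ : ∃ l t', t = Fin.cons l t' := ⟨t 0, Fin.tail t, (Fin.cons_self_tail t).symm⟩
  obtain ⟨i, I, rfl⟩ : ∃ i I', I = Fin.cons i I' := ⟨I 0, Fin.tail I, (Fin.cons_self_tail I).symm⟩
  have h0 : ∀ u, chainEll q l ell 0 u = algebraMap ℂ K (fProd q [u] l) * ell 0 u := fun u => by
    rw [chainEll, if_pos rfl, fProd, List.map_singleton, List.prod_singleton]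
  have h1 : ∀ (k : Fin N) u, chainEll q l ell k.succ.castSucc u = ell k.succ.castSucc u :=
    fun k u => if_neg fun h => by simpa using congrArg Fin.val h
  refine Fin.cases ?_ (fun p => ?_) p
  · rw [ellProd_zero, ellProd_zero, chosen_cons, Fin.cons_zero, Fin.castSucc_zero, h0]
  · rw [ellProd_succ, ellProd_succ, chosen_cons, Fin.cons_zero, Fin.castSucc_zero, h0, mul_assoc]
    exact congrArg (fun e => _ * (_ * ellProd e t p I)) (funext fun k => funext fun u => h1 k u)

end Choices

/-! ### Components of the extended Bethe vector in all colors, and the recursion for Bethe vectors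
-/

section Colors

variable {q : ℂ} {N : ℕ} {K : Type*} [CommRing K] [Algebra ℂ K]

theorem fProd_letters_ne_zero {S : Set ℂ} (hf : Nondeg q S) {l : List ℂ} {t : Fin N → List ℂ}
    (ht : Distinct S (Fin.cons l t : Fin (N + 1) → List ℂ)) (j : ℕ) :
    fProd q (colorOr t j) l ≠ 0 := by
  refine fProd_ne_zero fun u hu v hv => ?_
  obtain ⟨hk, hu⟩ := mem_colorOr hu
  exact hf u (ht.mem (Fin.succ ⟨_, hk⟩) u hu) v (ht.mem 0 v hv) fun h =>
    ht.disj (Fin.succ ⟨_, hk⟩) 0 (Fin.succ_ne_zero _) u hu (h ▸ hv)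

variable {H : Type*} [AddCommGroup H] [Module K H] [Module ℂ H] [IsScalarTower ℂ K H] {U S : Set ℂ}

theorem evL_bv {S : Set ℂ} (hf : Nondeg q S) (T : Fin (N + 1 + 1) → Fin (N + 1 + 1) → ℂ →
    Module.End K H) (vac : H) {l : List ℂ} {t : Fin N → List ℂ}
    (ht : Distinct S (Fin.cons l t : Fin (N + 1) → List ℂ)) :
    evL T l (bv q N (chainL q (lowerBlock T) l) (vacL N vac l) t) =
      fProd q (colorOr t 0) l • bv q (N + 1) T vac (Fin.cons l t : Fin (N + 1) → List ℂ) := by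
  rw [bv_cons, smul_inv_smul₀ (fProd_letters_ne_zero hf ht 0)]

theorem Distinct.cons_remaining {l : List ℂ} {t : Fin N → List ℂ}
    (ht : Distinct S (Fin.cons l t : Fin (N + 1) → List ℂ)) (p : Fin N) (I : Fin N → ℕ) :
    Distinct S (Fin.cons l (remaining t p I) : Fin (N + 1) → List ℂ) :=
  ht.sublist fun k => Fin.cases (.refl _) (fun k => remaining_sublist t p I k) k

theorem perm_chosen_cons_remaining {t : Fin (N + 1) → List ℂ} {p : Fin (N + 1)}
    {I : Fin (N + 1) → ℕ} (hI : I ∈ choices t p) :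
    (t 0).Perm (chosen t I 0 :: remaining t p I 0) := by
  have := perm_getD_cons_eraseIdx (lt_length_of_mem_choices hI (Fin.zero_le p))
  rwa [remaining, if_pos (Fin.zero_le p)]

/-- The contraction with the first row of the expansion of a component. -/
theorem evL_sum_choices (hf : Nondeg q S)
    (T : Fin (N + 1 + 1 + 1) → Fin (N + 1 + 1 + 1) → ℂ → Module.End K H)
    (vac : H) (ell : Fin (N + 1 + 1) → ℂ → K) {l : List ℂ} {t : Fin (N + 1) → List ℂ}
    (ht : Distinct S (Fin.cons l t : Fin (N + 1 + 1) → List ℂ)) (p : Fin (N + 1)) (z : ℂ) :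
    evL T l (∑ I ∈ choices t p, osCoeff q z t p I •
        ellProd (fun k => chainEll q l ell k.castSucc) t p I •
        bv q (N + 1) (chainL q (lowerBlock T) l) (vacL (N + 1) vac l) (remaining t p I)) =
      fProd q (t 0) l • ∑ I ∈ choices t p, osCoeff q z t p I •
        ellProd (fun k => ell k.castSucc) t p I •
        bv q (N + 1 + 1) T vac (Fin.cons l (remaining t p I) : Fin (N + 1 + 1) → List ℂ) := by
  rw [map_sum, Finset.smul_sum]
  refine Finset.sum_congr rfl fun I hI => ?_
  rw [LinearMap.map_smul_of_tower, LinearMap.map_smul, evL_bv hf T vac (ht.cons_remaining p I),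
    ellProd_chainEll, colorOr_zero, fProd_perm (perm_chosen_cons_remaining hI) (.refl l),
    fProd_cons_left _ (remaining t p I 0), mul_smul (algebraMap ℂ K _), algebraMap_smul, smul_comm (ellProd _ t p I),
    smul_smul, smul_smul, smul_smul]
  congr 1
  ring

/-- Iteration of `bv_site_succ`: the additional site is carried from `z` to `t^1_I`, then to
`t^2_I`, and so on, until the component index is exhausted and `bv_site_zero` applies. Each color
passed yields one eigenvalue at its chosen element. -/
theorem bv_site_color (hq : q ≠ 0) : ∀ {N : ℕ} {H : Type*} [AddCommGroup H] [Module K H]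
    [Module ℂ H] [IsScalarTower ℂ K H] {U S : Set ℂ}
    {T : Fin (N + 1) → Fin (N + 1) → ℂ → Module.End K H} {vac : H} {ell : Fin (N + 1) → ℂ → K}
    (_ : IsVacModel q U T vac ell) (_ : S ⊆ U) (_ : Nondeg q S) {t : Fin N → List ℂ}
    (_ : Distinct S t) {z : ℂ} (_ : ∀ k, ∀ x ∈ t k, x ≠ z) (p : Fin N),
    bv q N (site q T z) (Pi.single 0 vac) t p.succ = ∑ I ∈ choices t p, osCoeff q z t p I •
      ellProd (fun k => ell k.castSucc) t p I • bv q N T vac (remaining t p I)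
  | 0, _, _, _, _, _, _, _, _, _, _, _, _, _, _, _, _, _, p => p.elim0
  | N + 1, H, _, _, _, _, U, S, T, vac, ell, hT, hS, hf, t, ht, z, hz, p => by
    obtain ⟨l, t, rfl⟩ : ∃ l t', t = Fin.cons l t' :=
      ⟨t 0, Fin.tail t, (Fin.cons_self_tail t).symm⟩
    have hmem : ∀ x ∈ l, x ∈ S := ht.mem 0
    have hsub : ∀ i, Distinct S (Fin.cons (l.eraseIdx i) t : Fin (N + 1) → List ℂ) :=
      fun i => ht.sublist_head (List.eraseIdx_sublist _ _)
    have hch := fun l => hT.block.chainL hq l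
    have hS' := fun i => diff_subset_chainSet hS hf (l := l.eraseIdx i) fun x hx =>
      hmem x (List.mem_of_mem_eraseIdx hx)
    have hsplit : ∀ i < l.length, fProd q (colorOr t 0) l =
        fProd q (colorOr t 0) [l.getD i 0] * fProd q (colorOr t 0) (l.eraseIdx i) := fun i hi => by
      rw [fProd_perm (.refl _) (perm_getD_cons_eraseIdx hi), fProd_cons_right]
    rw [bv_site_succ hq hT hS hf ht (hz 0)]
    obtain rfl | ⟨p, rfl⟩ := Fin.eq_zero_or_eq_succ p
    · rw [sum_choices_zero, Finset.smul_sum]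
      refine Finset.sum_congr rfl fun i hi => ?_
      have hi : i < l.length := Finset.mem_range.mp hi
      have h0 := fProd_letters_ne_zero hf (hsub i) 0
      rw [bv_site_zero (hch _) (hS' i) _ (hsub i).cons_tail, evL_bv hf T vac (hsub i), osCoeff_zero,
        ellProd_zero, remaining_cons_zero, Fin.castSucc_zero, hsplit i hi,
        smul_comm (ell 0 (l.getD i 0)), smul_smul, smul_smul]
      congr 1
      field_simp
    · cases N with
      | zero => exact p.elim0
      | succ N =>
      rw [sum_choices_succ, Finset.smul_sum]
      refine Finset.sum_congr rfl fun i hi => ?_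
      have hi : i < l.length := Finset.mem_range.mp hi
      have h0 := fProd_letters_ne_zero hf (hsub i) 0
      rw [bv_site_color hq (hch _) (hS' i) (hf.mono Set.sdiff_subset) (hsub i).cons_tail
        (z := l.getD i 0) (fun k x hx h => ht.disj k.succ 0 (Fin.succ_ne_zero k) x hx (h ▸ getD_mem hi)) p,
        evL_sum_choices hf T vac _ (hsub i), hsplit i hi, ← colorOr_zero t,
        smul_comm (ell 0 (l.getD i 0)), smul_smul, smul_smul, Finset.smul_sum, Finset.smul_sum]
      refine Finset.sum_congr rfl fun I hI => ?_
      rw [osCoeff_succ, ellProd_succ, remaining_cons_succ, Fin.castSucc_zero,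
        smul_comm (ell 0 (l.getD i 0)), smul_smul, smul_smul]
      congr 1
      field_simp

/-- The recursion for the Bethe vectors. -/
theorem bv_recursion (hq : q ≠ 0) {T : Fin (N + 1 + 1) → Fin (N + 1 + 1) → ℂ → Module.End K H}
    {vac : H} {ell : Fin (N + 1 + 1) → ℂ → K} (hT : IsVacModel q U T vac ell) (hS : S ⊆ U)
    (hf : Nondeg q S) {z : ℂ} {l : List ℂ} {t : Fin N → List ℂ}
    (ht : Distinct S (Fin.cons (z :: l) t : Fin (N + 1) → List ℂ)) :
    bv q (N + 1) T vac (Fin.cons (z :: l) t : Fin (N + 1) → List ℂ) =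
      (fProd q (colorOr t 0) [z])⁻¹ •
        (T 0 1 z (bv q (N + 1) T vac (Fin.cons l t : Fin (N + 1) → List ℂ)) +
        ∑ p : Fin N, ∑ I ∈ choices t p, osCoeff q z t p I •
          ellProd (fun k => ell k.succ.castSucc) t p I • T 0 p.succ.succ z
            (bv q (N + 1) T vac (Fin.cons l (remaining t p I) : Fin (N + 1) → List ℂ))) := by
  have hsub : Distinct S (Fin.cons l t : Fin (N + 1) → List ℂ) :=
    ht.sublist_head (List.sublist_cons_self z l)
  have hch := hT.block.chainL hq l
  have hS' := diff_subset_chainSet hS hf (l := l) (hsub.mem 0)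
  have h0 := fProd_letters_ne_zero hf hsub 0
  have hz : ∀ k, ∀ x ∈ t k, x ≠ z := fun k x hx h =>
    ht.disj k.succ 0 (Fin.succ_ne_zero k) x hx (h ▸ List.mem_cons_self)
  -- The head `z` is the outermost site of the chain, so the inner Bethe vector is that of a
  -- one-site extension over `l`; its component 0 gives the term with `T 0 1 z`, the others are
  -- expanded by `bv_site_color`.
  rw [bv_cons, evL_cons, fProd_cons_right, mul_inv, mul_smul, Fin.sum_univ_succ]
  simp only [bv_chainL_cons]
  congr 1
  rw [smul_add]
  congr 1
  · rw [bv_site_zero hch hS' z hsub.cons_tail, evL_bv hf T vac hsub, LinearMap.map_smul_of_tower,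
      inv_smul_smul₀ h0]
    rfl
  · rw [Finset.smul_sum]
    refine Finset.sum_congr rfl fun p _ => ?_
    cases N with
    | zero => exact p.elim0
    | succ N =>
    have h1 := bv_site_color hq hch hS' (hf.mono Set.sdiff_subset) hsub.cons_tail hz p
    have h2 := congrArg (evL T l) h1
    rw [evL_sum_choices hf T vac _ hsub] at h2
    refine (congrArg (fun x => (fProd q (colorOr t 0) l)⁻¹ • T 0 p.succ.succ z x) h2).trans ?_
    rw [LinearMap.map_smul_of_tower, ← colorOr_zero t, inv_smul_smul₀ h0, map_sum]
    simp only [LinearMap.map_smul_of_tower]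
    rfl

end Colors

/-! ### Contraction with a row in all colors -/

section FirstColumnColors

variable {q : ℂ} {K : Type*} [CommRing K] [Algebra ℂ K]

theorem chainEll_zero {N : ℕ} (l : List ℂ) (ell : Fin (N + 1) → ℂ → K) (u : ℂ) :
    chainEll q l ell 0 u = algebraMap ℂ K (fProd q [u] l) * ell 0 u := by
  rw [chainEll, if_pos rfl, fProd, List.map_singleton, List.prod_singleton]

theorem chainEll_succ {N : ℕ} (l : List ℂ) (ell : Fin (N + 1) → ℂ → K) (k : Fin N) :
    chainEll q l ell k.succ = ell k.succ := by
  funext u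
  rw [chainEll, if_neg (Fin.succ_ne_zero k)]

/-- The leading part of the action of the first column on a Bethe vector. -/
theorem theta_bv_color (hq : q ≠ 0) : ∀ {N : ℕ} {H : Type*} [AddCommGroup H] [Module K H]
    [Module ℂ H] [IsScalarTower ℂ K H] {U S : Set ℂ}
    {T : Fin (N + 1 + 1) → Fin (N + 1 + 1) → ℂ → Module.End K H} {vac : H}
    {ell : Fin (N + 1 + 1) → ℂ → K}
    (_ : IsVacModel q U T vac ell) (_ : S ⊆ U) (_ : Nondeg q S) {t : Fin (N + 1) → List ℂ}
    (_ : Distinct S t) {y : ℂ} (_ : y ∈ U) (_ : ∀ k, ∀ x ∈ t k, x ≠ y) (p : Fin (N + 1)),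
    theta T p.succ y (bv q (N + 1) (site q T y) (Pi.single 0 vac) t) =
      ell 0 y • ∑ J ∈ choices t p, (fProd q (remaining t p J 0) [y] * fcCoeff q y [] t p J) •
      ellProd (fun k => ell k.succ) t p J • bv q (N + 1) T vac (remaining t p J)
  | N, H, _, _, _, _, U, S, T, vac, ell, hT, hS, hf, t, ht, y, hy, hyt, p => by
    obtain ⟨l, t, rfl⟩ : ∃ l t', t = Fin.cons l t' :=
      ⟨t 0, Fin.tail t, (Fin.cons_self_tail t).symm⟩
    have hmem : ∀ x ∈ l, x ∈ S := ht.mem 0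
    have hsub : ∀ i, Distinct S (Fin.cons (l.eraseIdx i) t : Fin (N + 1) → List ℂ) :=
      fun i => ht.sublist_head (List.eraseIdx_sublist _ _)
    have hch := fun l => hT.block.chainL hq l
    have hS' := fun i => diff_subset_chainSet hS hf (l := l.eraseIdx i) fun x hx =>
      hmem x (List.mem_of_mem_eraseIdx hx)
    have hne : ∀ i < l.length, ∀ k, ∀ x ∈ t k, x ≠ l.getD i 0 := fun i hi k x hx h =>
      ht.disj k.succ 0 (Fin.succ_ne_zero k) x hx (h ▸ getD_mem hi)
    have hiS : ∀ i < l.length, l.getD i 0 ∈ chainSet q (l.eraseIdx i) U := fun i hi =>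
      hS' i ⟨hmem _ (getD_mem hi), getD_notMem_eraseIdx (ht.nodup 0) hi⟩
    -- One color is split off. The inner contraction is taken at the chosen element, which is an
    -- admissible parameter of the chain over the rest; it is closed by `theta_bv_zero` or by
    -- recursion.
    rw [theta_bv_succ hq hT hS hf ht hy hyt]
    congr 1
    obtain rfl | ⟨p, rfl⟩ := Fin.eq_zero_or_eq_succ p
    · rw [sum_choices_zero, Finset.smul_sum]
      refine Finset.sum_congr rfl fun i hi => ?_
      have hi : i < l.length := Finset.mem_range.mp hi
      have h0 := fProd_letters_ne_zero hf ht 0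
      have h1 := theta_bv_zero (hch (l.eraseIdx i)) (hS' i) (hsub i).cons_tail (hiS i hi) (hne i hi)
      rw [chainEll_zero, mul_smul, algebraMap_smul] at h1
      have h2 : evL T (l.eraseIdx i) (fun κ => theta (chainL q (lowerBlock T) (l.eraseIdx i)) 0
          (l.getD i 0) (bv q N (site q (chainL q (lowerBlock T) (l.eraseIdx i)) (l.getD i 0))
            (Pi.single 0 (vacL N vac (l.eraseIdx i))) t) κ) = _ := congrArg (evL T _) h1
      rw [h2, LinearMap.map_smul_of_tower, LinearMap.map_smul_of_tower, LinearMap.map_smul,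
        evL_bv hf T vac (hsub i), fcCoeff_zero, remaining_cons_zero, fProd_nil_right, ellProd_zero,
        smul_comm (ell _ (l.getD i 0)), smul_smul, smul_smul, smul_smul, smul_smul, Fin.cons_zero]
      congr 1
      rw [fProd_perm (.refl _) (perm_getD_cons_eraseIdx hi), fProd_cons_right] at h0 ⊢
      have h3 := left_ne_zero_of_mul h0
      have h4 := right_ne_zero_of_mul h0
      field_simp
    · cases N with
      | zero => exact p.elim0
      | succ N =>
      rw [sum_choices_succ, Finset.smul_sum]
      refine Finset.sum_congr rfl fun i hi => ?_
      have hi : i < l.length := Finset.mem_range.mp hi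
      have h1 := theta_bv_color hq (hch (l.eraseIdx i)) (hS' i) (hf.mono Set.sdiff_subset)
        (hsub i).cons_tail (hiS i hi) (hne i hi) p
      rw [chainEll_zero, mul_smul, algebraMap_smul] at h1
      have h2 : evL T (l.eraseIdx i) (fun κ => theta (chainL q (lowerBlock T) (l.eraseIdx i)) p.succ
          (l.getD i 0) (bv q (N + 1) (site q (chainL q (lowerBlock T) (l.eraseIdx i)) (l.getD i 0))
            (Pi.single 0 (vacL (N + 1) vac (l.eraseIdx i))) t) κ) = _ := congrArg (evL T _) h1
      rw [h2, LinearMap.map_smul_of_tower, LinearMap.map_smul, map_sum, smul_smul, smul_smul,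
        Finset.smul_sum, Finset.smul_sum]
      refine Finset.sum_congr rfl fun J hJ => ?_
      have h0 := fProd_letters_ne_zero hf ht 0
      rw [LinearMap.map_smul_of_tower, LinearMap.map_smul, evL_bv hf T vac
        ((hsub i).cons_remaining p J), fcCoeff_succ, remaining_cons_succ, fProd_nil_right,
        ellProd_succ, fcCoeff_nil _ l, smul_comm (ellProd _ t p J), smul_comm (ell _ (l.getD i 0)),
        smul_comm (ell _ (l.getD i 0)), smul_smul, smul_smul, smul_smul, Fin.cons_zero]
      simp only [chainEll_succ]
      congr 1
      rw [colorOr_zero] at h0 ⊢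
      rw [colorOr_zero]
      rw [fProd_perm (perm_chosen_cons_remaining hJ) (.refl l),
        fProd_cons_left _ (remaining t p J 0),
        fProd_perm (.refl (remaining t p J 0)) (perm_getD_cons_eraseIdx hi),
        fProd_cons_right (remaining t p J 0)] at h0 ⊢
      have h3 := left_ne_zero_of_mul h0
      have h4 := left_ne_zero_of_mul (right_ne_zero_of_mul h0)
      have h5 := right_ne_zero_of_mul (right_ne_zero_of_mul h0)
      field_simp

end FirstColumnColors

/-! ## Families of Bethe vectors -/

section Families

variable {q : ℂ} {Ω Λ : Type*} {K : Type*} [CommRing K] [Algebra ℂ K]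

/-- Predicates on families of vectors which are stable under linear combinations with coefficients
in an algebra of functions. -/
structure IsLinFam (G : Subalgebra ℂ (Ω → ℂ)) {H : Ω → Type*} [∀ ω, AddCommGroup (H ω)]
    [∀ ω, Module ℂ (H ω)] (P : (∀ ω, H ω) → Prop) : Prop where
  zero : P fun _ => 0
  add : ∀ {x y}, P x → P y → P fun ω => x ω + y ω
  smul : ∀ {c}, c ∈ G → ∀ {x}, P x → P fun ω => c ω • x ω

variable {G : Subalgebra ℂ (Ω → ℂ)} {H : Ω → Type*} [∀ ω, AddCommGroup (H ω)]
  [∀ ω, Module K (H ω)] [∀ ω, Module ℂ (H ω)] [∀ ω, IsScalarTower ℂ K (H ω)]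

theorem IsLinFam.sum {P : (∀ ω, H ω) → Prop} (hP : IsLinFam G P) {ι : Type*} (s : Finset ι)
    (x : ι → ∀ ω, H ω) (h : ∀ i, P (x i)) : P fun ω => ∑ i ∈ s, x i ω := by
  classical
  induction s using Finset.induction_on with
  | empty => simpa using hP.zero
  | insert a s ha ih =>
    simp only [Finset.sum_insert ha]
    exact hP.add (h a) ih

/-- The restriction of an infinite multi-index. -/
def resIdx {n : ℕ} (κ : ℕ → Fin n) (r : ℕ) (a : Fin r) : Fin n := κ a

theorem resIdx_succ {n : ℕ} (κ : ℕ → Fin n) (r : ℕ) :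
    resIdx κ (r + 1) = Fin.cons (κ 0) (resIdx (fun a => κ (a + 1)) r) :=
  funext fun a => Fin.cases rfl (fun _ => rfl) a

theorem cons_resIdx {n : ℕ} (d : Fin n) (κ : ℕ → Fin n) (r : ℕ) :
    (Fin.cons d (resIdx κ r) : Fin (r + 1) → Fin n) =
      resIdx (fun a => Nat.casesOn a d κ) (r + 1) :=
  funext fun a => Fin.cases rfl (fun _ => rfl) a

/-- The type of multi-indices depends on `ω` through the length of `l.map (u ω)`. An infinite
multi-index, restricted to each length, labels the same component for all `ω`. -/
theorem chainL_family {n : ℕ} (u : Ω → Λ → ℂ) {P P' : (∀ ω, H ω) → Prop} (hP : IsLinFam G P')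
    {D : ∀ ω, Fin n → Fin n → ℂ → Module.End K (H ω)} {a : Λ}
    (hD : ∀ i j x, P x → P' fun ω => D ω i j (u ω a) (x ω)) :
    ∀ (l : List Λ) (_ : ∀ b ∈ l, ∀ x y, (fun ω => RMat q n (u ω a) (u ω b) x y) ∈ G) (i j : Fin n)
      (X : ∀ ω, (Fin (l.map (u ω)).length → Fin n) → H ω)
      (_ : ∀ κ, P fun ω => X ω (resIdx κ _)) (κ : ℕ → Fin n),
      P' fun ω => chainL q (D ω) (l.map (u ω)) i j (u ω a) (X ω) (resIdx κ _)
  | [], _, i, j, X, hX, κ => hD i j _ (hX κ)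
  | b :: l, hG, i, j, X, hX, κ => by
    have e : ∀ ω, chainL q (D ω) ((b :: l).map (u ω)) i j (u ω a) (X ω) (resIdx κ _) =
        ∑ k, ∑ d, RMat q n (u ω a) (u ω b) (k, κ 0) (j, d) •
          chainL q (D ω) (l.map (u ω)) i k (u ω a) (fun κ' => X ω (Fin.cons d κ'))
            (resIdx (fun a => κ (a + 1)) _) := by
      intro ω
      have h1 := chainL_cons (q := q) (D ω) (u ω b) (l.map (u ω)) i j (u ω a) (X ω) (κ 0)
        (resIdx (fun a => κ (a + 1)) _)
      rw [← resIdx_succ, site_apply] at h1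
      refine h1.trans ?_
      simp only [Finset.sum_apply, Pi.smul_apply]
    simp only [e]
    refine hP.sum _ _ fun k => hP.sum _ _ fun d => hP.smul (hG b (by simp) _ _) ?_
    refine chainL_family u hP hD l (fun b hb => hG b (by simp [hb])) i k _ (fun κ' => ?_) _
    simp only [cons_resIdx]
    exact hX _

theorem evL_family {n : ℕ} (u : Ω → Λ → ℂ) {P : Set Λ → (∀ ω, H ω) → Prop}
    (hP : ∀ A, IsLinFam G (P A))
    {T : ∀ ω, Fin (n + 1) → Fin (n + 1) → ℂ → Module.End K (H ω)} (A : Set Λ) :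
    ∀ (l : List Λ) (_ : l.Nodup) (_ : ∀ a ∈ l, a ∉ A)
      (_ : ∀ a ∈ l, ∀ A, a ∉ A → ∀ j x, P A x → P (insert a A) fun ω => T ω 0 j (u ω a) (x ω))
      (X : ∀ ω, (Fin (l.map (u ω)).length → Fin n) → H ω) (_ : ∀ κ, P A fun ω => X ω (resIdx κ _))
      (_ : 0 < n),
      P ({x | x ∈ l} ∪ A) fun ω => evL (T ω) (l.map (u ω)) (X ω)
  | [], _, _, _, X, hX, hn => by
    have : ({x | x ∈ ([] : List Λ)} ∪ A : Set Λ) = A := by simp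
    rw [this]
    have e : ∀ ω, evL (T ω) (([] : List Λ).map (u ω)) (X ω) =
        X ω (resIdx (fun _ => ⟨0, hn⟩) _) := fun ω =>
      (evL_nil (T ω) (X ω)).trans
        (congrArg (X ω) (Subsingleton.elim (α := Fin 0 → Fin n) _ _))
    rw [funext e]
    exact hX _
  | a :: l, hnd, hA, hT, X, hX, hn => by
    have hset : ({x | x ∈ a :: l} ∪ A : Set Λ) = insert a ({x | x ∈ l} ∪ A) := by
      ext x; simp [or_assoc]
    rw [hset]
    have e : ∀ ω, evL (T ω) ((a :: l).map (u ω)) (X ω) = ∑ k, T ω 0 k.succ (u ω a)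
        (evL (T ω) (l.map (u ω)) fun κ => X ω (Fin.cons k κ)) := fun ω =>
      evL_cons (T ω) (u ω a) (l.map (u ω)) (X ω)
    rw [funext e]
    refine (hP _).sum _ _ fun k => hT a (by simp) _ ?_ _ _ ?_
    · simp only [Set.mem_union, Set.mem_ofPred_eq, not_or]
      exact ⟨(List.nodup_cons.mp hnd).1, hA a (by simp)⟩
    · refine evL_family u hP A l (List.nodup_cons.mp hnd).2 (fun b hb => hA b (by simp [hb]))
        (fun b hb => hT b (by simp [hb])) _ (fun κ => ?_) hn
      simp only [cons_resIdx]
      exact hX _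

/-- The analogue of `bv_rel_graded` for families of parameters with fixed labels. The only
coefficients in a Bethe vector are R-matrix entries at distinct labels and inverses of `f` between
neighboring colors, so a predicate stable under `G` holds once these lie in `G`. -/
theorem bv_family (u : Ω → Λ → ℂ)
    (hG : ∀ a b, a ≠ b → ∀ n x y, (fun ω => RMat q n (u ω a) (u ω b) x y) ∈ G) :
    ∀ (N : ℕ) {H : Ω → Type*} [∀ ω, AddCommGroup (H ω)] [∀ ω, Module K (H ω)]
      [∀ ω, Module ℂ (H ω)] [∀ ω, IsScalarTower ℂ K (H ω)] {P : Set Λ → (∀ ω, H ω) → Prop}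
      (_ : ∀ A, IsLinFam G (P A)) {T : ∀ ω, Fin (N + 1) → Fin (N + 1) → ℂ → Module.End K (H ω)}
      {vac : ∀ ω, H ω} (t : Fin N → List Λ) (_ : ∀ k, (t k).Nodup)
      (_ : ∀ k l, k ≠ l → ∀ a ∈ t k, a ∉ t l)
      (_ : ∀ k : ℕ, (fun ω => (fProd q (colorOr (fun k => (t k).map (u ω)) (k + 1))
        (colorOr (fun k => (t k).map (u ω)) k))⁻¹) ∈ G)
      (_ : ∀ k, ∀ a ∈ t k, ∀ A, a ∉ A → ∀ i j x, P A x →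
        P (insert a A) fun ω => T ω i j (u ω a) (x ω)) (_ : P ∅ vac),
      P {a | ∃ k, a ∈ t k} fun ω => bv q N (T ω) (vac ω) fun k => (t k).map (u ω)
  | 0, _, _, _, _, _, _, _, _, _, _, _, _, _, _, h => by simpa [bv_zero] using h
  | N + 1, H, _, _, _, _, P, hP, T, vac, t, hnd, hdisj, hf, hT, hv => by
    have hset : ({x | ∃ k, x ∈ t k} : Set Λ) =
        {x | x ∈ t 0} ∪ {x | ∃ k : Fin N, x ∈ t k.succ} := by
      ext x; simp [Fin.exists_fin_succ]
    rw [hset]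
    simp only [bv_succ]
    have hf0 := hf 0
    simp only [colorOr_zero] at hf0
    refine (hP _).smul hf0 (evL_family u hP _ (t 0) (hnd 0) ?_
      (fun a ha A hA j => hT 0 a ha A hA 0 j) _ ?_ (Nat.succ_pos N))
    · rintro a ha ⟨k, hk⟩
      exact hdisj 0 k.succ (Fin.succ_ne_zero k).symm a ha hk
    · refine bv_family u hG N (H := fun ω => (Fin ((t 0).map (u ω)).length → Fin (N + 1)) → H ω)
        (P := fun A X => ∀ κ, P A fun ω => X ω (resIdx κ _))
        (fun A => ⟨fun _ => (hP A).zero, fun hx hy κ => (hP A).add (hx κ) (hy κ),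
          fun hc _ hx κ => (hP A).smul hc (hx κ)⟩) (fun k => t k.succ) (fun k => hnd k.succ)
        (fun k l hkl => hdisj _ _ fun h => hkl (Fin.succ_inj.mp h)) (fun k => ?_)
        (fun k a ha A hA i j x hx => ?_) ?_
      · simpa only [colorOr_succ] using hf (k + 1)
      · refine chainL_family u (hP _) (fun i j x => hT k.succ a ha A hA i.succ j.succ x) _
          (fun b hb => hG a b (fun h => ?_) _) i j x hx
        exact hdisj k.succ 0 (Fin.succ_ne_zero k) a ha (h ▸ hb)
      · intro κ
        by_cases h : ∀ a < (t 0).length, κ a = 0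
        · have : ∀ ω, vacL N (vac ω) ((t 0).map (u ω)) (resIdx κ _) = vac ω := by
            intro ω
            have : resIdx κ ((t 0).map (u ω)).length = fun _ => 0 :=
              funext fun a => h a (by simpa using a.2)
            rw [vacL, this, Pi.single_eq_same]
          simpa only [this] using hv
        · have : ∀ ω, vacL N (vac ω) ((t 0).map (u ω)) (resIdx κ _) = 0 := by
            intro ω
            rw [vacL, Pi.single_eq_of_ne]
            intro h'
            exact h fun a ha => congrFun h' ⟨a, by simpa using ha⟩
          simpa only [this] using (hP _).zero

end Families

/-! ## Vacuum expectation values of words -/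

section Words

variable {q : ℂ} {N m : ℕ} {H : Type*} [AddCommGroup H] [Module (LamRing m) H] [Module ℂ H]
  [IsScalarTower ℂ (LamRing m) H]

/-- A monodromy matrix with a pseudovacuum and a dual pseudovacuum, whose vacuum eigenvalues are
some of the free functional parameters. -/
structure IsFreeModel (q : ℂ) (ι : Fin (N + 1) → Fin m)
    (T : Fin (N + 1) → Fin (N + 1) → ℂ → Module.End (LamRing m) H) (vac : H)
    (bra : Module.Dual (LamRing m) H) : Prop where
  rtt : IsRTT q {0}ᶜ T
  inj : Function.Injective ι
  diag_vac : ∀ u : ℂ, u ≠ 0 → ∀ i, T i i u vac = lam (ι i) u • vac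
  lower_vac : ∀ u : ℂ, u ≠ 0 → ∀ i j, j < i → T i j u vac = 0
  bra_diag : ∀ u : ℂ, u ≠ 0 → ∀ i x, bra (T i i u x) = lam (ι i) u * bra x
  bra_upper : ∀ u : ℂ, u ≠ 0 → ∀ i j, i < j → ∀ x, bra (T i j u x) = 0
  bra_vac : bra vac = 1

variable {Ω Λ : Type*}

/-- The action of a word in the entries of the monodromy matrix. -/
noncomputable def word (T : Fin (N + 1) → Fin (N + 1) → ℂ → Module.End (LamRing m) H) (u : Λ → ℂ)
    (w : List (Fin (N + 1) × Fin (N + 1) × Λ)) (x : H) : H :=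
  w.foldr (fun a y => T a.1 a.2.1 (u a.2.2) y) x

section word

variable (T : Fin (N + 1) → Fin (N + 1) → ℂ → Module.End (LamRing m) H) (u : Λ → ℂ)

theorem word_nil (x : H) : word T u [] x = x := rfl

theorem word_cons (a : Fin (N + 1) × Fin (N + 1) × Λ) (w : List (Fin (N + 1) × Fin (N + 1) × Λ))
    (x : H) : word T u (a :: w) x = T a.1 a.2.1 (u a.2.2) (word T u w x) := rfl

theorem word_append (w w' : List (Fin (N + 1) × Fin (N + 1) × Λ)) (x : H) :
    word T u (w ++ w') x = word T u w (word T u w' x) := by simp [word]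

theorem word_zero (w : List (Fin (N + 1) × Fin (N + 1) × Λ)) : word T u w 0 = 0 := by
  induction w with
  | nil => rfl
  | cons a w ih => rw [word_cons, ih, map_zero]

theorem word_add (w : List (Fin (N + 1) × Fin (N + 1) × Λ)) (x y : H) :
    word T u w (x + y) = word T u w x + word T u w y := by
  induction w with
  | nil => rfl
  | cons a w ih => rw [word_cons, ih, map_add, word_cons, word_cons]

theorem word_smul (w : List (Fin (N + 1) × Fin (N + 1) × Λ)) (c : ℂ) (x : H) :
    word T u w (c • x) = c • word T u w x := by
  induction w with
  | nil => rfl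
  | cons a w ih => rw [word_cons, ih, LinearMap.map_smul_of_tower, word_cons]

end word

theorem IsRTT.swap_row {U : Set ℂ} {T : Fin (N + 1) → Fin (N + 1) → ℂ → Module.End (LamRing m) H}
    (h : IsRTT q U T) {u v : ℂ} (hu : u ∈ U) (hv : v ∈ U) (huv : u ≠ v) {a c : Fin (N + 1)}
    (hac : a ≠ c) (i j : Fin (N + 1)) (x : H) :
    T a i u (T c j v x) = (if i = j then fFun q u v else 1) • T c j v (T a i u x) +
      (if i = j then 0 else gOff q u v j i) • T c i v (T a j u x) +
      (-gOff q u v a c) • T c i u (T a j v x) := by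
  by_cases hij : i = j
  · subst hij
    rw [if_pos rfl, if_pos rfl, ← h.ne_eq hu hv huv i hac x]
    module
  · rw [if_neg hij, if_neg hij, one_smul, ← h.ne_ne hu hv huv hac hij x]
    module

theorem IsRTT.swap_col {U : Set ℂ} {T : Fin (N + 1) → Fin (N + 1) → ℂ → Module.End (LamRing m) H}
    (h : IsRTT q U T) {u v : ℂ} (hu : u ∈ U) (hv : v ∈ U) (huv : u ≠ v) {d i : Fin (N + 1)}
    (hdi : i ≠ d) (a c : Fin (N + 1)) (x : H) :
    T c d v (T a i u x) = (if a = c then fFun q u v else 1) • T a i u (T c d v x) +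
      (if a = c then 0 else gOff q u v a c) • T c i u (T a d v x) +
      (-gOff q u v d i) • T c i v (T a d u x) := by
  by_cases hac : a = c
  · subst hac
    rw [if_pos rfl, if_pos rfl, h.eq_ne hu hv huv a hdi x]
    module
  · have := h.ne_ne hu hv huv hac hdi x
    rw [if_neg hac, if_neg hac, one_smul, this]
    module

/-- An entry with column `d` and row above `d` annihilates the vacuum. If it is not adjacent to the
vacuum, exchanging columns moves column `d` one place to the right in every term, while the rows of
the word stay above `d`. -/
theorem word_vac_eq_zero {T : Fin (N + 1) → Fin (N + 1) → ℂ → Module.End (LamRing m) H} {vac : H}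
    (hT : IsRTT q {0}ᶜ T) (hv : ∀ u : ℂ, u ≠ 0 → ∀ i j, j < i → T i j u vac = 0) {u : Λ → ℂ}
    (hu : Function.Injective u) (hu0 : ∀ a, u a ≠ 0) (d : Fin (N + 1)) :
    ∀ (k : ℕ) (w : List (Fin (N + 1) × Fin (N + 1) × Λ)) (_ : w.length = k)
      (_ : (w.map fun a => a.2.2).Nodup) (_ : ∀ a ∈ w, d < a.1) (_ : ∃ a ∈ w, a.2.1 = d),
      word T u w vac = 0
  | 0, w, hk, _, _, hd => by
    obtain rfl := List.eq_nil_of_length_eq_zero hk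
    simp at hd
  | k + 1, [], hk, _, _, _ => by simp at hk
  | k + 1, [b], _, _, hr, hd => by
    obtain ⟨a, ha, h⟩ := hd
    obtain rfl := List.mem_singleton.mp ha
    rw [word_cons, word_nil, hv _ (hu0 _) _ _ (h ▸ hr a ha)]
  | k + 1, x :: y :: w, hk, hn, hr, hd => by
    have hk' : (y :: w).length = k := by simpa using hk
    by_cases hd' : ∃ a ∈ y :: w, a.2.1 = d
    · rw [word_cons, word_vac_eq_zero hT hv hu hu0 d k _ hk' (List.nodup_cons.mp hn).2
        (fun a ha => hr a (List.mem_cons_of_mem _ ha)) hd', map_zero]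
    · have hy : y.2.1 ≠ d := fun h => hd' ⟨y, by simp, h⟩
      have hx : x.2.1 = d := by
        obtain ⟨a, ha, h⟩ := hd
        rcases List.mem_cons.mp ha with rfl | ha
        · exact h
        · exact absurd ⟨a, ha, h⟩ hd'
      simp only [List.map_cons, List.nodup_cons, List.mem_cons, not_or] at hn
      have hz : ∀ r l, d < r → l = x.2.2 ∨ l = y.2.2 → T r d (u l) (word T u w vac) = 0 := by
        intro r l hrd hl
        have := word_vac_eq_zero hT hv hu hu0 d k ((r, d, l) :: w) (by simpa using hk') ?_ ?_
          ⟨_, List.mem_cons_self, rfl⟩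
        · exact this
        · simp only [List.map_cons, List.nodup_cons]
          rcases hl with rfl | rfl
          · exact ⟨hn.1.2, hn.2.2⟩
          · exact ⟨hn.2.1, hn.2.2⟩
        · intro a ha
          rcases List.mem_cons.mp ha with rfl | ha
          · exact hrd
          · exact hr a (by simp [ha])
      rw [word_cons, word_cons, hx, hT.swap_col (hu0 y.2.2) (hu0 x.2.2)
        (fun h => hn.1.1 (hu h).symm) hy, hz _ _ (hr x (by simp)) (Or.inl rfl),
        hz _ _ (hr y (by simp)) (Or.inl rfl), hz _ _ (hr y (by simp)) (Or.inr rfl)]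
      simp

/-- Families of polynomials in the functional parameters at given points, whose coefficients
belong to an algebra of functions. -/
structure IsNice (u : Ω → Λ → ℂ) (G : Subalgebra ℂ (Ω → ℂ)) (h : Ω → LamRing m) : Prop where
  coeff : ∀ e : (Fin m × Λ) →₀ ℤ,
    (fun ω => (h ω).coeff (e.mapDomain (Prod.map id (u ω)))) ∈ G
  nonneg : ∀ ω e, (h ω).coeff e ≠ 0 → 0 ≤ e

namespace IsNice

variable {u : Ω → Λ → ℂ} {G : Subalgebra ℂ (Ω → ℂ)} {h h' : Ω → LamRing m}

theorem zero : IsNice u G fun _ => (0 : LamRing m) where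
  coeff _ := zero_mem G
  nonneg ω e := by simp

theorem add (hh : IsNice u G h) (hh' : IsNice u G h') : IsNice u G fun ω => h ω + h' ω where
  coeff e := add_mem (hh.coeff e) (hh'.coeff e)
  nonneg ω e he := by
    by_cases h0 : (h ω).coeff e = 0
    · refine hh'.nonneg ω e fun h1 => he ?_
      simp [h0, h1]
    · exact hh.nonneg ω e h0

theorem smul {c : Ω → ℂ} (hc : c ∈ G) (hh : IsNice u G h) : IsNice u G fun ω => c ω • h ω where
  coeff e := mul_mem hc (hh.coeff e)
  nonneg ω e he := hh.nonneg ω e fun h0 => he (by simp [h0])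

theorem one (hu : ∀ ω, Function.Injective (u ω)) : IsNice u G fun _ => (1 : LamRing m) where
  coeff e := by
    classical
    have : (fun ω => (1 : LamRing m).coeff (e.mapDomain (Prod.map id (u ω)))) =
        algebraMap ℂ (Ω → ℂ) (if e = 0 then 1 else 0) := by
      funext ω
      have hinj := Finsupp.mapDomain_injective (M := ℤ)
        (Function.injective_id.prodMap (hu ω) : Function.Injective (Prod.map (id : Fin m → _) (u ω)))
      have h1 : 0 = e.mapDomain (Prod.map (id : Fin m → _) (u ω)) ↔ e = 0 :=
        ⟨fun h => hinj (h.symm.trans Finsupp.mapDomain_zero.symm), fun h => by simp [h]⟩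
      rw [AddMonoidAlgebra.one_def]
      simp [Finsupp.single_apply, h1]
    rw [this]
    exact G.algebraMap_mem _
  nonneg ω e he := by
    rw [AddMonoidAlgebra.one_def] at he
    simp [Finsupp.single_apply] at he
    exact he.le

end IsNice

theorem lam_mul_coeff (i : Fin m) (v : ℂ) (x : LamRing m) (e : (Fin m × ℂ) →₀ ℤ) :
    (lam i v * x).coeff e = x.coeff (e - Finsupp.single (i, v) 1) := by
  rw [lam, AddMonoidAlgebra.coeff_single_mul_eq_mul_coeff (e - Finsupp.single (i, v) 1), one_mul]
  intro e' _
  rw [eq_sub_iff_add_eq, add_comm]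

theorem IsNice.lam_mul {u : Ω → Λ → ℂ} {G : Subalgebra ℂ (Ω → ℂ)} {h : Ω → LamRing m}
    (hh : IsNice u G h) (i : Fin m) (a : Λ) : IsNice u G fun ω => lam i (u ω a) * h ω where
  coeff e := by
    have := hh.coeff (e - Finsupp.single (i, a) 1)
    simpa [lam_mul_coeff, Finsupp.mapDomain_sub, Finsupp.mapDomain_single] using this
  nonneg ω e he := by
    rw [lam_mul_coeff] at he
    have := hh.nonneg ω _ he
    exact (Finsupp.single_nonneg.mpr zero_le_one).trans (sub_nonneg.mp this)

section vacuum

variable {u : Ω → Λ → ℂ} {G : Subalgebra ℂ (Ω → ℂ)}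

theorem fFun_mem (hG : ∀ a b, a ≠ b → ∀ n x y, (fun ω => RMat q n (u ω a) (u ω b) x y) ∈ G)
    {a b : Λ} (hab : a ≠ b) : (fun ω => fFun q (u ω a) (u ω b)) ∈ G := by
  simpa [RMat_apply] using hG a b hab 1 (0, 0) (0, 0)

theorem gOff_mem (hG : ∀ a b, a ≠ b → ∀ n x y, (fun ω => RMat q n (u ω a) (u ω b) x y) ∈ G)
    {a b : Λ} (hab : a ≠ b) {n : ℕ} {i j : Fin n} (hij : i ≠ j) :
    (fun ω => gOff q (u ω a) (u ω b) i j) ∈ G := by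
  simpa [RMat_apply, hij] using hG a b hab n (i, j) (j, i)

variable {ι : Fin (N + 1) → Fin m} {T : Fin (N + 1) → Fin (N + 1) → ℂ → Module.End (LamRing m) H}
  {vac : H} {bra : Module.Dual (LamRing m) H}

/-- An entry of the minimal row `c` is moved to the left end. Each exchange keeps the letters and
the bound on columns. At the left end the dual vacuum turns it into an eigenvalue if its column is
`c`, and into zero if the column is larger. -/
theorem IsFreeModel.isNice_word_of_le (hT : IsFreeModel q ι T vac bra)
    (hu : ∀ ω, Function.Injective (u ω)) (hu0 : ∀ ω a, u ω a ≠ 0)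
    (hG : ∀ a b, a ≠ b → ∀ n x y, (fun ω => RMat q n (u ω a) (u ω b) x y) ∈ G) {r : ℕ}
    (ih : ∀ w : List (Fin (N + 1) × Fin (N + 1) × Λ), w.length = r →
      (w.map fun a => a.2.2).Nodup → IsNice u G fun ω => bra (word T (u ω) w vac))
    (c : Fin (N + 1)) :
    ∀ (k : ℕ) (w w' : List (Fin (N + 1) × Fin (N + 1) × Λ)) (j : Fin (N + 1)) (b : Λ)
      (_ : w.length = k) (_ : w.length + w'.length = r)
      (_ : ((w ++ (c, j, b) :: w').map fun a => a.2.2).Nodup)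
      (_ : ∀ a ∈ w ++ (c, j, b) :: w', c ≤ a.2.1),
      IsNice u G fun ω => bra (word T (u ω) (w ++ (c, j, b) :: w') vac)
  | 0, w, w', j, b, hk, hr, hn, hc => by
    obtain rfl := List.eq_nil_of_length_eq_zero hk
    simp only [List.nil_append, word_cons]
    rcases (hc (c, j, b) (by simp)).eq_or_lt with h | h
    · simp only at h
      subst h
      simp only [hT.bra_diag _ (hu0 _ _)]
      refine (ih w' (by simpa using hr) ?_).lam_mul _ _
      simp only [List.nil_append, List.map_cons, List.nodup_cons] at hn
      exact hn.2
    · simp only [hT.bra_upper _ (hu0 _ _) _ _ h]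
      exact .zero
  | k + 1, w, w', j, b, hk, hr, hn, hc => by
    obtain ⟨w, ⟨i, j', a⟩, rfl⟩ : ∃ v x, w = v ++ [x] := by
      rcases List.eq_nil_or_concat w with rfl | ⟨v, x, rfl⟩
      · simp at hk
      · exact ⟨v, x, by simp⟩
    simp only [List.append_assoc, List.singleton_append] at hn hc ⊢
    simp only [List.length_append, List.length_cons, List.length_nil] at hk hr
    have hk : w.length = k := by omega
    -- If the left neighbor already lies in row `c`, no exchange is needed: the neighbor becomes the
    -- entry to be moved.
    by_cases hi : i = c
    · subst hi
      exact hT.isNice_word_of_le hu hu0 hG ih i k w ((i, j, b) :: w') j' a hk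
        (by simp only [List.length_cons]; omega) hn hc
    · have hab : a ≠ b := by
        simp only [List.map_append, List.map_cons, List.nodup_append, List.nodup_cons,
          List.mem_cons, not_or] at hn
        exact hn.2.1.1.1
      have key : ∀ (j₁ j₂ : Fin (N + 1)) (b₁ b₂ : Λ), c ≤ j₁ → c ≤ j₂ →
          (b₁ = b ∧ b₂ = a ∨ b₁ = a ∧ b₂ = b) → IsNice u G fun ω => bra (word T (u ω) w
            (T c j₁ (u ω b₁) (T i j₂ (u ω b₂) (word T (u ω) w' vac)))) := by
        intro j₁ j₂ b₁ b₂ h1 h2 hb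
        have := hT.isNice_word_of_le hu hu0 hG ih c k w ((i, j₂, b₂) :: w') j₁ b₁ hk
          (by simp only [List.length_cons]; omega) ?_ ?_
        · simpa only [word_append, word_cons] using this
        · rcases hb with ⟨rfl, rfl⟩ | ⟨rfl, rfl⟩
          · refine (List.Perm.nodup_iff ?_).mp hn
            simp only [List.map_append, List.map_cons]
            exact (List.Perm.swap _ _ _).append_left _
          · simpa only [List.map_append, List.map_cons] using hn
        · intro x hx
          simp only [List.mem_append, List.mem_cons] at hx hc
          rcases hx with hx | rfl | rfl | hx
          · exact hc x (Or.inl hx)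
          · exact h1
          · exact h2
          · exact hc x (Or.inr (Or.inr (Or.inr hx)))
      have hj : c ≤ j := hc (c, j, b) (by simp)
      have hj' : c ≤ j' := hc (i, j', a) (by simp)
      have hsw : ∀ ω, bra (word T (u ω) (w ++ (i, j', a) :: (c, j, b) :: w') vac) =
          (if j' = j then fFun q (u ω a) (u ω b) else 1) • bra (word T (u ω) w
            (T c j (u ω b) (T i j' (u ω a) (word T (u ω) w' vac)))) +
          (if j' = j then 0 else gOff q (u ω a) (u ω b) j j') • bra (word T (u ω) w
            (T c j' (u ω b) (T i j (u ω a) (word T (u ω) w' vac)))) +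
          (-gOff q (u ω a) (u ω b) i c) • bra (word T (u ω) w
            (T c j' (u ω a) (T i j (u ω b) (word T (u ω) w' vac)))) := by
        intro ω
        rw [word_append, word_cons, word_cons, hT.rtt.swap_row (hu0 ω a) (hu0 ω b)
          (fun h => hab (hu ω h)) hi]
        simp only [word_add, word_smul, map_add, LinearMap.map_smul_of_tower]
      simp only [hsw]
      refine ((IsNice.smul ?_ (key _ _ _ _ hj hj' (Or.inl ⟨rfl, rfl⟩))).add
        (IsNice.smul ?_ (key _ _ _ _ hj' hj (Or.inl ⟨rfl, rfl⟩)))).add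
        (IsNice.smul ?_ (key _ _ _ _ hj' hj (Or.inr ⟨rfl, rfl⟩)))
      · split_ifs
        · exact fFun_mem hG hab
        · exact one_mem G
      · split_ifs with h
        · exact zero_mem G
        · exact gOff_mem hG hab (Ne.symm h)
      · exact neg_mem (gOff_mem hG hab hi)

/-- Induction on the length with an entry of minimal row `c`. If some column is smaller than `c`,
the word annihilates the vacuum; otherwise the entry of row `c` can be eliminated. Only
multiplication by `λ`, never by an inverse, occurs, so the exponents are nonnegative. -/
theorem IsFreeModel.isNice_word (hT : IsFreeModel q ι T vac bra)
    (hu : ∀ ω, Function.Injective (u ω)) (hu0 : ∀ ω a, u ω a ≠ 0)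
    (hG : ∀ a b, a ≠ b → ∀ n x y, (fun ω => RMat q n (u ω a) (u ω b) x y) ∈ G) :
    ∀ (r : ℕ) (w : List (Fin (N + 1) × Fin (N + 1) × Λ)) (_ : w.length = r)
      (_ : (w.map fun a => a.2.2).Nodup), IsNice u G fun ω => bra (word T (u ω) w vac)
  | 0, w, hw, _ => by
    obtain rfl := List.eq_nil_of_length_eq_zero hw
    simp only [word_nil, hT.bra_vac]
    exact .one hu
  | r + 1, w, hw, hn => by
    classical
    obtain ⟨x, hx, hmin⟩ : ∃ x ∈ w, ∀ y ∈ w, x.1 ≤ y.1 := by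
      obtain ⟨x, hx, h⟩ := w.toFinset.exists_min_image (fun x => x.1) (by
        cases w with
        | nil => simp at hw
        | cons a w => exact ⟨a, by simp⟩)
      exact ⟨x, List.mem_toFinset.mp hx, fun y hy => h y (List.mem_toFinset.mpr hy)⟩
    by_cases hc : ∃ y ∈ w, y.2.1 < x.1
    · obtain ⟨y, hy, hyx⟩ := hc
      have : ∀ ω, word T (u ω) w vac = 0 := fun ω =>
        word_vac_eq_zero hT.rtt hT.lower_vac (hu ω) (hu0 ω) y.2.1 (r + 1) w hw hn
          (fun a ha => hyx.trans_le (hmin a ha)) ⟨y, hy, rfl⟩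
      simp only [this, map_zero]
      exact .zero
    · push Not at hc
      obtain ⟨w₁, w₂, rfl⟩ := List.append_of_mem hx
      simp only [List.length_append, List.length_cons] at hw
      exact hT.isNice_word_of_le hu hu0 hG (hT.isNice_word hu hu0 hG r) x.1 _ w₁ w₂ x.2.1 x.2.2
        rfl (by omega) hn hc

end vacuum

end Words

/-! ## The dual model -/

section Dual

variable {q : ℂ}

theorem fFun_inv {u v : ℂ} (hu : u ≠ 0) (hv : v ≠ 0) : fFun q⁻¹ u⁻¹ v⁻¹ = fFun q u v := by
  by_cases h : u = v
  · subst h; simp [fFun]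
  · have h1 := sub_ne_zero.mpr h
    have h2 : v - u ≠ 0 := sub_ne_zero.mpr (Ne.symm h)
    have h3 : u⁻¹ - v⁻¹ ≠ 0 := sub_ne_zero.mpr fun h' => h (inv_injective h')
    rw [fFun, fFun, inv_inv, div_eq_div_iff h3 h1]
    field_simp
    ring

theorem gFun_inv {u v : ℂ} (hu : u ≠ 0) (hv : v ≠ 0) :
    gFun q⁻¹ u⁻¹ v⁻¹ = u * v * gFun q u v := by
  by_cases h : u = v
  · subst h; simp [gFun]
  · have h1 := sub_ne_zero.mpr h
    have h3 : u⁻¹ - v⁻¹ ≠ 0 := sub_ne_zero.mpr fun h' => h (inv_injective h')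
    rw [gFun, gFun, inv_inv, ← mul_div_assoc, div_eq_div_iff h3 h1]
    field_simp
    ring

theorem gL_inv {u v : ℂ} (hu : u ≠ 0) (hv : v ≠ 0) : gL q⁻¹ u⁻¹ v⁻¹ = gR q u v := by
  rw [gL, gR, gFun_inv hu hv]
  field_simp

theorem fProd_inv {us vs : List ℂ} (hu : ∀ x ∈ us, x ≠ 0) (hv : ∀ x ∈ vs, x ≠ 0) :
    fProd q⁻¹ (us.map fun x => x⁻¹) (vs.map fun x => x⁻¹) = fProd q us vs := by
  rw [fProd, fProd, List.map_map]
  congr 1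
  refine List.map_congr_left fun x hx => ?_
  rw [Function.comp_apply, List.map_map]
  congr 1
  exact List.map_congr_left fun y hy => fFun_inv (hu x hx) (hv y hy)

/-- Inverting `q` and the spectral parameters transposes the R-matrix. Hence the transposed
monodromy matrix at inverse parameters satisfies RTT for `q⁻¹` (`IsRTT.dual`). -/
theorem RMat_inv {n : ℕ} {u v : ℂ} (hu : u ≠ 0) (hv : v ≠ 0) (x y : Fin n × Fin n) :
    RMat q⁻¹ n u⁻¹ v⁻¹ x y = RMat q n u v y x := by
  obtain ⟨a, c⟩ := x
  obtain ⟨b, d⟩ := y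
  rw [RMat_apply, RMat_apply]
  by_cases h : a = b ∧ c = d
  · obtain ⟨rfl, rfl⟩ := h
    simp [fFun_inv hu hv]
  · have h1 : ¬(b = a ∧ d = c) := fun h' => h ⟨h'.1.symm, h'.2.symm⟩
    rw [if_neg h, if_neg h1]
    by_cases h' : a = d ∧ c = b
    · obtain ⟨rfl, rfl⟩ := h'
      have hac : a ≠ c := fun h' => h ⟨h', h'.symm⟩
      rw [if_pos ⟨rfl, rfl⟩, if_pos ⟨rfl, rfl⟩, gOff, gOff, gFun_inv hu hv]
      rcases lt_or_gt_of_ne hac with h1 | h1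
      · rw [if_pos h1, if_neg h1.not_gt]
        field_simp
      · rw [if_pos h1, if_neg h1.not_gt]
        field_simp
    · rw [if_neg h', if_neg fun h'' => h' ⟨h''.2.symm, h''.1.symm⟩]

variable {N m : ℕ} {H : Type*} [AddCommGroup H] [Module (LamRing m) H] [Module ℂ H]
  [IsScalarTower ℂ (LamRing m) H]

/-- The transposed monodromy matrix in the dual space. -/
noncomputable def dualT {n : ℕ} (T : Fin n → Fin n → ℂ → Module.End (LamRing m) H) (a b : Fin n)
    (u : ℂ) : Module.End (LamRing m) (Module.Dual (LamRing m) H) := (T b a u⁻¹).dualMap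

theorem dualT_apply {n : ℕ} (T : Fin n → Fin n → ℂ → Module.End (LamRing m) H) (a b : Fin n)
    (u : ℂ) (φ : Module.Dual (LamRing m) H) (x : H) : dualT T a b u φ x = φ (T b a u⁻¹ x) := rfl

theorem IsRTT.dual {n : ℕ} {T : Fin n → Fin n → ℂ → Module.End (LamRing m) H}
    (hT : IsRTT q {0}ᶜ T) : IsRTT q⁻¹ {0}ᶜ (dualT T) := by
  intro u hu v hv huv a c i j φ
  have hu' : u⁻¹ ≠ 0 := inv_ne_zero hu
  have hv' : v⁻¹ ≠ 0 := inv_ne_zero hv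
  refine LinearMap.ext fun x => ?_
  have h := congrArg φ (hT u⁻¹ hu' v⁻¹ hv' (fun h => huv (inv_injective h)) i j a c x)
  have hR : ∀ x y, RMat q⁻¹ n u v x y = RMat q n u⁻¹ v⁻¹ y x := fun x y => by
    rw [← RMat_inv hu' hv', inv_inv, inv_inv]
  simp only [map_sum, LinearMap.map_smul_of_tower] at h
  simp only [LinearMap.sum_apply, LinearMap.smul_apply, dualT_apply, hR]
  exact h.symm

theorem isUnit_lam (i : Fin m) (u : ℂ) : IsUnit (lam i u : LamRing m) := by
  refine IsUnit.of_mul_eq_one (lamInv i u) ?_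
  rw [lam, lamInv, AddMonoidAlgebra.single_mul_single, ← Finsupp.single_add]
  simp [AddMonoidAlgebra.one_def]

variable {ι : Fin (N + 1) → Fin m} {T : Fin (N + 1) → Fin (N + 1) → ℂ → Module.End (LamRing m) H}
  {vac : H} {bra : Module.Dual (LamRing m) H}

theorem IsFreeModel.vacModel (hT : IsFreeModel q ι T vac bra) :
    IsVacModel q {0}ᶜ T vac fun i u => lam (ι i) u where
  rtt := hT.rtt
  diag := hT.diag_vac
  lower := hT.lower_vac
  unit _ _ _ := isUnit_lam _ _
  cofinite := by simp

/-- In the dual space `bra` is an ordinary pseudovacuum, so all results on Bethe vectors apply to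
`dualBv`. -/
theorem IsFreeModel.dualVacModel (hT : IsFreeModel q ι T vac bra) :
    IsVacModel q⁻¹ {0}ᶜ (dualT T) bra fun i u => lam (ι i) u⁻¹ where
  rtt := hT.rtt.dual
  diag u hu i := LinearMap.ext fun x => hT.bra_diag _ (inv_ne_zero hu) i x
  lower u hu i j hij := LinearMap.ext fun x => hT.bra_upper _ (inv_ne_zero hu) j i hij x
  unit _ _ _ := isUnit_lam _ _
  cofinite := by simp

/-- The dual Bethe vector without the normalization by the vacuum eigenvalues. -/
noncomputable def dualBv (q : ℂ) (N : ℕ) (T : Fin (N + 1) → Fin (N + 1) → ℂ →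
    Module.End (LamRing m) H) (bra : Module.Dual (LamRing m) H) (s : Fin N → List ℂ) :
    Module.Dual (LamRing m) H :=
  bv q⁻¹ N (dualT T) bra fun k => (s k).map fun x => x⁻¹

/-! ### Matrix elements between Bethe vectors and dual Bethe vectors -/

section Pairing

variable {Ω Λ : Type*} {u : Ω → Λ → ℂ} {G : Subalgebra ℂ (Ω → ℂ)}

/-- Families of vectors with nice matrix elements. -/
def NiceVec (T : Fin (N + 1) → Fin (N + 1) → ℂ → Module.End (LamRing m) H)
    (bra : Module.Dual (LamRing m) H) (u : Ω → Λ → ℂ) (G : Subalgebra ℂ (Ω → ℂ)) (A : Set Λ)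
    (h : Ω → H) : Prop :=
  ∀ w : List (Fin (N + 1) × Fin (N + 1) × Λ), (w.map fun a => a.2.2).Nodup →
    (∀ a ∈ w, a.2.2 ∉ A) → IsNice u G fun ω => bra (word T (u ω) w (h ω))

theorem NiceVec.isLinFam (A : Set Λ) :
    IsLinFam (H := fun _ => H) G (NiceVec T bra u G A) where
  zero w _ _ := by
    simp only [word_zero, map_zero]
    exact .zero
  add hx hy w hw hA := by
    simp only [word_add, map_add]
    exact (hx w hw hA).add (hy w hw hA)
  smul hc _ hx w hw hA := by
    simp only [word_smul, LinearMap.map_smul_of_tower]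
    exact (hx w hw hA).smul hc

theorem NiceVec.apply {A : Set Λ} {h : Ω → H} (hh : NiceVec T bra u G A h) {a : Λ}
    (ha : a ∉ A) (i j : Fin (N + 1)) : NiceVec T bra u G (insert a A) fun ω => T i j (u ω a) (h ω) := by
  intro w hw hA
  have := hh (w ++ [(i, j, a)]) ?_ ?_
  · simpa only [word_append, word_cons, word_nil] using this
  · rw [List.map_append, List.nodup_append]
    refine ⟨hw, by simp, ?_⟩
    rintro b hb c hc rfl
    obtain ⟨x, hx, rfl⟩ := List.mem_map.mp hb
    simp only [List.map_cons, List.map_nil, List.mem_singleton] at hc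
    exact hA x hx (by simp [hc])
  · intro x hx
    rcases List.mem_append.mp hx with hx | hx
    · exact fun h => hA x hx (Set.mem_insert_of_mem _ h)
    · rwa [List.mem_singleton.mp hx]

/-- Families of covectors with nice values on nice vectors. -/
def NiceCovec (T : Fin (N + 1) → Fin (N + 1) → ℂ → Module.End (LamRing m) H)
    (bra : Module.Dual (LamRing m) H) (u : Ω → Λ → ℂ) (G : Subalgebra ℂ (Ω → ℂ)) (B : Set Λ)
    (φ : Ω → Module.Dual (LamRing m) H) : Prop :=
  ∀ A h, Disjoint A B → NiceVec T bra u G A h → IsNice u G fun ω => φ ω (h ω)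

theorem NiceCovec.isLinFam (B : Set Λ) :
    IsLinFam (H := fun _ => Module.Dual (LamRing m) H) G (NiceCovec T bra u G B) where
  zero A h _ _ := by
    simp only [LinearMap.zero_apply]
    exact .zero
  add hx hy A h hA hh := by
    simp only [LinearMap.add_apply]
    exact (hx A h hA hh).add (hy A h hA hh)
  smul hc _ hx A h hA hh := by
    simp only [LinearMap.smul_apply]
    exact (hx A h hA hh).smul hc

/-- A transposed entry acting on the covector is the entry acting on the vector, so the label `a`
passes from one set to the other and disjointness is kept. -/
theorem NiceCovec.dualT_apply {B : Set Λ} {φ : Ω → Module.Dual (LamRing m) H}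
    (hφ : NiceCovec T bra u G B φ) {a : Λ} (ha : a ∉ B) (i j : Fin (N + 1)) :
    NiceCovec T bra u G (insert a B) fun ω => dualT T i j (u ω a)⁻¹ (φ ω) := by
  intro A h hA hh
  simp only [_root_.dualT_apply, inv_inv]
  rw [Set.disjoint_insert_right] at hA
  exact hφ _ _ (Set.disjoint_insert_left.mpr ⟨ha, hA.2⟩) (hh.apply hA.1 j i)

variable (hT : IsFreeModel q ι T vac bra) (hu : ∀ ω, Function.Injective (u ω))
  (hu0 : ∀ ω a, u ω a ≠ 0)
  (hG : ∀ a b, a ≠ b → ∀ n x y, (fun ω => RMat q n (u ω a) (u ω b) x y) ∈ G)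

include hT hu hu0 hG

theorem IsFreeModel.niceVec_bv {t : Fin N → List Λ} (hn : ∀ k, (t k).Nodup)
    (hd : ∀ k l, k ≠ l → ∀ a ∈ t k, a ∉ t l)
    (hf : ∀ k : ℕ, (fun ω => (fProd q (colorOr (fun k => (t k).map (u ω)) (k + 1))
      (colorOr (fun k => (t k).map (u ω)) k))⁻¹) ∈ G) :
    NiceVec T bra u G {a | ∃ k, a ∈ t k} fun ω => bv q N T vac fun k => (t k).map (u ω) :=
  bv_family u hG N (H := fun _ => H) (P := NiceVec T bra u G) NiceVec.isLinFam (T := fun _ => T)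
    (vac := fun _ => vac) t hn hd hf (fun _ _ _ _ hA i j _ hx => hx.apply hA i j)
    fun w hw _ => hT.isNice_word hu hu0 hG _ w rfl hw

theorem IsFreeModel.niceCovec_dualBv {s : Fin N → List Λ} (hn : ∀ k, (s k).Nodup)
    (hd : ∀ k l, k ≠ l → ∀ a ∈ s k, a ∉ s l)
    (hf : ∀ k : ℕ, (fun ω => (fProd q (colorOr (fun k => (s k).map (u ω)) (k + 1))
      (colorOr (fun k => (s k).map (u ω)) k))⁻¹) ∈ G) :
    NiceCovec T bra u G {a | ∃ k, a ∈ s k} fun ω => dualBv q N T bra fun k => (s k).map (u ω) := by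
  simp only [dualBv, List.map_map]
  refine bv_family (q := q⁻¹) (fun ω a => (u ω a)⁻¹) (fun a b hab n x y => ?_) N
    (H := fun _ => Module.Dual (LamRing m) H) (P := NiceCovec T bra u G) NiceCovec.isLinFam
    (T := fun _ => dualT T) (vac := fun _ => bra) s hn hd (fun k => ?_)
    (fun _ _ _ _ hA i j _ hx => hx.dualT_apply hA i j) fun A h _ hh => ?_
  · simpa only [RMat_inv (hu0 _ _) (hu0 _ _)] using hG a b hab n y x
  · convert hf k using 2 with ω
    congr 1
    have : ∀ k, colorOr (fun k => (s k).map fun a => (u ω a)⁻¹) k =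
        (colorOr (fun k => (s k).map (u ω)) k).map fun x => x⁻¹ := fun k => by
      unfold colorOr
      split_ifs
      · rw [List.map_map]; rfl
      · rfl
    have h0 : ∀ k, ∀ x ∈ colorOr (fun k => (s k).map (u ω)) k, x ≠ 0 := fun k x hx => by
      obtain ⟨hk, hx⟩ := mem_colorOr hx
      obtain ⟨a, -, rfl⟩ := List.mem_map.mp hx
      exact hu0 ω a
    rw [this, this, fProd_inv (h0 _) (h0 _)]
  · simpa only [word_nil] using hh [] (by simp) (by simp)

end Pairing

end Dual

/-! ## Coefficients -/

section Coefficients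

variable {q : ℂ} {N : ℕ}

theorem chosen_map (f : ℂ → ℂ) (hf : f 0 = 0) (t : Fin N → List ℂ) (I : Fin N → ℕ) (k : Fin N) :
    chosen (fun k => (t k).map f) I k = f (chosen t I k) := by
  have := List.getD_map (t k) (0 : ℂ) (n := I k) f
  rwa [hf] at this

theorem remaining_map (f : ℂ → ℂ) (t : Fin N → List ℂ) (p : Fin N) (I : Fin N → ℕ) :
    remaining (fun k => (t k).map f) p I = fun k => (remaining t p I k).map f := by
  funext k
  unfold remaining
  split_ifs
  · rw [List.eraseIdx_map]
  · rfl

theorem choices_map (f : ℂ → ℂ) (t : Fin N → List ℂ) (p : Fin N) :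
    choices (fun k => (t k).map f) p = choices t p := by
  simp [choices]

theorem colorOr_map (f : ℂ → ℂ) (t : Fin N → List ℂ) (k : ℕ) :
    colorOr (fun k => (t k).map f) k = (colorOr t k).map f := by
  unfold colorOr
  split_ifs <;> rfl

theorem cons_inv (l : List ℂ) (t : Fin N → List ℂ) :
    (fun k => ((Fin.cons l t : Fin (N + 1) → List ℂ) k).map fun x => x⁻¹) =
      (Fin.cons (l.map fun x => x⁻¹) fun k => (t k).map fun x => x⁻¹ :
        Fin (N + 1) → List ℂ) :=
  funext fun k => Fin.cases rfl (fun _ => rfl) k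

/-- The factor of the recursion coefficient which depends on the parameters of the dual Bethe
vector only. -/
noncomputable def dualCoeff (q : ℂ) (s : Fin (N + 1) → List ℂ) (p : Fin (N + 1))
    (I : Fin (N + 1) → ℕ) : ℂ :=
  (fProd q (colorOr s ((p : ℕ) + 1)) [chosen s I p])⁻¹ *
    ∏ ν : Fin N with ν.castSucc < p, gR q (chosen s I ν.succ) (chosen s I ν.castSucc) *
      fProd q (remaining s p I ν.succ) [chosen s I ν.succ] /
        fProd q (s ν.succ) [chosen s I ν.castSucc]

/-- The coefficient separates into a part from the dual recursion and a part from the contraction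
with a row; they are linked only through `s^1_I`, the parameter of the first-column entry. -/
theorem recCoeff_eq (s t : Fin (N + 1) → List ℂ) (p : Fin (N + 1)) (I J : Fin (N + 1) → ℕ) :
    recCoeff q s t p I J = dualCoeff q s p I *
      (fProd q (remaining t p J 0) [chosen s I 0] * fcCoeff q (chosen s I 0) [] t p J) := by
  have h : fcCoeff q (chosen s I 0) [] t p J = gL q (chosen t J 0) (chosen s I 0) *
      fProd q [chosen t J 0] (remaining t p J 0) * ∏ ν : Fin N with ν.castSucc < p,
        gL q (chosen t J ν.succ) (chosen t J ν.castSucc) *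
          fProd q [chosen t J ν.succ] (remaining t p J ν.succ) /
            fProd q [chosen t J ν.succ] (t ν.castSucc) := by
    rw [fcCoeff, Finset.prod_filter, Fin.prod_univ_succ, Finset.prod_filter,
      if_pos (Fin.zero_le p), remaining, if_pos (Fin.zero_le p)]
    congr 1
    · rw [Fin.castSucc_zero, Fin.cons_zero, Fin.cons_zero, fProd_nil_right, div_one]
    · refine Finset.prod_congr rfl fun ν _ => ?_
      by_cases h : ν.castSucc < p
      · have h' : ν.succ ≤ p := Fin.castSucc_lt_iff_succ_le.mp h
        rw [if_pos h, if_pos h', remaining, if_pos h', ← Fin.succ_castSucc, Fin.cons_succ,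
          Fin.cons_succ]
      · rw [if_neg h, if_neg fun h' => h (Fin.castSucc_lt_iff_succ_le.mpr h')]
  rw [recCoeff, h, dualCoeff]
  have : ∀ ν : Fin N, gR q (chosen s I ν.succ) (chosen s I ν.castSucc) *
      gL q (chosen t J ν.succ) (chosen t J ν.castSucc) *
      fProd q (remaining s p I ν.succ) [chosen s I ν.succ] *
      fProd q [chosen t J ν.succ] (remaining t p J ν.succ) /
    (fProd q (s ν.succ) [chosen s I ν.castSucc] * fProd q [chosen t J ν.succ] (t ν.castSucc)) =
    (gR q (chosen s I ν.succ) (chosen s I ν.castSucc) *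
      fProd q (remaining s p I ν.succ) [chosen s I ν.succ] /
        fProd q (s ν.succ) [chosen s I ν.castSucc]) *
    (gL q (chosen t J ν.succ) (chosen t J ν.castSucc) *
          fProd q [chosen t J ν.succ] (remaining t p J ν.succ) /
            fProd q [chosen t J ν.succ] (t ν.castSucc)) := fun ν => by
    rw [div_mul_div_comm]
    congr 1
    ring
  simp only [this, Finset.prod_mul_distrib]
  ring

theorem dualCoeff_zero (l : List ℂ) (s : Fin N → List ℂ) (i : ℕ) (I : Fin N → ℕ) :
    dualCoeff q (Fin.cons l s : Fin (N + 1) → List ℂ) 0 (Fin.cons i I) =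
      (fProd q (colorOr s 0) [l.getD i 0])⁻¹ := by
  simp [dualCoeff, colorOr_succ, chosen_cons]

theorem dualCoeff_cons (l : List ℂ) (s : Fin (N + 1) → List ℂ) (p : Fin (N + 1)) (i : ℕ)
    (I : Fin (N + 1) → ℕ) :
    dualCoeff q (Fin.cons l s : Fin (N + 1 + 1) → List ℂ) p.succ (Fin.cons i I) =
      gR q (chosen s I 0) (l.getD i 0) * fProd q (remaining s p I 0) [chosen s I 0] /
        fProd q (s 0) [l.getD i 0] * dualCoeff q s p I := by
  rw [dualCoeff, Finset.prod_filter, Fin.prod_univ_succ, dualCoeff, Finset.prod_filter,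
    Fin.val_succ, colorOr_succ, chosen_cons, remaining_cons_succ]
  simp only [Fin.cons_succ, Fin.castSucc_zero, Fin.succ_pos, if_true, Fin.cons_zero,
    ← Fin.succ_castSucc, Fin.succ_lt_succ_iff]
  ring

/-- The dual coefficients are those of `bv_site_color` for `q⁻¹` and inverse parameters; this
inversion fixes `f` and turns `gL` into `gR`. -/
theorem dualCoeff_succ : ∀ {N : ℕ} (l : List ℂ) (s : Fin N → List ℂ) (p : Fin N)
    (i : ℕ) (I : Fin N → ℕ) (_ : i < l.length) (_ : ∀ x ∈ l, x ≠ 0) (_ : ∀ k, ∀ x ∈ s k, x ≠ 0)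
    (_ : I ∈ choices s p),
    dualCoeff q (Fin.cons l s : Fin (N + 1) → List ℂ) p.succ (Fin.cons i I) =
      (fProd q (colorOr s 0) [l.getD i 0])⁻¹ *
        osCoeff q⁻¹ (l.getD i 0)⁻¹ (fun k => (s k).map fun x => x⁻¹) p I
  | 0, _, _, p, _, _, _, _, _, _ => p.elim0
  | N + 1, l, s, p, i, I, hi, hl, hs, hI => by
    have hlt := lt_length_of_mem_choices hI (Fin.zero_le p)
    rw [dualCoeff_cons, colorOr_zero, remaining, if_pos (Fin.zero_le p)]
    obtain ⟨l', s, rfl⟩ : ∃ l t', s = Fin.cons l t' :=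
      ⟨s 0, Fin.tail s, (Fin.cons_self_tail s).symm⟩
    obtain ⟨i', I, rfl⟩ : ∃ i I', I = Fin.cons i I' :=
      ⟨I 0, Fin.tail I, (Fin.cons_self_tail I).symm⟩
    have h0 : l.getD i 0 ≠ 0 := hl _ (getD_mem hi)
    have h1 : l'.getD i' 0 ≠ 0 := hs 0 _ (getD_mem hlt)
    have h2 : ∀ x ∈ l'.eraseIdx i', x ≠ 0 := fun x hx => hs 0 x (List.mem_of_mem_eraseIdx hx)
    have h3 : (l'.map fun x => x⁻¹).getD i' 0 = (l'.getD i' 0)⁻¹ := by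
      have := List.getD_map l' (0 : ℂ) (n := i') fun x => x⁻¹
      rwa [inv_zero] at this
    have h4 : fProd q⁻¹ ((l'.map fun x => x⁻¹).eraseIdx i') [(l'.getD i' 0)⁻¹] =
        fProd q (l'.eraseIdx i') [l'.getD i' 0] := by
      rw [List.eraseIdx_map, ← fProd_inv h2 (vs := [l'.getD i' 0]) (by simpa using h1)]
      rfl
    have h5 : fProd q⁻¹ (colorOr (fun k => (s k).map fun x => x⁻¹) 0) [(l'.getD i' 0)⁻¹] =
        fProd q (colorOr s 0) [l'.getD i' 0] := by
      rw [colorOr_map, ← fProd_inv (us := colorOr s 0) (fun x hx => ?_) (vs := [l'.getD i' 0])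
        (by simpa using h1)]
      · rfl
      · obtain ⟨hk, hx⟩ := mem_colorOr hx
        exact hs (Fin.succ ⟨0, hk⟩) x hx
    rw [cons_inv, chosen_cons, Fin.cons_zero, Fin.cons_zero, Fin.cons_zero]
    obtain rfl | ⟨p, rfl⟩ := Fin.eq_zero_or_eq_succ p
    · rw [dualCoeff_zero, osCoeff_zero, h3, h4, h5, gL_inv h1 h0]
      ring
    · have hI' : I ∈ choices s p := by
        refine Fintype.mem_piFinset.mpr fun k => ?_
        simpa using Fintype.mem_piFinset.mp hI k.succ
      rw [dualCoeff_succ l' s p i' I hlt (hs 0) (fun k => hs k.succ) hI', osCoeff_succ, h3, h4, h5,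
        gL_inv h1 h0]
      ring

end Coefficients

/-! ## The recursion for generic parameters -/

section Recursion

variable {q : ℂ} {N m : ℕ}

theorem coeff_prod_lam_mul {κ : Type*} (s : Finset κ) (j : κ → Fin m) (y : κ → ℂ) (x : LamRing m)
    (e : (Fin m × ℂ) →₀ ℤ) :
    ((∏ ν ∈ s, lam (j ν) (y ν)) * x).coeff e = x.coeff (e - ∑ ν ∈ s, Finsupp.single (j ν, y ν) 1) := by
  classical
  induction s using Finset.induction_on generalizing e with
  | empty => simp
  | insert a s ha ih =>
    rw [Finset.prod_insert ha, Finset.sum_insert ha, mul_assoc, lam_mul_coeff, ih, sub_sub]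

theorem sum_remaining {A : Type*} [AddCommMonoid A] (F : Fin N → ℂ → A) {t : Fin N → List ℂ}
    {p : Fin N} {J : Fin N → ℕ} (hJ : J ∈ choices t p) :
    ∑ k, ((t k).map (F k)).sum = ∑ ν with ν ≤ p, F ν (chosen t J ν) +
      ∑ k, ((remaining t p J k).map (F k)).sum := by
  rw [Finset.sum_filter, ← Finset.sum_add_distrib]
  refine Finset.sum_congr rfl fun k _ => ?_
  unfold remaining
  split_ifs with h
  · rw [((perm_getD_cons_eraseIdx (lt_length_of_mem_choices hJ h)).map (F k)).sum_eq,
      List.map_cons, List.sum_cons]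
    rfl
  · rw [zero_add]

/-- The exponent of the monomial `∏ₖ λₖ(s̄ᵏ) λₖ₊₁(t̄ᵏ)`. -/
noncomputable def omegaExp (ι : Fin (N + 1) → Fin m) (s t : Fin N → List ℂ) : (Fin m × ℂ) →₀ ℤ :=
  ∑ k, ((s k).map fun x => Finsupp.single (ι k.castSucc, x) (1 : ℤ)).sum +
    ∑ k, ((t k).map fun x => Finsupp.single (ι k.succ, x) (1 : ℤ)).sum

theorem omegaExp_remaining (ι : Fin (N + 1) → Fin m) {s t : Fin N → List ℂ} {p : Fin N}
    {I J : Fin N → ℕ} (hI : I ∈ choices s p) (hJ : J ∈ choices t p) :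
    omegaExp ι s t - ∑ ν with ν ≤ p, Finsupp.single (ι ν.castSucc, chosen s I ν) 1 -
      ∑ ν with ν ≤ p, Finsupp.single (ι ν.succ, chosen t J ν) 1 =
        omegaExp ι (remaining s p I) (remaining t p J) := by
  rw [omegaExp, sum_remaining _ hI, sum_remaining _ hJ, omegaExp]
  abel

theorem sum_map_single_eq_zero {A B : Type*} (l : List A) (f : A → B) {x : B}
    (h : ∀ a ∈ l, f a ≠ x) : (l.map fun a => Finsupp.single (f a) (1 : ℤ)).sum x = 0 := by
  induction l with
  | nil => simp
  | cons a l ih =>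
    rw [List.map_cons, List.sum_cons, Finsupp.add_apply, ih fun a ha => h a (by simp [ha]),
      Finsupp.single_eq_of_ne (h a (by simp)).symm, add_zero]

/-- The target monomial contains the first eigenvalue only at points of `s^1`; this excludes the
terms with `λ_0` at a point of `t^1`. -/
theorem omegaExp_apply_zero {ι : Fin (N + 1 + 1) → Fin m} (hι : Function.Injective ι)
    {s : Fin (N + 1) → List ℂ} (t : Fin (N + 1) → List ℂ) {x : ℂ} (hx : x ∉ s 0) :
    omegaExp ι s t (ι 0, x) = 0 := by
  rw [omegaExp, Finsupp.add_apply, Finsupp.finsetSum_apply, Finsupp.finsetSum_apply,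
    Finset.sum_eq_zero, Finset.sum_eq_zero, add_zero]
  · intro k _
    refine sum_map_single_eq_zero _ _ fun a _ h => ?_
    exact Fin.succ_ne_zero k (hι (congrArg Prod.fst h))
  · intro k _
    refine sum_map_single_eq_zero _ _ fun a ha h => ?_
    have h1 := hι (congrArg Prod.fst h)
    have h2 := congrArg Prod.snd h
    simp only at h1 h2
    have : k = 0 := by
      rw [Fin.ext_iff] at h1 ⊢
      simpa using h1
    subst this
    exact hx (h2 ▸ ha)

variable {H : Type*} [AddCommGroup H] [Module (LamRing m) H] [Module ℂ H]
  [IsScalarTower ℂ (LamRing m) H]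

/-- The letters of two collections are pairwise distinct and nonzero. -/
structure Letters (s t : Fin N → List ℂ) : Prop where
  left : Distinct {0}ᶜ s
  right : Distinct {0}ᶜ t
  disj : ∀ k l, ∀ x ∈ s k, x ∉ t l

theorem exists_lift (P : ℂ → Prop) {t : Fin N → List ℂ} (ht : ∀ k, ∀ x ∈ t k, P x) :
    ∃ t' : Fin N → List {x : ℂ // P x}, ∀ k, (t' k).map Subtype.val = t k := by
  choose t' h using fun k => CanLift.prf (β := List {x : ℂ // P x}) (t k) (ht k)
  exact ⟨t', h⟩

/-- The machinery of families with a one-point parameter space and all functions allowed as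
coefficients: only the nonnegativity of exponents is extracted. -/
theorem IsFreeModel.nonneg_coeff {ι : Fin (N + 1) → Fin m}
    {T : Fin (N + 1) → Fin (N + 1) → ℂ → Module.End (LamRing m) H} {vac : H}
    {bra : Module.Dual (LamRing m) H} (hT : IsFreeModel q ι T vac bra) {s t : Fin N → List ℂ}
    (h : Letters s t) {z : ℂ} (hz : z ≠ 0) (hzs : ∀ k, z ∉ s k) (hzt : ∀ k, z ∉ t k)
    (i j : Fin (N + 1)) {e : (Fin m × ℂ) →₀ ℤ}
    (he : (dualBv q N T bra s (T i j z (bv q N T vac t))).coeff e ≠ 0) : 0 ≤ e := by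
  obtain ⟨s', hs'⟩ := exists_lift (· ≠ 0) h.left.mem
  obtain ⟨t', ht'⟩ := exists_lift (· ≠ 0) h.right.mem
  have hmem : ∀ {r : Fin N → List ℂ} {r' : Fin N → List {x : ℂ // x ≠ 0}},
      (∀ k, (r' k).map Subtype.val = r k) → ∀ k a, a ∈ r' k → a.1 ∈ r k := fun hr k a ha => by
    rw [← hr k]; exact List.mem_map_of_mem ha
  have key : ∀ {r : Fin N → List ℂ} {r' : Fin N → List {x : ℂ // x ≠ 0}},
      (∀ k, (r' k).map Subtype.val = r k) → Distinct {0}ᶜ r → (∀ k, (r' k).Nodup) ∧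
      ∀ k l, k ≠ l → ∀ a ∈ r' k, a ∉ r' l := fun hr hd =>
    ⟨fun k => List.Nodup.of_map _ (by rw [hr k]; exact hd.nodup k), fun k l hkl a ha ha' =>
      hd.disj k l hkl a.1 (hmem hr k a ha) (hmem hr l a ha')⟩
  have hu : ∀ _ : Unit, Function.Injective (Subtype.val : {x : ℂ // x ≠ 0} → ℂ) :=
    fun _ => Subtype.val_injective
  have hu0 : ∀ (_ : Unit) (a : {x : ℂ // x ≠ 0}), a.1 ≠ 0 := fun _ a => a.2
  have h1 := hT.niceVec_bv (G := ⊤) (u := fun _ : Unit => Subtype.val) hu hu0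
    (fun _ _ _ _ _ _ => trivial) (key ht' h.right).1 (key ht' h.right).2 fun _ => trivial
  have h2 := hT.niceCovec_dualBv (G := ⊤) (u := fun _ : Unit => Subtype.val) hu hu0
    (fun _ _ _ _ _ _ => trivial) (key hs' h.left).1 (key hs' h.left).2 fun _ => trivial
  have h3 := h2 _ _ ?_ (h1.apply (a := ⟨z, hz⟩) (fun ⟨k, hk⟩ => hzt k (hmem ht' k _ hk)) i j)
  · have e1 : (fun k => (s' k).map Subtype.val) = s := funext hs'
    have e2 : (fun k => (t' k).map Subtype.val) = t := funext ht'
    simp only [e1, e2] at h3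
    exact h3.nonneg () e he
  · rw [Set.disjoint_left]
    rintro a (rfl | ⟨k, hk⟩) ⟨l, hl⟩
    · exact hzs l (hmem hs' l _ hl)
    · exact h.disj l k a.1 (hmem hs' l _ hl) (hmem ht' k _ hk)

variable {ι : Fin (N + 1 + 1) → Fin m}
    {T : Fin (N + 1 + 1) → Fin (N + 1 + 1) → ℂ → Module.End (LamRing m) H} {vac : H}
    {bra : Module.Dual (LamRing m) H}

theorem Letters.mono {s t s' t' : Fin N → List ℂ} (h : Letters s t)
    (hs : ∀ k, (s' k).Sublist (s k)) (ht : ∀ k, (t' k).Sublist (t k)) : Letters s' t' :=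
  ⟨h.left.sublist hs, h.right.sublist ht, fun k l x hx hx' =>
    h.disj k l x ((hs k).subset hx) ((ht l).subset hx')⟩

/-- The terms of the action of the first column which contribute to the highest coefficient. -/
theorem IsFreeModel.action_coeff (hq : q ≠ 0) (hT : IsFreeModel q ι T vac bra)
    {s t : Fin (N + 1) → List ℂ} (h : Letters s t) (hf : Nondeg q {x | ∃ k, x ∈ t k})
    {z : ℂ} (hz : z ≠ 0) (hzs : ∀ k, z ∉ s k) (hzt : ∀ k, z ∉ t k) (p : Fin (N + 1))
    {e : (Fin m × ℂ) →₀ ℤ} (he : ∀ x ∈ t 0, e (ι 0, x) ≤ 0) :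
    (dualBv q (N + 1) T bra s (T p.succ 0 z (bv q (N + 1) T vac t))).coeff e =
      ∑ J ∈ choices t p, (fProd q (remaining t p J 0) [z] * fcCoeff q z [] t p J) *
        (lam (ι 0) z * (ellProd (fun k => lam (ι k.succ)) t p J *
          dualBv q (N + 1) T bra s (bv q (N + 1) T vac (remaining t p J)))).coeff e := by
  have ht : Distinct {x | ∃ k, x ∈ t k} t := ⟨h.right.nodup, fun k x hx => ⟨k, hx⟩, h.right.disj⟩
  have hS : {x | ∃ k, x ∈ t k} ⊆ ({0}ᶜ : Set ℂ) := fun x ⟨k, hx⟩ => h.right.mem k x hx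
  have hzt' : ∀ k, ∀ x ∈ t k, x ≠ z := fun k x hx h' => hzt k (h' ▸ hx)
  have h1 := theta_bv_color hq hT.vacModel hS hf ht hz hzt' p
  -- Component 0 of the extended Bethe vector is the original one, so the wanted action is the first
  -- summand of the contraction.
  rw [theta_apply, Fin.sum_univ_succ, bv_site_zero hT.vacModel hS z ht] at h1
  have h2 := congrArg (fun y => (dualBv q (N + 1) T bra s y).coeff e) h1
  -- The other components contain `λ_0` at an element of `t^1`. After division by it, the exponent
  -- required of the matrix element is negative there, so its coefficient vanishes.
  have h3 : ∀ k : Fin (N + 1), (dualBv q (N + 1) T bra s (T p.succ k.succ z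
      (bv q (N + 1) (site q T z) (Pi.single 0 vac) t k.succ))).coeff e = 0 := by
    intro k
    rw [bv_site_color hq hT.vacModel hS hf ht hzt' k]
    simp only [map_sum, LinearMap.map_smul_of_tower, AddMonoidAlgebra.coeff_sum,
      Finsupp.finsetSum_apply, AddMonoidAlgebra.coeff_smul, Finsupp.smul_apply, smul_eq_mul]
    refine Finset.sum_eq_zero fun I hI => ?_
    rw [ellProd, coeff_prod_lam_mul, mul_eq_zero]
    refine or_iff_not_imp_right.mpr fun h4 => absurd (hT.nonneg_coeff
      (h.mono (fun _ => .refl _) (remaining_sublist t k I)) hz hzs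
      (fun l hl => hzt l ((remaining_sublist t k I l).subset hl)) _ _ h4) fun h5 => ?_
    have h6 := h5 (ι 0, chosen t I 0)
    have h7 := he (chosen t I 0) (getD_mem (lt_length_of_mem_choices hI (Fin.zero_le k)))
    rw [Finsupp.coe_zero, Pi.zero_apply, Finsupp.sub_apply, Finsupp.finsetSum_apply] at h6
    have h8 : (1 : ℤ) ≤ ∑ ν with ν ≤ k,
        Finsupp.single (ι ν.castSucc, chosen t I ν) 1 (ι 0, chosen t I 0) := by
      refine le_trans ?_ (Finset.single_le_sum (fun ν _ => ?_)
        (Finset.mem_filter.mpr ⟨Finset.mem_univ 0, Fin.zero_le k⟩))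
      · rw [Fin.castSucc_zero, Finsupp.single_eq_same]
      · exact Finsupp.single_nonneg.mpr zero_le_one _
    omega
  simp only [map_add, map_sum, AddMonoidAlgebra.coeff_add, AddMonoidAlgebra.coeff_sum,
    Finsupp.add_apply, Finsupp.finsetSum_apply, h3, Finset.sum_const_zero, add_zero] at h2
  rw [h2]
  simp only [Finset.smul_sum, map_sum, AddMonoidAlgebra.coeff_sum, Finsupp.finsetSum_apply]
  refine Finset.sum_congr rfl fun J _ => ?_
  rw [smul_comm, LinearMap.map_smul_of_tower, LinearMap.map_smul, LinearMap.map_smul,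
    AddMonoidAlgebra.coeff_smul, Finsupp.smul_apply, smul_eq_mul, smul_eq_mul, smul_eq_mul]

end Recursion

/-! ### The dual recursion and the highest coefficient for nondegenerate parameters -/

section GenericRecursion

variable {q : ℂ} {N m : ℕ}

theorem sum_filter_choices_zero {M : Type*} [AddCommMonoid M] {l : List ℂ} (s : Fin N → List ℂ)
    {i : ℕ} (hi : i < l.length) (F : (Fin (N + 1) → ℕ) → M) :
    ∑ I ∈ choices (Fin.cons l s : Fin (N + 1) → List ℂ) 0 with I 0 = i, F I = F (Fin.cons i 0) := by
  rw [Finset.sum_filter, sum_choices_zero]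
  simp [hi]

theorem sum_filter_choices_succ {M : Type*} [AddCommMonoid M] {l : List ℂ} (s : Fin N → List ℂ)
    (p : Fin N) {i : ℕ} (hi : i < l.length) (F : (Fin (N + 1) → ℕ) → M) :
    ∑ I ∈ choices (Fin.cons l s : Fin (N + 1) → List ℂ) p.succ with I 0 = i, F I =
      ∑ I ∈ choices s p, F (Fin.cons i I) := by
  rw [Finset.sum_filter, sum_choices_succ, Finset.sum_eq_single i]
  · simp
  · intro j _ hj
    simp [hj]
  · intro h
    exact absurd (Finset.mem_range.mpr hi) h

theorem Nondeg.inv {S : Set ℂ} (hf : Nondeg q S) (h0 : ∀ x ∈ S, x ≠ 0) :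
    Nondeg q⁻¹ ((fun x => x⁻¹) '' S) := by
  rintro _ ⟨a, ha, rfl⟩ _ ⟨b, hb, rfl⟩ hab
  rw [fFun_inv (h0 a ha) (h0 b hb)]
  exact hf a ha b hb fun h => hab (h ▸ rfl)

theorem Distinct.inv {S : Set ℂ} {s : Fin N → List ℂ} (hs : Distinct S s) :
    Distinct ((fun x => x⁻¹) '' S) fun k => (s k).map fun x => x⁻¹ where
  nodup k := (hs.nodup k).map inv_injective
  mem k x hx := by
    obtain ⟨y, hy, rfl⟩ := List.mem_map.mp hx
    exact ⟨y, hs.mem k y hy, rfl⟩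
  disj k l hkl x hx hx' := by
    obtain ⟨y, hy, rfl⟩ := List.mem_map.mp hx
    obtain ⟨y', hy', h⟩ := List.mem_map.mp hx'
    exact hs.disj k l hkl y hy (inv_injective h ▸ hy')

variable {H : Type*} [AddCommGroup H] [Module (LamRing m) H] [Module ℂ H]
  [IsScalarTower ℂ (LamRing m) H] {ι : Fin (N + 1 + 1) → Fin m}
    {T : Fin (N + 1 + 1) → Fin (N + 1 + 1) → ℂ → Module.End (LamRing m) H} {vac : H}
    {bra : Module.Dual (LamRing m) H}

theorem fProd_colorOr_inv {s : Fin N → List ℂ} (hs : ∀ k, ∀ x ∈ s k, x ≠ 0) {z : ℂ} (hz : z ≠ 0) :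
    fProd q⁻¹ (colorOr (fun k => (s k).map fun x => x⁻¹) 0) [z⁻¹] = fProd q (colorOr s 0) [z] := by
  rw [colorOr_map, ← fProd_inv (us := colorOr s 0) (fun x hx => ?_) (vs := [z]) (by simpa using hz)]
  · rfl
  · obtain ⟨hk, hx⟩ := mem_colorOr hx
    exact hs _ x hx

theorem dualBv_cons (l : List ℂ) (s : Fin N → List ℂ) :
    dualBv q (N + 1) T bra (Fin.cons l s : Fin (N + 1) → List ℂ) =
      bv q⁻¹ (N + 1) (dualT T) bra (Fin.cons (l.map fun x => x⁻¹)
        fun k => (s k).map fun x => x⁻¹ : Fin (N + 1) → List ℂ) := by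
  rw [dualBv, cons_inv]

theorem ellProd_inv (j : Fin N → Fin m) (s : Fin N → List ℂ) (p : Fin N) (I : Fin N → ℕ) :
    ellProd (fun k u => (lam (j k) u⁻¹ : LamRing m)) (fun k => (s k).map fun x => x⁻¹) p I =
      ellProd (fun k => lam (j k)) s p I := by
  unfold ellProd
  refine Finset.prod_congr rfl fun ν _ => ?_
  rw [chosen_map _ inv_zero]
  simp only [inv_inv]

theorem IsFreeModel.dualBv_perm (hq : q ≠ 0) (hT : IsFreeModel q ι T vac bra)
    {s s' : Fin (N + 1) → List ℂ} (h : Distinct {0}ᶜ s) (hf : Nondeg q {x | ∃ k, x ∈ s k})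
    (hp : ∀ k, (s k).Perm (s' k)) :
    dualBv q (N + 1) T bra s = dualBv q (N + 1) T bra s' := by
  have h0 : ∀ x ∈ {x | ∃ k, x ∈ s k}, x ≠ 0 := fun x ⟨k, hx⟩ => h.mem k x hx
  have hs : Distinct {x | ∃ k, x ∈ s k} s := ⟨h.nodup, fun k x hx => ⟨k, hx⟩, h.disj⟩
  refine bv_perm (inv_ne_zero hq) hT.dualVacModel ?_ (hf.inv h0) hs.inv fun k => (hp k).map _
  rintro _ ⟨x, hx, rfl⟩
  exact inv_ne_zero (h0 x hx)

theorem IsFreeModel.dualBv_cons_cons (hq : q ≠ 0) (hT : IsFreeModel q ι T vac bra) {z : ℂ}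
    {l : List ℂ} {s : Fin N → List ℂ}
    (h : Distinct {0}ᶜ (Fin.cons (z :: l) s : Fin (N + 1) → List ℂ))
    (hf : Nondeg q {x | ∃ k, x ∈ (Fin.cons (z :: l) s : Fin (N + 1) → List ℂ) k}) :
    dualBv q (N + 1) T bra (Fin.cons (z :: l) s : Fin (N + 1) → List ℂ) =
      (fProd q (colorOr s 0) [z])⁻¹ •
        (dualT T 0 1 z⁻¹ (dualBv q (N + 1) T bra (Fin.cons l s : Fin (N + 1) → List ℂ)) +
        ∑ p : Fin N, ∑ I ∈ choices s p,
          osCoeff q⁻¹ z⁻¹ (fun k => (s k).map fun x => x⁻¹) p I •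
          ellProd (fun k => (lam (ι k.succ.castSucc) : ℂ → LamRing m)) s p I •
            dualT T 0 p.succ.succ z⁻¹ (dualBv q (N + 1) T bra
              (Fin.cons l (remaining s p I) : Fin (N + 1) → List ℂ))) := by
  have h0 : ∀ x ∈ {x | ∃ k, x ∈ (Fin.cons (z :: l) s : Fin (N + 1) → List ℂ) k}, x ≠ 0 :=
    fun x ⟨k, hx⟩ => h.mem k x hx
  have hs : Distinct {x | ∃ k, x ∈ (Fin.cons (z :: l) s : Fin (N + 1) → List ℂ) k}
      (Fin.cons (z :: l) s : Fin (N + 1) → List ℂ) := ⟨h.nodup, fun k x hx => ⟨k, hx⟩, h.disj⟩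
  have hS : (fun x => x⁻¹) '' {x | ∃ k, x ∈ (Fin.cons (z :: l) s : Fin (N + 1) → List ℂ) k} ⊆
      ({0}ᶜ : Set ℂ) := by
    rintro _ ⟨x, hx, rfl⟩
    exact inv_ne_zero (h0 x hx)
  have h1 := hs.inv
  rw [cons_inv, List.map_cons] at h1
  have h2 := bv_recursion (inv_ne_zero hq) hT.dualVacModel hS (hf.inv h0) h1
  rw [fProd_colorOr_inv (s := s) (fun k => h.mem k.succ) (h.mem 0 z List.mem_cons_self)] at h2
  rw [dualBv_cons, List.map_cons, h2, ← dualBv_cons]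
  refine congrArg _ (congrArg _ (Finset.sum_congr rfl fun p _ => ?_))
  rw [choices_map]
  refine Finset.sum_congr rfl fun I _ => ?_
  rw [remaining_map, ← dualBv_cons, ellProd_inv]

/-- The recursion for the dual Bethe vectors. -/
theorem IsFreeModel.dualBv_recursion (hq : q ≠ 0) (hT : IsFreeModel q ι T vac bra)
    {s : Fin (N + 1) → List ℂ} (h : Distinct {0}ᶜ s) (hf : Nondeg q {x | ∃ k, x ∈ s k}) {i : ℕ}
    (hi : i < (s 0).length) (y : H) :
    lam (ι 0) ((s 0).getD i 0) * dualBv q (N + 1) T bra s y =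
      ∑ p, ∑ I ∈ choices s p with I 0 = i, dualCoeff q s p I •
        (ellProd (fun k => lam (ι k.castSucc)) s p I *
          dualBv q (N + 1) T bra (remaining s p I) (T p.succ 0 ((s 0).getD i 0) y)) := by
  obtain ⟨l, s, rfl⟩ : ∃ l t', s = Fin.cons l t' := ⟨s 0, Fin.tail s, (Fin.cons_self_tail s).symm⟩
  change i < l.length at hi
  rw [Fin.cons_zero]
  -- By symmetry any element of the first color may be brought to the front. The factor `λ_0` on the
  -- left of the claim supplies the first factor of each `ellProd` on the right.
  have hp : ∀ k, ((Fin.cons l s : Fin (N + 1) → List ℂ) k).Perm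
      ((Fin.cons (l.getD i 0 :: l.eraseIdx i) s : Fin (N + 1) → List ℂ) k) := fun k =>
    Fin.cases (perm_getD_cons_eraseIdx hi) (fun _ => .refl _) k
  have hset : {x | ∃ k, x ∈ (Fin.cons l s : Fin (N + 1) → List ℂ) k} =
      {x | ∃ k, x ∈ (Fin.cons (l.getD i 0 :: l.eraseIdx i) s : Fin (N + 1) → List ℂ) k} := by
    ext x
    exact exists_congr fun k => (hp k).mem_iff
  rw [hT.dualBv_perm hq h hf hp, hT.dualBv_cons_cons hq (h.perm hp) (hset ▸ hf), Fin.sum_univ_succ,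
    sum_filter_choices_zero s hi, dualCoeff_zero, ellProd_zero,
    remaining_cons_zero, LinearMap.smul_apply, LinearMap.add_apply, mul_smul_comm, mul_add,
    smul_add, Fin.castSucc_zero, dualT_apply, inv_inv, Fin.succ_zero_eq_one]
  congr 1
  rw [LinearMap.sum_apply, Finset.mul_sum, Finset.smul_sum]
  refine Finset.sum_congr rfl fun p _ => ?_
  rw [sum_filter_choices_succ s p hi, LinearMap.sum_apply, Finset.mul_sum, Finset.smul_sum]
  refine Finset.sum_congr rfl fun I hI => ?_
  rw [dualCoeff_succ l s p i I hi (h.mem 0) (fun k => h.mem k.succ) hI, ellProd_succ,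
    remaining_cons_succ, LinearMap.smul_apply, LinearMap.smul_apply, dualT_apply, inv_inv,
    mul_smul_comm, smul_smul, smul_eq_mul, Fin.castSucc_zero, mul_assoc (lam _ _)]

/-- The highest coefficient of the scalar product of the unnormalized Bethe vectors. -/
noncomputable def highCoeff (q : ℂ) (N : ℕ) (ι : Fin (N + 1) → Fin m)
    (T : Fin (N + 1) → Fin (N + 1) → ℂ → Module.End (LamRing m) H) (vac : H)
    (bra : Module.Dual (LamRing m) H) (s t : Fin N → List ℂ) : ℂ :=
  (dualBv q N T bra s (bv q N T vac t)).coeff (omegaExp ι s t)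

/-- The dual recursion is followed by the action of the first column. The eigenvalues collected in
the two steps are those at the chosen elements, so dividing the target monomial by them leaves the
target monomial of the remaining collections (`omegaExp_remaining`). -/
theorem IsFreeModel.highCoeff_recursion_of_nondeg (hq : q ≠ 0) (hT : IsFreeModel q ι T vac bra)
    {s t : Fin (N + 1) → List ℂ} (h : Letters s t) (hs : Nondeg q {x | ∃ k, x ∈ s k})
    (ht : Nondeg q {x | ∃ k, x ∈ t k}) {i : ℕ} (hi : i < (s 0).length) :
    highCoeff q (N + 1) ι T vac bra s t =
      ∑ p : Fin (N + 1), ∑ I ∈ choices s p with I 0 = i, ∑ J ∈ choices t p,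
        recCoeff q s t p I J *
          highCoeff q (N + 1) ι T vac bra (remaining s p I) (remaining t p J) := by
  set z := (s 0).getD i 0 with hz
  have hzs : z ∈ s 0 := getD_mem hi
  -- The exponent is raised to account for the factor `λ_0(z)` in the dual recursion; the same
  -- factor reappears in the action of the first column.
  have h1 := congrArg (fun x => x.coeff (omegaExp ι s t + Finsupp.single (ι 0, z) 1))
    (hT.dualBv_recursion hq h.left hs hi (bv q (N + 1) T vac t))
  simp only [← hz, lam_mul_coeff, add_sub_cancel_right, AddMonoidAlgebra.coeff_sum,
    Finsupp.finsetSum_apply, AddMonoidAlgebra.coeff_smul, Finsupp.smul_apply, smul_eq_mul] at h1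
  rw [highCoeff, h1]
  refine Finset.sum_congr rfl fun p _ => Finset.sum_congr rfl fun I hI => ?_
  obtain ⟨hI, hIi⟩ := Finset.mem_filter.mp hI
  have hzI : z = chosen s I 0 := by rw [chosen, hIi, hz]
  have hzr : ∀ k, z ∉ remaining s p I k := by
    intro k hk
    by_cases hk0 : k = 0
    · subst hk0
      rw [remaining, if_pos (Fin.zero_le p), hIi] at hk
      exact getD_notMem_eraseIdx (h.left.nodup 0) hi hk
    · exact h.left.disj 0 k (Ne.symm hk0) z hzs ((remaining_sublist s p I k).subset hk)
  rw [ellProd, coeff_prod_lam_mul, hT.action_coeff hq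
    (h.mono (remaining_sublist s p I) fun _ => .refl _) ht (h.left.mem 0 z hzs) hzr
    (fun k => h.disj 0 k z hzs), Finset.mul_sum]
  · refine Finset.sum_congr rfl fun J hJ => ?_
    have he : omegaExp ι s t + Finsupp.single (ι 0, z) 1 -
        ∑ ν with ν ≤ p, Finsupp.single (ι ν.castSucc, chosen s I ν) 1 -
          Finsupp.single (ι 0, z) 1 -
          ∑ ν with ν ≤ p, Finsupp.single (ι ν.succ, chosen t J ν) 1 =
        omegaExp ι (remaining s p I) (remaining t p J) := by
      rw [← omegaExp_remaining ι hI hJ]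
      abel
    rw [recCoeff_eq, ← hzI, ellProd, lam_mul_coeff, coeff_prod_lam_mul, highCoeff, he]
    ring
  · intro x hx
    have hzx : z ≠ x := fun h' => h.disj 0 0 z hzs (h' ▸ hx)
    rw [Finsupp.sub_apply, Finsupp.add_apply, omegaExp_apply_zero hT.inj t
      fun h' => h.disj 0 0 x h' hx, Finsupp.single_eq_of_ne fun h' => hzx (congrArg Prod.snd h').symm,
      zero_add, zero_sub, Finsupp.finsetSum_apply, neg_nonpos]
    exact Finset.sum_nonneg fun ν _ => Finsupp.single_nonneg.mpr zero_le_one _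

end GenericRecursion

/-! ## Passage to the limit -/

section Limit

open Filter Topology

variable {q : ℂ} {N m : ℕ}

theorem finite_zeros (c₀ c₁ c₂ : ℂ) (h₁ : c₁ ≠ 0) {i j : ℕ} (hij : i ≠ j) :
    {e : ℂ | c₀ + c₁ * e ^ (i + 1) + c₂ * e ^ (j + 1) = 0}.Finite := by
  set P : Polynomial ℂ := .C c₀ + .C c₁ * .X ^ (i + 1) + .C c₂ * .X ^ (j + 1) with hP
  have h : P ≠ 0 := by
    intro h
    have h2 := congrArg (fun p => p.coeff (i + 1)) h
    simp [hP, Polynomial.coeff_X_pow, hij, h₁] at h2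
  refine (Polynomial.finite_setOfPred_isRoot h).subset fun e he => ?_
  simpa [hP] using he

/-- Each element is shifted by its own power of a small `e`. Distinct powers make every forbidden
coincidence a nonzero polynomial equation in `e`, so only finitely many `e` are bad. The label
`none` is the unperturbed limit; `v` fixes 0 because 0 is the default value in `chosen`. -/
theorem exists_perturbation (hq : q ≠ 0) (A : List ℂ) (hA : 0 ∉ A) :
    ∃ v : Option ℕ → ℂ → ℂ, (∀ x, v none x = x) ∧ (∀ ω, v ω 0 = 0) ∧
      (∀ x, Tendsto (fun n => v (some n) x) atTop (𝓝 x)) ∧ (∀ ω, Set.InjOn (v ω) {x | x ∈ A}) ∧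
      (∀ ω, ∀ x ∈ A, v ω x ≠ 0) ∧ ∀ n, Nondeg q (v (some n) '' {x | x ∈ A}) := by
  classical
  set w : ℂ → ℂ → ℂ := fun e x => x + if x ∈ A then e ^ (A.idxOf x + 1) else 0 with hw
  have hwA : ∀ e, ∀ x ∈ A, w e x = x + e ^ (A.idxOf x + 1) := fun e x hx => by simp [hw, hx]
  have hidx : ∀ a ∈ A, ∀ b ∈ A, a ≠ b → A.idxOf a ≠ A.idxOf b := fun a ha b _ hab h =>
    hab ((List.idxOf_inj ha).mp h)
  set B : Set ℂ := ⋃ a ∈ A, ⋃ b ∈ A, {e | w e a = 0} ∪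
    if a = b then ∅ else {e | w e a = w e b} ∪ {e | q * w e a - q⁻¹ * w e b = 0} with hB
  have hfin : B.Finite := by
    have hA' : {x | x ∈ A}.Finite := List.finite_toSet A
    refine hA'.biUnion fun a ha => hA'.biUnion fun b hb => .union ?_ ?_
    · refine (finite_zeros a 1 0 one_ne_zero (Nat.lt_succ_self (A.idxOf a)).ne).subset fun e he => ?_
      rw [Set.mem_ofPred_eq, hwA e a ha] at he
      simpa using he
    · split_ifs with hab
      · exact Set.finite_empty
      · refine .union ?_ ?_
        · refine (finite_zeros (a - b) 1 (-1) one_ne_zero (hidx a ha b hb hab)).subset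
            fun e he => ?_
          rw [Set.mem_ofPred_eq, hwA e a ha, hwA e b hb] at he
          rw [Set.mem_ofPred_eq]
          linear_combination he
        · refine (finite_zeros (q * a - q⁻¹ * b) q (-q⁻¹) hq (hidx a ha b hb hab)).subset
            fun e he => ?_
          rw [Set.mem_ofPred_eq, hwA e a ha, hwA e b hb] at he
          rw [Set.mem_ofPred_eq]
          linear_combination he
  obtain ⟨ε, hε, hlim⟩ := mem_closure_iff_seq_limit.mp (hfin.countable.dense_compl ℂ (0 : ℂ))
  have hgood : ∀ n, ∀ a ∈ A, ∀ b ∈ A, w (ε n) a ≠ 0 ∧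
      (a ≠ b → w (ε n) a ≠ w (ε n) b ∧ q * w (ε n) a - q⁻¹ * w (ε n) b ≠ 0) := by
    intro n a ha b hb
    have h1 : ε n ∉ B := hε n
    simp only [hB, Set.mem_iUnion, not_exists, Set.mem_union, not_or] at h1
    obtain ⟨h2, h3⟩ := h1 a ha b hb
    refine ⟨h2, fun hab => ?_⟩
    rw [if_neg hab, Set.mem_union, not_or] at h3
    exact h3
  have hw0 : ∀ x, w 0 x = x := fun x => by simp [hw]
  refine ⟨fun ω => Option.elim ω (w 0) fun n => w (ε n), hw0, ?_, ?_, ?_, ?_, ?_⟩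
  · rintro (_ | n) <;> simp [hw, hA]
  · intro x
    have : Continuous fun e => w e x := by
      by_cases hx : x ∈ A
      · simp only [hw, hx, if_true]; fun_prop
      · simp only [hw, hx, if_false]; fun_prop
    have h := (this.tendsto 0).comp hlim
    rwa [hw0] at h
  · rintro (_ | n) a ha b hb hab
    · exact (hw0 a).symm.trans (hab.trans (hw0 b))
    · by_contra h
      exact ((hgood n a ha b hb).2 h).1 hab
  · rintro (_ | n) a ha
    · exact fun h => hA (((hw0 a).symm.trans h) ▸ ha)
    · exact (hgood n a ha a ha).1
  · rintro n _ ⟨a, ha, rfl⟩ _ ⟨b, hb, rfl⟩ hab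
    obtain ⟨h1, h2⟩ := (hgood n a ha b hb).2 fun h => hab (by rw [h])
    exact div_ne_zero h2 (sub_ne_zero.mpr h1)

/-- The algebra of convergent sequences together with their limits. -/
def convAlg : Subalgebra ℂ (Option ℕ → ℂ) where
  carrier := {c | Tendsto (fun n => c (some n)) atTop (𝓝 (c none))}
  mul_mem' h h' := h.mul h'
  add_mem' h h' := h.add h'
  algebraMap_mem' _ := tendsto_const_nhds

theorem convAlg.mem_iff {c : Option ℕ → ℂ} :
    c ∈ convAlg ↔ Tendsto (fun n => c (some n)) atTop (𝓝 (c none)) := Iff.rfl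

theorem convAlg.inv_mem {c : Option ℕ → ℂ} (hc : c ∈ convAlg) (h : c none ≠ 0) :
    (fun ω => (c ω)⁻¹) ∈ convAlg := Tendsto.inv₀ hc h

theorem convAlg.eq {c c' : Option ℕ → ℂ} (hc : c ∈ convAlg) (hc' : c' ∈ convAlg)
    (h : ∀ n, c (some n) = c' (some n)) : c none = c' none := by
  rw [mem_iff] at hc hc'
  simp only [h] at hc
  exact tendsto_nhds_unique hc hc'

/-- The nonvanishing of the normalizing factors of the Bethe vectors. -/
def Admissible (q : ℂ) (t : Fin N → List ℂ) : Prop :=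
  ∀ k l : Fin N, (l : ℕ) = k + 1 → ∀ x ∈ t l, ∀ y ∈ t k, fFun q x y ≠ 0

theorem Admissible.sublist {t t' : Fin N → List ℂ} (h : Admissible q t)
    (ht : ∀ k, (t' k).Sublist (t k)) : Admissible q t' :=
  fun k l hkl x hx y hy => h k l hkl x ((ht l).subset hx) y ((ht k).subset hy)

theorem Admissible.fProd_ne_zero {t : Fin N → List ℂ} (h : Admissible q t) (k : ℕ) :
    fProd q (colorOr t (k + 1)) (colorOr t k) ≠ 0 := by
  refine _root_.fProd_ne_zero fun x hx y hy => ?_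
  obtain ⟨hl, hx⟩ := mem_colorOr hx
  obtain ⟨hk, hy⟩ := mem_colorOr hy
  exact h ⟨k, hk⟩ ⟨k + 1, hl⟩ rfl x hx y hy

section Functions

variable {v : Option ℕ → ℂ → ℂ} (h0 : ∀ x, v none x = x)
  (hv : ∀ x, Tendsto (fun n => v (some n) x) atTop (𝓝 x))

include h0 hv

theorem label_mem (x : ℂ) : (fun ω => v ω x) ∈ convAlg := by
  rw [convAlg.mem_iff, h0]
  exact hv x

theorem gFun_mem {x y : ℂ} (hxy : x ≠ y) : (fun ω => gFun q (v ω x) (v ω y)) ∈ convAlg := by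
  simp only [gFun, div_eq_mul_inv]
  refine mul_mem (convAlg.algebraMap_mem _) (convAlg.inv_mem
    (sub_mem (label_mem h0 hv x) (label_mem h0 hv y)) ?_)
  simpa [h0, sub_eq_zero] using hxy

theorem gL_mem {x y : ℂ} (hxy : x ≠ y) : (fun ω => gL q (v ω x) (v ω y)) ∈ convAlg :=
  mul_mem (label_mem h0 hv x) (gFun_mem h0 hv hxy)

theorem gR_mem {x y : ℂ} (hxy : x ≠ y) : (fun ω => gR q (v ω x) (v ω y)) ∈ convAlg :=
  mul_mem (label_mem h0 hv y) (gFun_mem h0 hv hxy)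

theorem fFun_mem_convAlg {x y : ℂ} (hxy : x ≠ y) :
    (fun ω => fFun q (v ω x) (v ω y)) ∈ convAlg := by
  simp only [fFun, div_eq_mul_inv]
  refine mul_mem (sub_mem (mul_mem (convAlg.algebraMap_mem q) (label_mem h0 hv x))
    (mul_mem (convAlg.algebraMap_mem q⁻¹) (label_mem h0 hv y))) (convAlg.inv_mem
    (sub_mem (label_mem h0 hv x) (label_mem h0 hv y)) ?_)
  simpa [h0, sub_eq_zero] using hxy

theorem fProd_mem {us vs : List ℂ} (h : ∀ x ∈ us, ∀ y ∈ vs, x ≠ y) :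
    (fun ω => fProd q (us.map (v ω)) (vs.map (v ω))) ∈ convAlg := by
  simp only [fProd, List.map_map, Function.comp_def]
  have key : ∀ (l : List ℂ) (F : Option ℕ → ℂ → ℂ), (∀ x ∈ l, (fun ω => F ω x) ∈ convAlg) →
      (fun ω => (l.map (F ω)).prod) ∈ convAlg := by
    intro l F hF
    induction l with
    | nil =>
      simp only [List.map_nil, List.prod_nil]
      exact one_mem convAlg
    | cons a l ih =>
      simp only [List.map_cons, List.prod_cons]
      exact mul_mem (hF a (by simp)) (ih fun x hx => hF x (by simp [hx]))
  exact key _ _ fun x hx => key _ _ fun y hy => fFun_mem_convAlg h0 hv (h x hx y hy)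

theorem RMat_mem {x y : ℂ} (hxy : x ≠ y) (n : ℕ) (a b : Fin n × Fin n) :
    (fun ω => RMat q n (v ω x) (v ω y) a b) ∈ convAlg := by
  simp only [RMat, Matrix.of_apply]
  split_ifs
  · exact fFun_mem_convAlg h0 hv hxy
  · exact one_mem convAlg
  · exact gL_mem h0 hv hxy
  · exact gR_mem h0 hv hxy
  · exact zero_mem convAlg

theorem recCoeff_mem (hv0 : ∀ ω, v ω 0 = 0) {s t : Fin (N + 1) → List ℂ} (h : Letters s t)
    (hs : Admissible q s) (ht : Admissible q t) {p : Fin (N + 1)} {I J : Fin (N + 1) → ℕ}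
    (hI : I ∈ choices s p) (hJ : J ∈ choices t p) :
    (fun ω => recCoeff q (fun k => (s k).map (v ω)) (fun k => (t k).map (v ω)) p I J) ∈
      convAlg := by
  have hcs : ∀ k ≤ p, chosen s I k ∈ s k := fun k hk => getD_mem (lt_length_of_mem_choices hI hk)
  have hct : ∀ k ≤ p, chosen t J k ∈ t k := fun k hk => getD_mem (lt_length_of_mem_choices hJ hk)
  have hrs : ∀ k ≤ p, ∀ x ∈ remaining s p I k, x ≠ chosen s I k := fun k hk x hx h' => by
    rw [remaining, if_pos hk, h', chosen] at hx
    exact getD_notMem_eraseIdx (h.left.nodup k) (lt_length_of_mem_choices hI hk) hx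
  have hrt : ∀ k ≤ p, ∀ x ∈ remaining t p J k, x ≠ chosen t J k := fun k hk x hx h' => by
    rw [remaining, if_pos hk, h', chosen] at hx
    exact getD_notMem_eraseIdx (h.right.nodup k) (lt_length_of_mem_choices hJ hk) hx
  have hst : ∀ {k l x y}, x ∈ s k → y ∈ t l → x ≠ y := fun hx hy h' => h.disj _ _ _ hx (h' ▸ hy)
  have hss : ∀ {k l}, k ≠ l → ∀ {x y}, x ∈ s k → y ∈ s l → x ≠ y :=
    fun hkl _ _ hx hy h' => h.left.disj _ _ hkl _ hx (h' ▸ hy)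
  have htt : ∀ {k l}, k ≠ l → ∀ {x y}, x ∈ t k → y ∈ t l → x ≠ y :=
    fun hkl _ _ hx hy h' => h.right.disj _ _ hkl _ hx (h' ▸ hy)
  have hsing : ∀ {x : ℂ} {ω}, [v ω x] = [x].map (v ω) := rfl
  simp only [recCoeff, chosen_map _ (hv0 _), remaining_map, colorOr_map, hsing]
  have hmul : ∀ {c d : Option ℕ → ℂ}, c ∈ convAlg → d ∈ convAlg → (fun ω => c ω * d ω) ∈ convAlg :=
    fun hc hd => mul_mem hc hd
  have hdiv : ∀ {c d : Option ℕ → ℂ}, c ∈ convAlg → d ∈ convAlg → d none ≠ 0 →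
      (fun ω => c ω / d ω) ∈ convAlg := fun hc hd hd0 => by
    simp only [div_eq_mul_inv]
    exact mul_mem hc (convAlg.inv_mem hd hd0)
  have hnone : ∀ l : List ℂ, l.map (v none) = l := fun l => by
    rw [show v none = id from funext h0, List.map_id]
  have hp0 : (0 : Fin (N + 1)) ≤ p := Fin.zero_le p
  refine hmul (hdiv (hmul (hmul (gL_mem h0 hv (hst (hcs 0 hp0) (hct 0 hp0)).symm)
    (fProd_mem h0 hv ?_)) (fProd_mem h0 hv ?_)) (fProd_mem h0 hv ?_) ?_) ?_
  · intro x hx y hy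
    rw [List.mem_singleton.mp hx]
    exact (hrt 0 hp0 y hy).symm
  · intro x hx y hy
    rw [List.mem_singleton.mp hy]
    exact (hst (hcs 0 hp0) ((remaining_sublist t p J 0).subset hx)).symm
  · intro x hx y hy
    rw [List.mem_singleton.mp hy]
    obtain ⟨hk, hx⟩ := mem_colorOr hx
    refine hss (fun h' => ?_) hx (hcs p le_rfl)
    exact absurd (congrArg Fin.val h') (by simp)
  · rw [hnone, hnone]
    refine fProd_ne_zero fun x hx y hy => ?_
    rw [List.mem_singleton.mp hy]
    obtain ⟨hk, hx⟩ := mem_colorOr hx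
    exact hs p _ rfl x hx _ (hcs p le_rfl)
  · have hprod : ∀ (S : Finset (Fin N)) (F : Option ℕ → Fin N → ℂ),
        (∀ ν ∈ S, (fun ω => F ω ν) ∈ convAlg) → (fun ω => ∏ ν ∈ S, F ω ν) ∈ convAlg := by
      intro S F hF
      have : (fun ω => ∏ ν ∈ S, F ω ν) = ∏ ν ∈ S, fun ω => F ω ν := by
        funext ω; rw [Finset.prod_apply]
      rw [this]
      exact prod_mem hF
    refine hprod _ _ fun ν hν => ?_
    have h1 : ν.castSucc ≤ p := (Finset.mem_filter.mp hν).2.le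
    have h2 : ν.succ ≤ p := Fin.castSucc_lt_iff_succ_le.mp (Finset.mem_filter.mp hν).2
    have h3 : ν.succ ≠ ν.castSucc := (Fin.castSucc_lt_succ).ne'
    refine hdiv (hmul (hmul (hmul (gR_mem h0 hv (hss h3 (hcs _ h2) (hcs _ h1)))
      (gL_mem h0 hv (htt h3 (hct _ h2) (hct _ h1)))) (fProd_mem h0 hv ?_))
      (fProd_mem h0 hv ?_)) (hmul (fProd_mem h0 hv ?_) (fProd_mem h0 hv ?_)) (mul_ne_zero ?_ ?_)
    · intro x hx y hy
      rw [List.mem_singleton.mp hy]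
      exact hrs _ h2 x hx
    · intro x hx y hy
      rw [List.mem_singleton.mp hx]
      exact (hrt _ h2 y hy).symm
    · intro x hx y hy
      rw [List.mem_singleton.mp hy]
      exact hss h3 hx (hcs _ h1)
    · intro x hx y hy
      rw [List.mem_singleton.mp hx]
      exact htt h3 (hct _ h2) hy
    · rw [hnone, hnone]
      refine fProd_ne_zero fun x hx y hy => ?_
      rw [List.mem_singleton.mp hy]
      exact hs ν.castSucc _ (by simp) x hx _ (hcs _ h1)
    · rw [hnone, hnone]
      refine fProd_ne_zero fun x hx y hy => ?_
      rw [List.mem_singleton.mp hx]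
      exact ht ν.castSucc _ (by simp) _ (hct _ h2) y hy

end Functions

end Limit

/-! ## The recursion for the highest coefficient -/

section RecursionLimit

open Filter Topology

variable {q : ℂ} {N m : ℕ} {H : Type*} [AddCommGroup H] [Module (LamRing m) H] [Module ℂ H]
  [IsScalarTower ℂ (LamRing m) H]

theorem omegaExp_map {Λ : Type*} (ι : Fin (N + 1) → Fin m) (s t : Fin N → List Λ) (u : Λ → ℂ) :
    omegaExp ι (fun k => (s k).map u) (fun k => (t k).map u) = Finsupp.mapDomain (Prod.map id u)
      (∑ k, ((s k).map fun x => Finsupp.single (ι k.castSucc, x) (1 : ℤ)).sum +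
        ∑ k, ((t k).map fun x => Finsupp.single (ι k.succ, x) (1 : ℤ)).sum) := by
  have key : ∀ (i : Fin m) (l : List Λ), ((l.map u).map fun x => Finsupp.single (i, x) (1 : ℤ)).sum =
      Finsupp.mapDomain (Prod.map id u) (l.map fun x => Finsupp.single (i, x) (1 : ℤ)).sum := by
    intro i l
    induction l with
    | nil => simp
    | cons a l ih =>
      simp only [List.map_cons, List.sum_cons, Finsupp.mapDomain_add, Finsupp.mapDomain_single, ih]
      rfl
  simp only [omegaExp, key, Finsupp.mapDomain_add, Finsupp.mapDomain_finsetSum]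

theorem Distinct.map {t : Fin N → List ℂ} (ht : Distinct {0}ᶜ t) {A : Set ℂ}
    (hA : ∀ k, ∀ x ∈ t k, x ∈ A) {v : ℂ → ℂ} (hv : Set.InjOn v A) (hv0 : ∀ x ∈ A, v x ≠ 0) :
    Distinct {0}ᶜ fun k => (t k).map v where
  nodup k := List.Nodup.map_on (fun x hx y hy h => hv (hA k x hx) (hA k y hy) h) (ht.nodup k)
  mem k x hx := by
    obtain ⟨y, hy, rfl⟩ := List.mem_map.mp hx
    exact hv0 y (hA k y hy)
  disj k l hkl x hx hx' := by
    obtain ⟨y, hy, rfl⟩ := List.mem_map.mp hx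
    obtain ⟨y', hy', h⟩ := List.mem_map.mp hx'
    exact ht.disj k l hkl y hy (hv (hA l y' hy') (hA k y hy) h ▸ hy')

theorem Letters.map {s t : Fin N → List ℂ} (h : Letters s t) {A : Set ℂ}
    (hs : ∀ k, ∀ x ∈ s k, x ∈ A) (ht : ∀ k, ∀ x ∈ t k, x ∈ A) {v : ℂ → ℂ} (hv : Set.InjOn v A)
    (hv0 : ∀ x ∈ A, v x ≠ 0) : Letters (fun k => (s k).map v) fun k => (t k).map v where
  left := h.left.map hs hv hv0
  right := h.right.map ht hv hv0
  disj k l x hx hx' := by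
    obtain ⟨y, hy, rfl⟩ := List.mem_map.mp hx
    obtain ⟨y', hy', h'⟩ := List.mem_map.mp hx'
    exact h.disj k l y hy (hv (ht l y' hy') (hs k y hy) h' ▸ hy')

/-- Continuity of the highest coefficient. The labels are the unperturbed values, so one monomial in
the labels serves the whole sequence. Admissibility keeps the inverted factors nonzero in the limit,
and the reordering itself divides only by differences of distinct points. -/
theorem IsFreeModel.highCoeff_mem {ι : Fin (N + 1) → Fin m}
    {T : Fin (N + 1) → Fin (N + 1) → ℂ → Module.End (LamRing m) H} {vac : H}
    {bra : Module.Dual (LamRing m) H} (hT : IsFreeModel q ι T vac bra) {s t : Fin N → List ℂ}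
    (h : Letters s t) (hs : Admissible q s) (ht : Admissible q t) {A : Set ℂ}
    (hsA : ∀ k, ∀ x ∈ s k, x ∈ A) (htA : ∀ k, ∀ x ∈ t k, x ∈ A)
    {v : Option ℕ → ℂ → ℂ} (h0 : ∀ x, v none x = x)
    (hv : ∀ x, Tendsto (fun n => v (some n) x) atTop (𝓝 x)) (hinj : ∀ ω, Set.InjOn (v ω) A)
    (hv0 : ∀ ω, ∀ x ∈ A, v ω x ≠ 0) :
    (fun ω => highCoeff q N ι T vac bra (fun k => (s k).map (v ω)) fun k => (t k).map (v ω)) ∈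
      convAlg := by
  obtain ⟨s', hs'⟩ := exists_lift (· ∈ A) hsA
  obtain ⟨t', ht'⟩ := exists_lift (· ∈ A) htA
  have hmem : ∀ {r : Fin N → List ℂ} {r' : Fin N → List {x : ℂ // x ∈ A}},
      (∀ k, (r' k).map Subtype.val = r k) → ∀ k a, a ∈ r' k → a.1 ∈ r k := fun hr k a ha => by
    rw [← hr k]; exact List.mem_map_of_mem ha
  have key : ∀ {r : Fin N → List ℂ} {r' : Fin N → List {x : ℂ // x ∈ A}},
      (∀ k, (r' k).map Subtype.val = r k) → Distinct {0}ᶜ r → (∀ k, (r' k).Nodup) ∧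
      ∀ k l, k ≠ l → ∀ a ∈ r' k, a ∉ r' l := fun hr hd =>
    ⟨fun k => List.Nodup.of_map _ (by rw [hr k]; exact hd.nodup k), fun k l hkl a ha ha' =>
      hd.disj k l hkl a.1 (hmem hr k a ha) (hmem hr l a ha')⟩
  set u : Option ℕ → {x : ℂ // x ∈ A} → ℂ := fun ω a => v ω a.1 with hu
  have hmap : ∀ {r : Fin N → List ℂ} {r' : Fin N → List {x : ℂ // x ∈ A}},
      (∀ k, (r' k).map Subtype.val = r k) → ∀ ω, (fun k => (r k).map (v ω)) =
        fun k => (r' k).map (u ω) := fun hr ω => by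
    funext k
    rw [← hr k, List.map_map]
    rfl
  have hfac : ∀ {r : Fin N → List ℂ} {r' : Fin N → List {x : ℂ // x ∈ A}},
      (∀ k, (r' k).map Subtype.val = r k) → Distinct {0}ᶜ r → Admissible q r →
      ∀ k : ℕ, (fun ω => (fProd q (colorOr (fun k => (r' k).map (u ω)) (k + 1))
        (colorOr (fun k => (r' k).map (u ω)) k))⁻¹) ∈ convAlg := fun {r r'} hr hd ha k => by
    simp only [← hmap hr, colorOr_map]
    refine convAlg.inv_mem (fProd_mem h0 hv fun x hx y hy => ?_) ?_
    · obtain ⟨hl, hx⟩ := mem_colorOr hx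
      obtain ⟨hk, hy⟩ := mem_colorOr hy
      exact fun h' => hd.disj _ _ (fun h'' => by simp at h'') x hx (h' ▸ hy)
    · rw [show v none = id from funext h0, List.map_id, List.map_id]
      exact ha.fProd_ne_zero k
  have hui : ∀ ω, Function.Injective (u ω) := fun ω a b hab => Subtype.ext (hinj ω a.2 b.2 hab)
  have hu0 : ∀ ω a, u ω a ≠ 0 := fun ω a => hv0 ω a.1 a.2
  have hG : ∀ a b, a ≠ b → ∀ n x y, (fun ω => RMat q n (u ω a) (u ω b) x y) ∈ convAlg :=
    fun a b hab n x y => RMat_mem h0 hv (fun h' => hab (Subtype.ext h')) n x y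
  have h1 := hT.niceVec_bv hui hu0 hG (key ht' h.right).1 (key ht' h.right).2
    (hfac ht' h.right ht)
  have h2 := hT.niceCovec_dualBv hui hu0 hG (key hs' h.left).1 (key hs' h.left).2
    (hfac hs' h.left hs)
  have hdisj : Disjoint {a | ∃ k, a ∈ t' k} {a | ∃ k, a ∈ s' k} :=
    Set.disjoint_left.mpr fun a ⟨k, hk⟩ ⟨l, hl⟩ =>
      h.disj l k a.1 (hmem hs' l _ hl) (hmem ht' k _ hk)
  have h3 := (h2 _ _ hdisj h1).coeff
      (∑ k, ((s' k).map fun x => Finsupp.single (ι k.castSucc, x) (1 : ℤ)).sum +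
        ∑ k, ((t' k).map fun x => Finsupp.single (ι k.succ, x) (1 : ℤ)).sum)
  simpa only [highCoeff, hmap hs', hmap ht', omegaExp_map] using h3

variable {ι : Fin (N + 1 + 1) → Fin m}
    {T : Fin (N + 1 + 1) → Fin (N + 1 + 1) → ℂ → Module.End (LamRing m) H} {vac : H}
    {bra : Module.Dual (LamRing m) H}

/-- The recursion for the highest coefficient. -/
theorem IsFreeModel.highCoeff_recursion (hq : q ≠ 0) (hT : IsFreeModel q ι T vac bra)
    {s t : Fin (N + 1) → List ℂ} (h : Letters s t) (hs : Admissible q s)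
    (ht : Admissible q t) {i : ℕ} (hi : i < (s 0).length) :
    highCoeff q (N + 1) ι T vac bra s t =
      ∑ p : Fin (N + 1), ∑ I ∈ choices s p with I 0 = i, ∑ J ∈ choices t p,
        recCoeff q s t p I J *
          highCoeff q (N + 1) ι T vac bra (remaining s p I) (remaining t p J) := by
  set A : List ℂ := (List.ofFn s).flatten ++ (List.ofFn t).flatten with hA
  have hsA : ∀ k, ∀ x ∈ s k, x ∈ {x | x ∈ A} := fun k x hx => by
    simp only [hA, Set.mem_ofPred_eq, List.mem_append, List.mem_flatten]
    exact .inl ⟨s k, (List.mem_ofFn' s _).mpr ⟨k, rfl⟩, hx⟩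
  have htA : ∀ k, ∀ x ∈ t k, x ∈ {x | x ∈ A} := fun k x hx => by
    simp only [hA, Set.mem_ofPred_eq, List.mem_append, List.mem_flatten]
    exact .inr ⟨t k, (List.mem_ofFn' t _).mpr ⟨k, rfl⟩, hx⟩
  have hA0 : 0 ∉ A := by
    simp only [hA, List.mem_append, List.mem_flatten, List.mem_ofFn', Set.mem_range]
    rintro (⟨_, ⟨k, rfl⟩, hk⟩ | ⟨_, ⟨k, rfl⟩, hk⟩)
    · exact h.left.mem k 0 hk rfl
    · exact h.right.mem k 0 hk rfl
  obtain ⟨v, h0, hv00, hv, hinj, hv0, hnd⟩ := exists_perturbation hq A hA0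
  have hL := hT.highCoeff_mem h hs ht hsA htA h0 hv hinj hv0
  have hR : (fun ω => ∑ p : Fin (N + 1), ∑ I ∈ choices s p with I 0 = i, ∑ J ∈ choices t p,
      recCoeff q (fun k => (s k).map (v ω)) (fun k => (t k).map (v ω)) p I J *
        highCoeff q (N + 1) ι T vac bra (fun k => (remaining s p I k).map (v ω))
          fun k => (remaining t p J k).map (v ω)) ∈ convAlg := by
    have hsum : ∀ {κ : Type} (S : Finset κ) (F : Option ℕ → κ → ℂ),
        (∀ ν ∈ S, (fun ω => F ω ν) ∈ convAlg) → (fun ω => ∑ ν ∈ S, F ω ν) ∈ convAlg := by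
      intro κ S F hF
      have : (fun ω => ∑ ν ∈ S, F ω ν) = ∑ ν ∈ S, fun ω => F ω ν := by
        funext ω; rw [Finset.sum_apply]
      rw [this]
      exact sum_mem hF
    refine hsum _ _ fun p _ => hsum _ _ fun I hI => hsum _ _ fun J hJ => ?_
    have hrs := remaining_sublist s p I
    have hrt := remaining_sublist t p J
    exact mul_mem (recCoeff_mem h0 hv hv00 h hs ht (Finset.mem_filter.mp hI).1 hJ)
      (hT.highCoeff_mem (h.mono hrs hrt) (hs.sublist hrs) (ht.sublist hrt)
        (fun k x hx => hsA k x ((hrs k).subset hx)) (fun k x hx => htA k x ((hrt k).subset hx))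
        h0 hv hinj hv0)
  have hn : v none = id := funext h0
  -- Both sides converge to their unperturbed values and agree along the sequence, where the
  -- parameters are nondegenerate.
  have key := convAlg.eq hL hR fun n => ?_
  · simpa only [hn, List.map_id] using key
  · have hset : ∀ {r : Fin (N + 1) → List ℂ}, (∀ k, ∀ x ∈ r k, x ∈ {x | x ∈ A}) →
        Nondeg q {x | ∃ k, x ∈ (r k).map (v (some n))} := by
      rintro r hr x ⟨k, hx⟩ y ⟨l, hy⟩
      obtain ⟨x', hx', rfl⟩ := List.mem_map.mp hx
      obtain ⟨y', hy', rfl⟩ := List.mem_map.mp hy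
      exact hnd n _ ⟨x', hr k x' hx', rfl⟩ _ ⟨y', hr l y' hy', rfl⟩
    have hrec := hT.highCoeff_recursion_of_nondeg hq (h.map hsA htA (hinj (some n)) (hv0 (some n)))
      (hset hsA) (hset htA) (i := i) (by simpa using hi)
    simpa only [choices_map, remaining_map] using hrec

end RecursionLimit

/-! ## Generalized models -/

section Models

variable {q : ℂ} {N : ℕ}

/-- The eigenvalue normalization is a scalar at each level and commutes with all operators, so it
can be restored at the very end. -/
theorem betheVec_eq_smul_bv {K : Type*} [CommRing K] [Algebra ℂ K] :
    ∀ (N : ℕ) {H : Type*} [AddCommGroup H] [Module K H]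
      (T : Fin (N + 1) → Fin (N + 1) → ℂ → Module.End K H) (nu : Fin N → ℂ → K) (vac : H)
      (t : Fin N → List ℂ),
      betheVec q N T nu vac t = (∏ k, ((t k).map (nu k)).prod) • bv q N T vac t
  | 0, _, _, _, _, _, _, _ => by simp [betheVec, bv]
  | N + 1, H, _, _, T, nu, vac, t => by
    rw [Fin.prod_univ_succ, bv, betheVec, betheVec]
    simp only [betheVec_eq_smul_bv N (H := (Fin (t 0).length → Fin (N + 1)) → H), Pi.smul_apply,
      map_smul, ← Finset.smul_sum, smul_smul, List.map_const', List.prod_replicate, one_pow,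
      Finset.prod_const_one, one_smul, one_mul]
    congr 1
    ring

variable {H : Type*} [AddCommGroup H] [Module (LamRing (N + 1)) H]

theorem GenModel.isFreeModel [Module ℂ H] [IsScalarTower ℂ (LamRing (N + 1)) H]
    (M : GenModel q (N + 1) H) : IsFreeModel q id M.T M.vac M.bra where
  rtt u hu v hv huv a c i j x := by
    have h := LinearMap.congr_fun (M.rtt u v hu hv huv a c i j) x
    simpa only [LinearMap.sum_apply, LinearMap.smul_apply, Module.End.mul_apply,
      algebraMap_smul] using h
  inj := Function.injective_id
  diag_vac := M.diag_vac
  lower_vac := M.lower_vac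
  bra_diag u hu i x := LinearMap.congr_fun (M.bra_diag u hu i) x
  bra_upper u hu i j hij x := LinearMap.congr_fun (M.bra_upper u hu i j hij) x
  bra_vac := M.bra_vac

theorem lamInv_mul_coeff {m : ℕ} (i : Fin m) (v : ℂ) (x : LamRing m) (e : (Fin m × ℂ) →₀ ℤ) :
    (lamInv i v * x).coeff e = x.coeff (e + Finsupp.single (i, v) 1) := by
  rw [lamInv, AddMonoidAlgebra.coeff_single_mul_eq_mul_coeff (e + Finsupp.single (i, v) 1), one_mul]
  intro e' _
  rw [Finsupp.single_neg, neg_add_eq_iff_eq_add, add_comm (Finsupp.single _ _)]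

theorem coeff_prod_lamInv_mul (t : Fin N → List ℂ) (x : LamRing (N + 1))
    (e : (Fin (N + 1) × ℂ) →₀ ℤ) :
    ((∏ k, ((t k).map fun u => lamInv k.succ u).prod) * x).coeff e =
      x.coeff (e + ∑ k, ((t k).map fun u => Finsupp.single (k.succ, u) (1 : ℤ)).sum) := by
  have hl : ∀ (i : Fin (N + 1)) (l : List ℂ) (x : LamRing (N + 1)) (e : (Fin (N + 1) × ℂ) →₀ ℤ),
      ((l.map fun u => lamInv i u).prod * x).coeff e =
        x.coeff (e + (l.map fun u => Finsupp.single (i, u) (1 : ℤ)).sum) := by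
    intro i l
    induction l with
    | nil => simp
    | cons a l ih =>
      intro x e
      rw [List.map_cons, List.prod_cons, mul_assoc, lamInv_mul_coeff, ih, List.map_cons,
        List.sum_cons, add_assoc]
  have : ∀ S : Finset (Fin N), ∀ e, ((∏ k ∈ S, ((t k).map fun u => lamInv k.succ u).prod) * x).coeff e =
      x.coeff (e + ∑ k ∈ S, ((t k).map fun u => Finsupp.single (k.succ, u) (1 : ℤ)).sum) := by
    intro S
    induction S using Finset.induction_on with
    | empty => simp
    | insert a S ha ih =>
      intro e
      rw [Finset.prod_insert ha, Finset.sum_insert ha, mul_assoc, hl, ih, add_assoc]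
  exact this _ e

/-- Clearing the normalizations of both Bethe vectors turns the monomial `∏ α_k(s^k)` into `∏
λ_k(s^k) λ_{k+1}(t^k)`. -/
theorem omegaExp_id (s t : Fin N → List ℂ) :
    omegaExp id s t = alphaExp s +
      ∑ k, ((s k).map fun u => Finsupp.single (k.succ, u) (1 : ℤ)).sum +
      ∑ k, ((t k).map fun u => Finsupp.single (k.succ, u) (1 : ℤ)).sum := by
  have hl : ∀ (i j : Fin (N + 1)) (l : List ℂ),
      (l.map fun u => Finsupp.single (i, u) (1 : ℤ)).sum =
        (l.map fun u => Finsupp.single (i, u) (1 : ℤ) - Finsupp.single (j, u) (1 : ℤ)).sum +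
          (l.map fun u => Finsupp.single (j, u) (1 : ℤ)).sum := by
    intro i j l
    rw [← List.sum_map_add]
    simp
  have h : ∑ k : Fin N, ((s k).map fun u => Finsupp.single (k.castSucc, u) (1 : ℤ)).sum =
      alphaExp s + ∑ k, ((s k).map fun u => Finsupp.single (k.succ, u) (1 : ℤ)).sum := by
    rw [alphaExp, ← Finset.sum_add_distrib]
    exact Finset.sum_congr rfl fun k _ => hl _ _ _
  rw [← h]
  rfl

theorem GenModel.Z_eq_highCoeff (M : GenModel q (N + 1) H) (s t : Fin N → List ℂ) :
    M.Z s t = highCoeff q N id M.T M.vac M.bra s t := by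
  have hB : M.B t = (∏ k, ((t k).map fun u => lamInv k.succ u).prod) • bv q N M.T M.vac t :=
    betheVec_eq_smul_bv N _ _ _ _
  have hC : M.C s = (∏ k, ((s k).map fun u => lamInv k.succ u).prod) •
      dualBv q N M.T M.bra s := by
    rw [GenModel.C, betheVec_eq_smul_bv]
    simp only [List.map_map, Function.comp_def, inv_inv]
    rfl
  rw [GenModel.Z, GenModel.S, hB, hC, LinearMap.smul_apply, LinearMap.map_smul, smul_eq_mul,
    smul_eq_mul, coeff_prod_lamInv_mul, coeff_prod_lamInv_mul, highCoeff, omegaExp_id]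

theorem IsGeneric.letters {s t : Fin N → List ℂ} (h : IsGeneric q s t) : Letters s t := by
  have h1 := List.nodup_append.mp h.nodup
  have hd : ∀ {r : Fin N → List ℂ}, (List.ofFn r).flatten.Nodup → (∀ k, ∀ x ∈ r k, x ≠ 0) →
      Distinct {0}ᶜ r := fun {r} hr h0 => by
    rw [List.nodup_flatten] at hr
    refine ⟨fun k => hr.1 _ ((List.mem_ofFn' r _).mpr ⟨k, rfl⟩), h0, ?_⟩
    have h2 := List.pairwise_ofFn.mp hr.2
    intro k l hkl x hx hx'
    rcases lt_or_gt_of_ne hkl with h3 | h3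
    · exact h2 h3 hx hx'
    · exact h2 h3 hx' hx
  have hm : ∀ {r : Fin N → List ℂ} {k x}, x ∈ r k → x ∈ (List.ofFn r).flatten := fun {r k x} hx =>
    List.mem_flatten.mpr ⟨_, (List.mem_ofFn' r _).mpr ⟨k, rfl⟩, hx⟩
  exact ⟨hd h1.1 fun k => (h.ne_zero k).1, hd h1.2.1 fun k => (h.ne_zero k).2,
    fun k l x hx hx' => h1.2.2 x (hm hx) x (hm hx') rfl⟩

theorem IsGeneric.admissible_left {s t : Fin N → List ℂ} (h : IsGeneric q s t) : Admissible q s :=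
  fun k l hkl => (h.f_ne_zero k l hkl).1

theorem IsGeneric.admissible_right {s t : Fin N → List ℂ} (h : IsGeneric q s t) :
    Admissible q t :=
  fun k l hkl => (h.f_ne_zero k l hkl).2

/-- Restriction of scalars; the intermediate results use a complex vector space structure that a
model does not carry by itself. -/
theorem GenModel.exists_module (N : ℕ) (H : Type*) [AddCommGroup H] [Module (LamRing N) H] :
    ∃ _ : Module ℂ H, IsScalarTower ℂ (LamRing N) H :=
  ⟨Module.compHom H (algebraMap ℂ (LamRing N)),
    @IsScalarTower.mk _ _ _ _ _ (Module.compHom H (algebraMap ℂ (LamRing N))).toSMul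
      fun c x y => by rw [Algebra.smul_def, mul_smul]; rfl⟩

end Models

/-! ## Reduction of the rank and uniqueness of the highest coefficient -/

section Uniqueness

variable {q : ℂ} {N m : ℕ} {H : Type*} [AddCommGroup H] [Module (LamRing m) H] [Module ℂ H]
  [IsScalarTower ℂ (LamRing m) H]

/-- A chain without sites is the lower right block itself, up to the unique empty multi-index. -/
theorem bv_cons_nil {K : Type*} [CommRing K] [Algebra ℂ K] {H : Type*} [AddCommGroup H]
    [Module K H] [Module ℂ H] [IsScalarTower ℂ K H]
    (T : Fin (N + 1 + 1) → Fin (N + 1 + 1) → ℂ → Module.End K H) (vac : H) (t : Fin N → List ℂ) :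
    bv q (N + 1) T vac (Fin.cons [] t : Fin (N + 1) → List ℂ) = bv q N (lowerBlock T) vac t := by
  rw [bv_cons, fProd_nil_right, inv_one, one_smul, evL_nil]
  have h := bv_map (q := q) (LinearMap.proj (R := K) (φ := fun _ => H)
    (Fin.elim0 : Fin ([] : List ℂ).length → Fin (N + 1))) (T := chainL q (lowerBlock T) [])
    (T' := lowerBlock T) (vacL N vac []) t fun _ _ _ _ _ _ => rfl
  have hvac : vacL N vac [] Fin.elim0 = vac := by
    rw [vacL, Pi.single_apply, if_pos (funext fun a => a.elim0)]
  rw [LinearMap.proj_apply, LinearMap.proj_apply, hvac] at h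
  exact h

theorem omegaExp_cons_nil (ι : Fin (N + 1 + 1) → Fin m) (s t : Fin N → List ℂ) :
    omegaExp ι (Fin.cons [] s : Fin (N + 1) → List ℂ) (Fin.cons [] t : Fin (N + 1) → List ℂ) =
      omegaExp (fun k => ι k.succ) s t := by
  simp [omegaExp, Fin.sum_univ_succ]

theorem highCoeff_cons_nil (ι : Fin (N + 1 + 1) → Fin m)
    (T : Fin (N + 1 + 1) → Fin (N + 1 + 1) → ℂ → Module.End (LamRing m) H) (vac : H)
    (bra : Module.Dual (LamRing m) H) (s t : Fin N → List ℂ) :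
    highCoeff q (N + 1) ι T vac bra (Fin.cons [] s : Fin (N + 1) → List ℂ)
        (Fin.cons [] t : Fin (N + 1) → List ℂ) =
      highCoeff q N (fun k => ι k.succ) (lowerBlock T) vac bra s t := by
  rw [highCoeff, dualBv_cons, List.map_nil, bv_cons_nil, bv_cons_nil, omegaExp_cons_nil]
  rfl

theorem IsFreeModel.lowerBlock {ι : Fin (N + 1 + 1) → Fin m}
    {T : Fin (N + 1 + 1) → Fin (N + 1 + 1) → ℂ → Module.End (LamRing m) H} {vac : H}
    {bra : Module.Dual (LamRing m) H} (hT : IsFreeModel q ι T vac bra) :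
    IsFreeModel q (fun k => ι k.succ) (lowerBlock T) vac bra where
  rtt := hT.vacModel.block.rtt
  inj _ _ h := Fin.succ_injective _ (hT.inj h)
  diag_vac u hu i := hT.diag_vac u hu i.succ
  lower_vac u hu _ _ hij := hT.lower_vac u hu _ _ (Fin.succ_lt_succ_iff.mpr hij)
  bra_diag u hu i := hT.bra_diag u hu i.succ
  bra_upper u hu _ _ hij := hT.bra_upper u hu _ _ (Fin.succ_lt_succ_iff.mpr hij)
  bra_vac := hT.bra_vac

theorem length_remaining {s : Fin N → List ℂ} {p : Fin N} {I : Fin N → ℕ} (hI : I ∈ choices s p)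
    (k : Fin N) : (remaining s p I k).length = if k ≤ p then (s k).length - 1 else (s k).length := by
  unfold remaining
  split_ifs with h
  · exact List.length_eraseIdx_of_lt (lt_length_of_mem_choices hI h)
  · rfl

theorem Letters.tail {s t : Fin (N + 1) → List ℂ} (h : Letters s t) :
    Letters (Fin.tail s) (Fin.tail t) where
  left := ⟨fun _ => h.left.nodup _, fun _ => h.left.mem _, fun _ _ hkl =>
    h.left.disj _ _ fun h' => hkl (Fin.succ_injective _ h')⟩
  right := ⟨fun _ => h.right.nodup _, fun _ => h.right.mem _, fun _ _ hkl =>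
    h.right.disj _ _ fun h' => hkl (Fin.succ_injective _ h')⟩
  disj _ _ := h.disj _ _

theorem Admissible.tail {t : Fin (N + 1) → List ℂ} (h : Admissible q t) :
    Admissible q (Fin.tail t) :=
  fun k l hkl => h k.succ l.succ (by simp [hkl])

theorem IsFreeModel.highCoeff_zero {ι : Fin (0 + 1) → Fin m}
    {T : Fin (0 + 1) → Fin (0 + 1) → ℂ → Module.End (LamRing m) H} {vac : H}
    {bra : Module.Dual (LamRing m) H} (hT : IsFreeModel q ι T vac bra) (s t : Fin 0 → List ℂ) :
    highCoeff q 0 ι T vac bra s t = 1 := by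
  rw [highCoeff, dualBv, bv_zero, bv_zero, hT.bra_vac]
  simp [omegaExp, AddMonoidAlgebra.one_def]

/-- The highest coefficient does not depend on the model. -/
theorem IsFreeModel.highCoeff_unique (hq : q ≠ 0) {m' : ℕ} {H' : Type*} [AddCommGroup H']
    [Module (LamRing m') H'] [Module ℂ H'] [IsScalarTower ℂ (LamRing m') H'] {N : ℕ} :
    ∀ {ι : Fin (N + 1) → Fin m}
      {T : Fin (N + 1) → Fin (N + 1) → ℂ → Module.End (LamRing m) H} {vac : H}
      {bra : Module.Dual (LamRing m) H} (_ : IsFreeModel q ι T vac bra)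
      {ι' : Fin (N + 1) → Fin m'}
      {T' : Fin (N + 1) → Fin (N + 1) → ℂ → Module.End (LamRing m') H'} {vac' : H'}
      {bra' : Module.Dual (LamRing m') H'} (_ : IsFreeModel q ι' T' vac' bra')
      {s t : Fin N → List ℂ} (_ : Letters s t) (_ : Admissible q s) (_ : Admissible q t)
      (_ : ∀ k, (s k).length = (t k).length),
      highCoeff q N ι T vac bra s t = highCoeff q N ι' T' vac' bra' s t := by
  -- Induction on the rank and then on the size of the first color. Each term of the recursion
  -- removes one element of the first color, and its coefficients do not involve the model; equal
  -- sizes make both first collections empty at the same time, where the rank drops.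
  induction N with
  | zero =>
    intro ι T vac bra hT ι' T' vac' bra' hT' s t _ _ _ _
    rw [hT.highCoeff_zero, hT'.highCoeff_zero]
  | succ N ihN =>
    intro ι T vac bra hT ι' T' vac' bra' hT' s t h hs ht hl
    induction hr : (s 0).length generalizing s t with
    | zero =>
      have hs0 : s = Fin.cons [] (Fin.tail s) := by
        rw [← List.eq_nil_of_length_eq_zero hr, Fin.cons_self_tail]
      have ht0 : t = Fin.cons [] (Fin.tail t) := by
        rw [← List.eq_nil_of_length_eq_zero ((hl 0).symm.trans hr), Fin.cons_self_tail]
      rw [hs0, ht0, highCoeff_cons_nil, highCoeff_cons_nil]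
      exact ihN hT.lowerBlock hT'.lowerBlock h.tail hs.tail ht.tail fun k => hl k.succ
    | succ r ih =>
      have h0 : 0 < (s 0).length := hr ▸ Nat.succ_pos r
      rw [hT.highCoeff_recursion hq h hs ht h0, hT'.highCoeff_recursion hq h hs ht h0]
      refine Finset.sum_congr rfl fun p _ => Finset.sum_congr rfl fun I hI =>
        Finset.sum_congr rfl fun J hJ => congrArg _ ?_
      have hI' := (Finset.mem_filter.mp hI).1
      refine ih (h.mono (remaining_sublist s p I) (remaining_sublist t p J))
        (hs.sublist (remaining_sublist s p I)) (ht.sublist (remaining_sublist t p J))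
        (fun k => ?_) ?_
      · rw [length_remaining hI', length_remaining hJ, hl]
      · rw [length_remaining hI', if_pos (Fin.zero_le p), hr, Nat.succ_sub_one]

end Uniqueness

/-! ## The Izergin-Korepin determinant -/

section IzerginKorepin

open Finset

variable {q : ℂ} {n : ℕ}

/-- Moving `t i` to the front is a cycle of sign `(-1)^i`; both products are Vandermonde
determinants, with nodes `-t k` so that the differences have the required orientation. -/
theorem prod_Ioi_succAbove (t : Fin (n + 1) → ℂ) (i : Fin (n + 1)) :
    ∏ a, ∏ b ∈ Ioi a, (t a - t b) = (-1) ^ (i : ℕ) * (∏ k, (t i - t (i.succAbove k))) *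
      ∏ a, ∏ b ∈ Ioi a, (t (i.succAbove a) - t (i.succAbove b)) := by
  have h := Matrix.det_permute i.cycleRange.symm (Matrix.vandermonde fun k => -t k)
  have h1 : (Matrix.vandermonde fun k => -t k).submatrix i.cycleRange.symm id =
      Matrix.vandermonde fun k => -t (i.cycleRange.symm k) := rfl
  rw [h1, Matrix.det_vandermonde, Matrix.det_vandermonde, Equiv.Perm.sign_symm,
    Fin.sign_cycleRange, Fin.prod_univ_succ, Fin.prod_Ioi_zero] at h
  simp only [Fin.prod_Ioi_succ, Fin.cycleRange_symm_zero, Fin.cycleRange_symm_succ,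
    sub_neg_eq_add, neg_add_eq_sub] at h
  rw [mul_assoc, h]
  push_cast
  rw [← mul_assoc, ← mul_pow]
  norm_num

/-- The partial fraction expansion of `∏ₖ (x - tₖ) / (x - sₖ)`. -/
theorem prod_div_prod_eq (s t : Fin n → ℂ) (hs : Function.Injective s) {x : ℂ}
    (hx : ∀ k, x ≠ s k) :
    (∏ k, (x - t k)) / ∏ k, (x - s k) =
      1 + ∑ k, (Lagrange.nodalWeight univ s k * ∏ l, (s k - t l)) * (x - s k)⁻¹ := by
  set f := Lagrange.nodal univ t - Lagrange.nodal univ s with hf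
  have hdeg : f.degree < ((univ : Finset (Fin n)).card : WithBot ℕ) := by
    rw [← Lagrange.degree_nodal (v := t)]
    refine Polynomial.degree_sub_lt_left ?_ Lagrange.nodal_ne_zero ?_
    · rw [Lagrange.degree_nodal, Lagrange.degree_nodal]
    · rw [Lagrange.nodal_monic.leadingCoeff, Lagrange.nodal_monic.leadingCoeff]
  have h := congrArg (Polynomial.eval x) (Lagrange.eq_interpolate (s := univ) hs.injOn hdeg)
  rw [Lagrange.eval_interpolate_not_at_node _ fun k _ => hx k] at h
  simp only [hf, Polynomial.eval_sub, Lagrange.eval_nodal_at_node (mem_univ _), sub_zero,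
    Lagrange.eval_nodal] at h
  have h0 : ∏ k, (x - s k) ≠ 0 := prod_ne_zero_iff.mpr fun k _ => sub_ne_zero.mpr (hx k)
  rw [div_eq_iff h0, add_mul, one_mul, mul_comm (∑ k, _), ← sub_eq_iff_eq_add', h]
  refine congrArg _ (sum_congr rfl fun k _ => ?_)
  ring

/-- The matrix of the Izergin-Korepin determinant. -/
noncomputable def ikMatrix (q : ℂ) (s t : Fin n → ℂ) : Matrix (Fin n) (Fin n) ℂ :=
  Matrix.of fun i j => (q - q⁻¹) / ((t i - s j) * (q * t i - q⁻¹ * s j))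

/-- Since `t` times the matrix entry equals `(t - s)⁻¹ - (q²t - s)⁻¹`, the weighted sum is the
difference of the partial fraction expansion at `x = t i` and at `x = q² t i`. The first value is
zero because the numerator vanishes. -/
theorem ikMatrix_mul_sum (hq : q ≠ 0) (s t : Fin n → ℂ) (hs : Function.Injective s)
    (hts : ∀ i j, t i ≠ s j) (hqts : ∀ i j, q * t i - q⁻¹ * s j ≠ 0) (i : Fin n) :
    t i * ∑ k, (Lagrange.nodalWeight univ s k * ∏ l, (s k - t l)) * ikMatrix q s t i k =
      -((∏ k, (q * t i - q⁻¹ * t k)) / ∏ k, (q * t i - q⁻¹ * s k)) := by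
  have h1 := prod_div_prod_eq s t hs (hts i)
  have h2 := prod_div_prod_eq s t hs (x := q ^ 2 * t i) fun k h => hqts i k (by
    rw [← h]; field_simp; ring)
  rw [prod_eq_zero (mem_univ i) (sub_self _), zero_div] at h1
  have h3 : ∀ r : Fin n → ℂ, ∏ k, (q ^ 2 * t i - r k) =
      q ^ n * ∏ k, (q * t i - q⁻¹ * r k) := fun r => by
    calc ∏ k, (q ^ 2 * t i - r k) = ∏ k, q * (q * t i - q⁻¹ * r k) :=
          prod_congr rfl fun k _ => by field_simp
      _ = _ := by rw [prod_mul_distrib, Fin.prod_const]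
  rw [h3, h3, mul_div_mul_left _ _ (pow_ne_zero _ hq)] at h2
  rw [h2, mul_sum]
  have h4 : ∀ k, t i * ((Lagrange.nodalWeight univ s k * ∏ l, (s k - t l)) * ikMatrix q s t i k) =
      (Lagrange.nodalWeight univ s k * ∏ l, (s k - t l)) * (t i - s k)⁻¹ -
        (Lagrange.nodalWeight univ s k * ∏ l, (s k - t l)) * (q ^ 2 * t i - s k)⁻¹ := by
    intro k
    have e1 := sub_ne_zero.mpr (hts i k)
    have e2 := hqts i k
    have e3 : q ^ 2 * t i - s k = q * (q * t i - q⁻¹ * s k) := by field_simp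
    have e4 : t i * q ^ 2 - s k ≠ 0 := by
      rw [mul_comm, e3]
      exact mul_ne_zero hq e2
    rw [ikMatrix, Matrix.of_apply, e3]
    field_simp
    ring
  simp only [h4, sum_sub_distrib]
  linear_combination -h1

theorem izerginKorepin_eq (s t : Fin n → ℂ) : izerginKorepin q s t =
    (∏ i, t i) * (∏ i, ∏ j, (q * t i - q⁻¹ * s j)) /
      ((∏ i, ∏ j ∈ Ioi i, (t i - t j)) * ∏ i, ∏ j ∈ Ioi i, (s j - s i)) *
        (ikMatrix q s t).det := by
  rw [izerginKorepin, ikMatrix]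
  simp only [prod_mul_distrib]

/-- The first column is replaced by a combination of all columns whose entries factorize by
`ikMatrix_mul_sum`. Laplace expansion along it gives minors that are determinants of the same kind,
with `s 0` and one `t i` removed. -/
theorem izerginKorepin_succ (hq : q ≠ 0) (s t : Fin (n + 1) → ℂ) (hs : Function.Injective s)
    (ht : Function.Injective t) (ht0 : ∀ i, t i ≠ 0) (hts : ∀ i j, t i ≠ s j)
    (hqts : ∀ i j, q * t i - q⁻¹ * s j ≠ 0) :
    izerginKorepin q s t = ∑ i, gL q (t i) (s 0) * (∏ k, fFun q (t i) (t (i.succAbove k))) *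
      (∏ k, fFun q (t (i.succAbove k)) (s 0)) *
        izerginKorepin q (fun k => s k.succ) fun k => t (i.succAbove k) := by
  set ρ : Fin (n + 1) → ℂ := fun k => Lagrange.nodalWeight univ s k * ∏ l, (s k - t l) with hρ
  -- Replacing column 0 by the combination with weights `ρ` multiplies the determinant by `ρ 0`; the
  -- constant `C` below is the prefactor of the determinant divided by `ρ 0`.
  have hdet := Matrix.det_updateCol_sum (ikMatrix q s t) 0 ρ
  rw [Matrix.det_succ_column_zero] at hdet
  set C : ℂ := -((∏ k, t k) * (∏ l, (q * t l - q⁻¹ * s 0)) *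
    (∏ l, ∏ k : Fin n, (q * t l - q⁻¹ * s k.succ)) / ((∏ l, (t l - s 0)) *
      (∏ a, ∏ b ∈ Ioi a, (t a - t b)) *
        ∏ a : Fin n, ∏ b ∈ Ioi a, (s b.succ - s a.succ))) with hC
  have hw : ∏ k : Fin n, (s k.succ - s 0) ≠ 0 :=
    prod_ne_zero_iff.mpr fun k _ => sub_ne_zero.mpr fun h => Fin.succ_ne_zero k (hs h)
  have hz : ∏ l, (t l - s 0) ≠ 0 := prod_ne_zero_iff.mpr fun l _ => sub_ne_zero.mpr (hts l 0)
  have hρ0 : ρ 0 = -(∏ l, (t l - s 0)) / ∏ k : Fin n, (s k.succ - s 0) := by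
    have e1 : Lagrange.nodalWeight univ s 0 = (∏ k : Fin n, (s 0 - s k.succ))⁻¹ := by
      rw [Lagrange.nodalWeight, ← Finset.prod_inv_distrib, ← compl_singleton, ← Fin.image_succ_univ,
        prod_image (Fin.succ_injective n).injOn]
    have e2 : ∏ k : Fin n, (s 0 - s k.succ) = (-1) ^ n * ∏ k : Fin n, (s k.succ - s 0) := by
      rw [← Fin.prod_const, ← prod_mul_distrib]
      exact prod_congr rfl fun k _ => by ring
    have e3 : ∏ l, (s 0 - t l) = (-1) ^ (n + 1) * ∏ l, (t l - s 0) := by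
      rw [← Fin.prod_const, ← prod_mul_distrib]
      exact prod_congr rfl fun k _ => by ring
    rw [hρ]
    simp only
    rw [e1, e2, e3, pow_succ]
    field_simp
  have hL : izerginKorepin q s t = C * (ρ 0 • (ikMatrix q s t).det) := by
    rw [izerginKorepin_eq, hρ0, hC, Fin.prod_univ_succ (fun i => ∏ j ∈ Ioi i, (s j - s i)),
      Fin.prod_Ioi_zero]
    simp only [Fin.prod_univ_succ (fun j => q * t _ - q⁻¹ * s j), prod_mul_distrib,
      Fin.prod_Ioi_succ, smul_eq_mul]
    field_simp
  rw [hL, ← hdet, mul_sum]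
  refine sum_congr rfl fun i _ => ?_
  have hsub : ((ikMatrix q s t).updateCol 0 fun k => ∑ j, ρ j • ikMatrix q s t k j).submatrix
      i.succAbove Fin.succ = ikMatrix q (fun k => s k.succ) fun k => t (i.succAbove k) := by
    ext a b
    rw [Matrix.submatrix_apply, Matrix.updateCol_ne (Fin.succ_ne_zero b)]
    rfl
  rw [hsub, Matrix.updateCol_self, izerginKorepin_eq]
  have hy := ikMatrix_mul_sum hq s t hs hts hqts i
  simp only [smul_eq_mul]
  set y := ∑ k, ρ k * ikMatrix q s t i k with hy'
  have hy2 : y = -((∏ k, (q * t i - q⁻¹ * t k)) / ∏ k, (q * t i - q⁻¹ * s k)) / t i := by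
    rw [eq_div_iff (ht0 i), mul_comm, ← hy]
  have hΔ := prod_Ioi_succAbove t i
  have hΔ' : ∏ a : Fin n, ∏ b ∈ Ioi a, (t (i.succAbove a) - t (i.succAbove b)) ≠ 0 :=
    prod_ne_zero_iff.mpr fun a _ => prod_ne_zero_iff.mpr fun b hb => sub_ne_zero.mpr fun h =>
      (mem_Ioi.mp hb).ne (Fin.succAbove_right_injective (ht h))
  have hV : ∏ a : Fin n, ∏ b ∈ Ioi a, (s b.succ - s a.succ) ≠ 0 :=
    prod_ne_zero_iff.mpr fun a _ => prod_ne_zero_iff.mpr fun b hb => sub_ne_zero.mpr fun h =>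
      (mem_Ioi.mp hb).ne' (Fin.succ_injective _ (hs h))
  have hd : ∏ k, (t i - t (i.succAbove k)) ≠ 0 := prod_ne_zero_iff.mpr fun k _ =>
    sub_ne_zero.mpr fun h => Fin.succAbove_ne i k (ht h).symm
  rw [Fin.prod_univ_succAbove _ i] at hz
  have hz1 := left_ne_zero_of_mul hz
  have hz2 := right_ne_zero_of_mul hz
  have hq0 := hqts i 0
  have hq1 : ∏ k : Fin n, (q * t i - q⁻¹ * s k.succ) ≠ 0 :=
    prod_ne_zero_iff.mpr fun k _ => hqts i _
  have hti := ht0 i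
  rw [hy2, hC, hΔ, Fin.prod_univ_succ (fun k => q * t i - q⁻¹ * s k),
    Fin.prod_univ_succAbove (fun k => q * t i - q⁻¹ * t k) i, Fin.prod_univ_succAbove t i,
    Fin.prod_univ_succAbove (fun l => q * t l - q⁻¹ * s 0) i,
    Fin.prod_univ_succAbove (fun l => ∏ k : Fin n, (q * t l - q⁻¹ * s k.succ)) i,
    Fin.prod_univ_succAbove (fun l => t l - s 0) i]
  simp only [fFun, prod_div_distrib, gL, gFun]
  -- The Laplace sign cancels against the sign from `prod_Ioi_succAbove`; what remains is an
  -- identity of rational monomials in the abstracted products.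
  have hsign : ((-1 : ℂ) ^ (i : ℕ)) ^ 2 = 1 := by rw [← pow_mul, mul_comm, pow_mul]; norm_num
  generalize (-1 : ℂ) ^ (i : ℕ) = σ at *
  have hσ : σ ≠ 0 := fun h => by simp [h] at hsign
  generalize ∏ a : Fin n, ∏ b ∈ Ioi a, (t (i.succAbove a) - t (i.succAbove b)) = X1 at *
  generalize ∏ a : Fin n, ∏ b ∈ Ioi a, (s b.succ - s a.succ) = X2 at *
  generalize ∏ k, (t i - t (i.succAbove k)) = X3 at *
  generalize ∏ k, (t (i.succAbove k) - s 0) = X4 at *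
  generalize ∏ k : Fin n, (q * t i - q⁻¹ * s k.succ) = X5 at *
  generalize ∏ k, (q * t i - q⁻¹ * t (i.succAbove k)) = X6 at *
  generalize ∏ k, (q * t (i.succAbove k) - q⁻¹ * s 0) = X7 at *
  generalize ∏ k, t (i.succAbove k) = X8 at *
  generalize ∏ l, ∏ k : Fin n, (q * t (i.succAbove l) - q⁻¹ * s k.succ) = X9 at *
  generalize (ikMatrix q (fun k => s k.succ) fun k => t (i.succAbove k)).det = X10 at *
  have e : q * t i - q⁻¹ * t i = (q - q⁻¹) * t i := by ring
  rw [e]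
  generalize q * t i - q⁻¹ * s 0 = X11 at *
  generalize t i - s 0 = X12 at *
  generalize q - q⁻¹ = X13 at *
  field_simp

theorem eraseIdx_ofFn {α : Type*} : ∀ {n : ℕ} (t : Fin (n + 1) → α) (i : Fin (n + 1)),
    (List.ofFn t).eraseIdx i = List.ofFn fun k => t (i.succAbove k)
  | 0, t, i => by
    rw [Subsingleton.elim (α := Fin 1) i 0]
    simp
  | n + 1, t, i => by
    rw [List.ofFn_succ]
    refine Fin.cases ?_ (fun j => ?_) i
    · simp
    · rw [Fin.val_succ, List.eraseIdx_cons_succ, eraseIdx_ofFn (fun k => t k.succ) j,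
        List.ofFn_succ (f := fun k => t (j.succ.succAbove k))]
      simp

variable {m : ℕ} {H : Type*} [AddCommGroup H] [Module (LamRing m) H] [Module ℂ H]
  [IsScalarTower ℂ (LamRing m) H]

/-- For one color the recursion at position 0 has only `p = 0`, with no denominators, and coincides
with `izerginKorepin_succ`; both sides equal 1 without variables. -/
theorem IsFreeModel.highCoeff_eq_izerginKorepin (hq : q ≠ 0) {ι : Fin (1 + 1) → Fin m}
    {T : Fin (1 + 1) → Fin (1 + 1) → ℂ → Module.End (LamRing m) H} {vac : H}
    {bra : Module.Dual (LamRing m) H} (hT : IsFreeModel q ι T vac bra) :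
    ∀ {r : ℕ} (s t : Fin r → ℂ), Letters (fun _ : Fin 1 => List.ofFn s) (fun _ => List.ofFn t) →
      (∀ i j, q * t i - q⁻¹ * s j ≠ 0) →
      highCoeff q 1 ι T vac bra (fun _ => List.ofFn s) (fun _ => List.ofFn t) =
        izerginKorepin q s t
  | 0, s, t, _, _ => by
    have : ∀ l : List ℂ, (fun _ : Fin 1 => l) = (Fin.cons l Fin.elim0 : Fin (0 + 1) → List ℂ) :=
      fun l => funext fun k => by rw [Subsingleton.elim k 0]; rfl
    rw [this, this, List.ofFn_zero, List.ofFn_zero]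
    refine (highCoeff_cons_nil ι T vac bra _ _).trans ?_
    rw [hT.lowerBlock.highCoeff_zero]
    simp [izerginKorepin]
  | r + 1, s, t, h, hqts => by
    have hadm : ∀ l : Fin 1 → List ℂ, Admissible q l := fun l k k' hk => by
      omega
    have hcons : ∀ l : List ℂ, (fun _ : Fin 1 => l) =
        (Fin.cons l Fin.elim0 : Fin (0 + 1) → List ℂ) :=
      fun l => funext fun k => by rw [Subsingleton.elim k 0]; rfl
    have hs := List.nodup_ofFn.mp (h.left.nodup 0)
    have ht := List.nodup_ofFn.mp (h.right.nodup 0)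
    have hms : ∀ j, s j ∈ List.ofFn s := fun j => (List.mem_ofFn' s _).mpr ⟨j, rfl⟩
    have hmt : ∀ j, t j ∈ List.ofFn t := fun j => (List.mem_ofFn' t _).mpr ⟨j, rfl⟩
    have hrec := hT.highCoeff_recursion hq h (hadm _) (hadm _) (i := 0) (by simp)
    rw [hrec, izerginKorepin_succ hq s t hs ht (fun i => h.right.mem 0 _ (hmt i))
      (fun i j h' => h.disj 0 0 _ (hms j) (h' ▸ hmt i)) hqts]
    rw [Fin.sum_univ_one, hcons, hcons,
      sum_filter_choices_zero _ (by simp), sum_choices_zero, List.length_ofFn,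
      Finset.sum_range]
    refine sum_congr rfl fun i _ => ?_
    have hes : (List.ofFn s).eraseIdx 0 = List.ofFn fun k => s k.succ := by
      rw [List.ofFn_succ, List.eraseIdx_cons_zero]
    have hgs : (List.ofFn s).getD 0 0 = s 0 := by rw [List.ofFn_succ]; rfl
    have hgt : (List.ofFn t).getD i 0 = t i := by
      rw [List.getD_eq_getElem _ _ (by rw [List.length_ofFn]; exact i.2), List.getElem_ofFn]
    have hf : ∀ (a : ℂ) (b : Fin r → ℂ), fProd q [a] (List.ofFn b) = ∏ k, fFun q a (b k) := by
      intro a b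
      simp [fProd, List.map_ofFn, List.prod_ofFn]
    have hf' : ∀ (a : ℂ) (b : Fin r → ℂ), fProd q (List.ofFn b) [a] = ∏ k, fFun q (b k) a := by
      intro a b
      simp [fProd, List.map_ofFn, List.prod_ofFn]
    have hch : chosen (Fin.cons (List.ofFn s) Fin.elim0 : Fin (0 + 1) → List ℂ)
        (Fin.cons 0 0 : Fin (0 + 1) → ℕ) 0 = s 0 := hgs
    have hcol : colorOr (Fin.elim0 : Fin 0 → List ℂ) 0 = [] := by simp [colorOr]
    have hsub : ∀ j : Fin (r + 1), ∀ u : Fin (r + 1) → ℂ,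
        (List.ofFn fun k => u (j.succAbove k)).Sublist (List.ofFn u) := fun j u => by
      rw [← eraseIdx_ofFn]
      exact List.eraseIdx_sublist ..
    have ih := IsFreeModel.highCoeff_eq_izerginKorepin hq hT (fun k => s k.succ)
      (fun k => t (i.succAbove k)) (h.mono (fun _ => by simp) fun _ => hsub i t)
      fun a b => hqts _ _
    rw [recCoeff_eq, dualCoeff_zero, fcCoeff_zero, remaining_cons_zero, remaining_cons_zero,
      eraseIdx_ofFn, hes, hch, hgs, hgt, hcol, fProd_nil_left, fProd_nil_right, ← hcons, ← hcons,
      ih, hf]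
    beta_reduce
    rw [hf', inv_one, one_mul, div_one]
    ring

end IzerginKorepin

theorem mainTheorem6 (q : ℂ) (hq : q ≠ 0) :
    -- the recursion over the first color, for models with `N = n + 1` colors
    (∀ (n : ℕ) (H : Type*) [AddCommGroup H] [Module (LamRing (n + 1 + 1)) H]
      (M : GenModel q (n + 1 + 1) H) (s t : Fin (n + 1) → List ℂ), IsGeneric q s t →
      (∀ k, (s k).length = (t k).length) →
      ∀ i : ℕ, i < (s 0).length →
        M.Z s t = ∑ p : Fin (n + 1), ∑ I ∈ choices s p with I 0 = i, ∑ J ∈ choices t p,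
          recCoeff q s t p I J * M.Z (remaining s p I) (remaining t p J)) ∧
    -- without variables of the first color, `Z` is the highest coefficient of rank one less
    (∀ (N : ℕ) (H H' : Type*) [AddCommGroup H] [Module (LamRing (N + 1 + 1)) H]
      [AddCommGroup H'] [Module (LamRing (N + 1)) H']
      (M : GenModel q (N + 1 + 1) H) (M' : GenModel q (N + 1) H') (s t : Fin N → List ℂ),
      IsGeneric q s t → (∀ k, (s k).length = (t k).length) →
        M.Z (Fin.cons [] s : Fin (N + 1) → List ℂ) (Fin.cons [] t : Fin (N + 1) → List ℂ) =
          M'.Z s t) ∧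
    -- for one color, `Z` is the Izergin-Korepin determinant
    (∀ (H : Type*) [AddCommGroup H] [Module (LamRing (1 + 1)) H] (M : GenModel q (1 + 1) H)
      (r : ℕ) (s t : Fin r → ℂ),
      IsGeneric q (fun _ : Fin 1 => List.ofFn s) (fun _ : Fin 1 => List.ofFn t) →
      (∀ i j, q * t i - q⁻¹ * s j ≠ 0) →
        M.Z (fun _ : Fin 1 => List.ofFn s) (fun _ : Fin 1 => List.ofFn t) =
          izerginKorepin q s t) := by
  refine ⟨?_, ?_, ?_⟩
  · intro n H _ _ M s t h _ i hi
    obtain ⟨_, _⟩ := GenModel.exists_module (n + 1 + 1) H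
    simp only [GenModel.Z_eq_highCoeff]
    exact M.isFreeModel.highCoeff_recursion hq h.letters h.admissible_left h.admissible_right hi
  · intro N H H' _ _ _ _ M M' s t h hl
    obtain ⟨_, _⟩ := GenModel.exists_module (N + 1 + 1) H
    obtain ⟨_, _⟩ := GenModel.exists_module (N + 1) H'
    rw [GenModel.Z_eq_highCoeff, GenModel.Z_eq_highCoeff, highCoeff_cons_nil]
    exact M.isFreeModel.lowerBlock.highCoeff_unique hq M'.isFreeModel h.letters h.admissible_left
      h.admissible_right hl
  · intro H _ _ M r s t h hqts
    obtain ⟨_, _⟩ := GenModel.exists_module (1 + 1) H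
    rw [GenModel.Z_eq_highCoeff]
    exact M.isFreeModel.highCoeff_eq_izerginKorepin hq s t h.letters hqts
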